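/- **Setting.** Let $(\Delta_0,\mathcal A,m)$ be a finite measure space with $m(\Delta_0)>0$ and let $\mathcal P_0$ be a countable ($m$ mod 0) measurable partition of $\Delta_0$. Let $F:\Delta_0\to\Delta_0$ be a weak Gibbs Markov map with respect to $\mathcal P_0$, that is: $F$ is measurable, injective with measurable inverse on each $\omega\in\mathcal P_0$, and each $F(\omega)$ is ($m$ mod 0) a union of elements of $\mathcal P_0$; the partitions $\bigvee_{i<n}F^{-i}\mathcal P_0$ generate $\mathcal A$ ($m$ mod 0), and $\bigvee_{i\ge0}F^{-i}\mathcal P_0$ is the partition into points; there is a measurable $J_F>0$ with $m(F(A))=\int_A J_F\,dm$ for measurable $A\subset\omega\in\mathcal P_0$; there are $C_F>0$ and $0<\beta<1$ with $\log\frac{J_F(x)}{J_F(y)}\le C_F\beta^{s(F(x),F(y))}$ for $x,y\in\omega\in\mathcal P_0$, where $s(x,y)$ is the least $n\ge0$ such that $F^n(x),F^n(y)$ do not lie in a common element of $\mathcal P_0$ ($s=\infty$ if there is none, $\beta^\infty=0$); and $\inf_{\omega}m(F(\omega))>0$. Let $R:\Delta_0\to\{1,2,\dots\}$ be measurable, integrable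 and constant on each element of $\mathcal P_0$. Assume that $F$ is aperiodic (for all $\omega_1,\omega_2\in\mathcal P_0$, $m(\omega_1\cap F^{-n}(\omega_2))>0$ for all large $n$) and that there is a coprime block ($N\ge2$ and $\omega_1,\dots,\omega_N\in\mathcal P_0$ with $\gcd_i R(\omega_i)=1$ and $F(\omega_i)\supseteq\omega_1\cup\dots\cup\omega_N$ mod 0 for all $i$). Let $\Delta=\{(x,\ell):0\le\ell<R(x)\}$ carry the measure, again denoted $m$, that is the copy of $m|_{\{R>\ell\}}$ on the level $\ell$. Identify $\Delta_0$ with the level $0$, and let $T(x,\ell)=(x,\ell+1)$ if $\ell+1<R(x)$ and $T(x,\ell)=(F(x),0)$ if $\ell+1=R(x)$. Let $\eta$ be the partition of $\Delta$ induced on the levels by $\mathcal P_0$, and put $s((x,\ell),(y,\ell))=s(x,y)$ and $s=0$ for points on different levels. Let $J_T(x,\ell)=1$ if $\ell+1<R(x)$ and $J_T(x,\ell)=J_F(x)$ otherwise; Jacobians of iterates are the corresponding products along orbits. For bounded $\varphi:\Delta\to\mathbb R$ let $v_n(\varphi)=\sup\{|\varphi(x)-\varphi(y)|:s(x,y)\ge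 n\}$. Fix $C''>0$. Let $\mathcal I^+(\Delta)$ be the set of bounded $\varphi$ with $v_n(\varphi)\to0$ for which there is $C'_\varphi>0$ such that $\varphi(x)>0$ and $|\varphi(x)/\varphi(y)-1|\le C'_\varphi v_{s(x,y)}(\varphi)+C''\beta^{s(x,y)}$ for all $x,y\in\omega\in\eta$. Let $\hat R(x)=\min\{n\ge0:T^n(x)\in\Delta_0\}$ and fix $n_0\ge1$ such that for some $\gamma_0>0$, $m(T^{-n}(\Delta_0)\cap F(\omega))\ge\gamma_0$ for all $\omega\in\mathcal P_0$, $n\ge n_0$. On $\Delta\times\Delta$ let $\tau_0=0$ and $\tau_{k+1}=n_0+\tau_k+\hat R\circ T^{n_0+\tau_k}\circ\pi$, where $\pi$ is the first coordinate for $k$ even and the second for $k$ odd. Let $S(x,y)$ be the least $\tau_i(x,y)$, $i\ge2$, with $T^{\tau_i}(x),T^{\tau_i}(y)\in\Delta_0$. Let $\widetilde T=(T\times T)^S$, let $\widetilde\xi$ be the (mod 0) partition of $\Delta\times\Delta$ in which two points lie in the same element when $S$ has the same finite value at both and, at each time $0\le t<S$, both the first and the second coordinates of their images under $(T\times T)^t$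 lie in common elements of $\eta$, and let $\Omega_i(u)$ be the element of $\bigvee_{j<i}\widetilde T^{-j}\widetilde\xi$ containing $u$. For probability measures $\lambda_1,\lambda_2$ on $\Delta$ with densities $\varphi_1=\frac{d\lambda_1}{dm},\varphi_2=\frac{d\lambda_2}{dm}\in\mathcal I^+(\Delta)$ put $P=\lambda_1\times\lambda_2$, $\Phi(x,y)=\varphi_1(x)\varphi_2(y)$, $v_n(\Phi)=\max\{v_n(\varphi_1),v_n(\varphi_2)\}$, and let $C_\Phi=C_1+C_2$, where $C_1,C_2\ge0$ are constants with $$\Bigl|\log\tfrac{\varphi_i(x)}{\varphi_i(y)}\Bigr|\le C_i\,v_{s(x,y)}(\Phi)+C''\beta^{s(x,y)}\qquad(x,y\in\omega\in\eta,\ i=1,2).$$ Let $(\varepsilon'_i)_{i\ge1}$ be any sequence in $(0,\frac12]$ such that, for all $i\ge1$, $$v_i(\Phi)\prod_{j=1}^i(1+\varepsilon'_j)\le D_3,\qquad \sum_{j=1}^i\Bigl(\prod_{k=j}^i(1+\varepsilon'_k)\Bigr)\beta^{\,i-j+1}\le D_3 .$$ For $\bar\delta>0$ put $\varepsilon_i=\bar\delta\varepsilon_i'$,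 $\widetilde\Phi_0=\Phi$ and, for $i\ge1$, $\widetilde\Phi_i(u)=\widetilde\Phi_{i-1}(u)-\varepsilon_iJ_{\widetilde T^i}(u)\inf_{v\in\Omega_i(u)}\frac{\widetilde\Phi_{i-1}(v)}{J_{\widetilde T^i}(v)}$. **Proposition.** Given the tower, $n_0$, $C''$ and real numbers $C,v,D_3$, there are constants $0<\bar\delta\le1$, $D_4>1$ and $D_5>0$ such that for all $\lambda_1,\lambda_2$ with densities in $\mathcal I^+(\Delta)$, $C_\Phi\le C$ and $v_0(\Phi)\le v$, and all sequences $(\varepsilon'_i)$ as above: 1. $\widetilde\Phi_i\le\bigl(1-\frac{\varepsilon_i}{D_4}\bigr)\widetilde\Phi_{i-1}$ for all $i\ge1$, at every point that lies in an element of $\bigvee_{j<i}\widetilde T^{-j}\widetilde\xi$; 2. for all $n\ge1$, with $|\cdot|$ the total variation norm, $$\left|T^n_*\lambda_1-T^n_*\lambda_2\right|\le 2P\{S>n\}+D_5\sum_{i=1}^n\prod_{j=1}^i\Bigl(1-\frac{\varepsilon_j}{D_4}\Bigr)(i+1)\,(m\times m)\Bigl\{S>\frac n{i+1}\Bigr\}.$$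 -/

import Mathlib

open MeasureTheory Set Filter Topology
open scoped ENNReal

noncomputable section

namespace WGM

/-! ### Weak Gibbs Markov maps

`X` plays the role of the base, `F : X → X` is the map, and `ω : ι → Set X` lists the elements of
the (mod 0) partition of the base. -/

/-- `x` and `y` lie in a common element of the partition. -/
def SameElt {X ι : Type*} (ω : ι → Set X) (x y : X) : Prop :=
  ∃ i, x ∈ ω i ∧ y ∈ ω i

/-- Separation time: the least `n ≥ 0` such that `F^n x` and `F^n y` do not lie in a common element
of the partition (`⊤` if there is no such `n`). -/
def sep {X ι : Type*} (F : X → X) (ω : ι → Set X) (x y : X) : ℕ∞ :=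
  sInf ((fun n : ℕ => (n : ℕ∞)) '' {n : ℕ | ¬ SameElt ω (F^[n] x) (F^[n] y)})

/-- `b ^ s` for `s ∈ ℕ ∪ {∞}`, with `b ^ ∞ = 0`; used for `0 < b < 1`. -/
def epow (b : ℝ) (s : ℕ∞) : ℝ :=
  if s = ⊤ then 0 else b ^ s.toNat

/-- The elements of the partition `⋁_{k < n} F^{-k}(ω)`. -/
def cylinders {X ι : Type*} (F : X → X) (ω : ι → Set X) (n : ℕ) : Set (Set X) :=
  {A | ∃ a : Fin n → ι, A = ⋂ k : Fin n, F^[(k : ℕ)] ⁻¹' ω (a k)}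

/-- `F` is a weak Gibbs Markov map with respect to the `m` mod 0 partition `ω`, with Jacobian `J`
and with the constant `β` in the Gibbs property. -/
structure IsWGM {X ι : Type*} [MeasurableSpace X] (m : Measure X) (F : X → X) (ω : ι → Set X)
    (J : X → ℝ) (β : ℝ) : Prop where
  measurable_map : Measurable F
  measurableSet_elt : ∀ i, MeasurableSet (ω i)
  disjoint : Pairwise fun i j => Disjoint (ω i) (ω j)
  cover : m (⋃ i, ω i)ᶜ = 0
  /-- `F` is injective on each element, with measurable inverse -/
  injOn : ∀ i, InjOn F (ω i)
  measurableSet_image : ∀ i, ∀ A ⊆ ω i, MeasurableSet A → MeasurableSet (F '' A)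
  /-- Markov -/
  markov : ∀ i, ∃ I : Set ι, F '' ω i =ᵐ[m] ⋃ j ∈ I, ω j
  /-- Separability: the cylinders generate the σ-algebra mod 0 -/
  generates : ∀ A, MeasurableSet A → ∃ B,
    MeasurableSet[MeasurableSpace.generateFrom {E | ∃ n ≥ 1, E ∈ cylinders F ω n}] B ∧ A =ᵐ[m] B
  /-- Separability: the partition `⋁_k F^{-k}(ω)` is the partition into single points -/
  separates : ∀ x y, (∀ n : ℕ, SameElt ω (F^[n] x) (F^[n] y)) → x = y
  /-- Nonsingular -/
  measurable_jac : Measurable J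
  jac_pos : ∀ x, 0 < J x
  measure_image : ∀ i, ∀ A ⊆ ω i, MeasurableSet A →
    m (F '' A) = ∫⁻ x in A, ENNReal.ofReal (J x) ∂m
  /-- Gibbs -/
  beta_pos : 0 < β
  beta_lt_one : β < 1
  gibbs : ∃ C : ℝ, 0 < C ∧ ∀ i, ∀ x ∈ ω i, ∀ y ∈ ω i,
    Real.log (J x / J y) ≤ C * epow β (sep F ω (F x) (F y))
  /-- Long branches -/
  long_branches : ∃ δ : ℝ, 0 < δ ∧ ∀ i, ENNReal.ofReal δ ≤ m (F '' ω i)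

/-- Aperiodicity. -/
def Aperiodic {X ι : Type*} [MeasurableSpace X] (m : Measure X) (F : X → X) (ω : ι → Set X) :
    Prop :=
  ∀ i j, ∃ k₀ : ℕ, ∀ n ≥ k₀, 0 < m (ω i ∩ F^[n] ⁻¹' ω j)

/-- `R` is a measurable positive integer valued function, constant on the partition elements. -/
structure IsReturnTime {X ι : Type*} [MeasurableSpace X] (R : X → ℕ) (ω : ι → Set X) : Prop where
  measurable : Measurable R
  const : ∀ i, ∀ x ∈ ω i, ∀ y ∈ ω i, R x = R y

/-- Existence of a coprime block `ω (a 0), …, ω (a (N-1))`; `r k` is the value of `R` on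
`ω (a k)`. -/
def HasCoprimeBlock {X ι : Type*} [MeasurableSpace X] (m : Measure X) (F : X → X) (R : X → ℕ)
    (ω : ι → Set X) : Prop :=
  ∃ N : ℕ, 2 ≤ N ∧ ∃ (a : Fin N → ι) (r : Fin N → ℕ),
    (∀ k, ∀ x ∈ ω (a k), R x = r k) ∧ Finset.univ.gcd r = 1 ∧
    ∀ k, (⋃ l, ω (a l)) ≤ᵐ[m] F '' ω (a k)

/-! ### The tower -/

/-- The tower `Δ = {(x, ℓ) : 0 ≤ ℓ < R x}`. -/
abbrev Tower {X : Type*} (R : X → ℕ) : Type _ := {p : X × ℕ // p.2 < R p.1}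

/-- The reference measure on the tower: a copy of `m` restricted to `{R > ℓ}` on each level `ℓ`. -/
def towerMeasure {X : Type*} [MeasurableSpace X] (m : Measure X) (R : X → ℕ) :
    Measure (Tower R) :=
  (m.prod Measure.count).comap Subtype.val

/-- The tower map `T`. -/
def towerMap {X : Type*} (F : X → X) (R : X → ℕ) (hR : ∀ x, 0 < R x) (p : Tower R) : Tower R :=
  if h : p.1.2 + 1 < R p.1.1 then ⟨(p.1.1, p.1.2 + 1), h⟩ else ⟨(F p.1.1, 0), hR (F p.1.1)⟩

/-- The ground level `Δ₀` of the tower. -/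
def base {X : Type*} (R : X → ℕ) : Set (Tower R) := {p | p.1.2 = 0}

/-- `p` and `q` lie in a common element of the partition `η = {Δ_{ℓ,i}}` of the tower. -/
def TowerSame {X ι : Type*} {R : X → ℕ} (ω : ι → Set X) (p q : Tower R) : Prop :=
  p.1.2 = q.1.2 ∧ SameElt ω p.1.1 q.1.1

/-- The separation time on the tower. -/
def towerSep {X ι : Type*} {R : X → ℕ} (F : X → X) (ω : ι → Set X) (p q : Tower R) : ℕ∞ :=
  if p.1.2 = q.1.2 then sep F ω p.1.1 q.1.1 else 0

/-- The variation `v_n(φ) = sup {|φ(p) - φ(q)| : s(p, q) ≥ n}` of a bounded function `φ`. -/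
def variation {X ι : Type*} {R : X → ℕ} (F : X → X) (ω : ι → Set X) (φ : Tower R → ℝ)
    (n : ℕ∞) : ℝ :=
  sSup {r | ∃ p q : Tower R, n ≤ towerSep F ω p q ∧ r = |φ p - φ q|}

/-- The space `I(Δ)` of bounded functions whose variations tend to zero. -/
def InI {X ι : Type*} {R : X → ℕ} (F : X → X) (ω : ι → Set X) (φ : Tower R → ℝ) : Prop :=
  (∃ K : ℝ, ∀ p, |φ p| ≤ K) ∧ Tendsto (fun n : ℕ => variation F ω φ n) atTop (𝓝 0)

/-- The space `I⁺(Δ)`, for the fixed constants `β` and `C''`. -/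
def InIPlus {X ι : Type*} {R : X → ℕ} (F : X → X) (ω : ι → Set X) (β C'' : ℝ)
    (φ : Tower R → ℝ) : Prop :=
  InI F ω φ ∧ ∃ C' : ℝ, 0 < C' ∧ ∀ p q : Tower R, TowerSame ω p q →
    0 < φ p ∧ |φ p / φ q - 1| ≤
      C' * variation F ω φ (towerSep F ω p q) + C'' * epow β (towerSep F ω p q)

/-- `v_n(Φ) = max {v_n(φ₁), v_n(φ₂)}` for `Φ(x, y) = φ₁(x) φ₂(y)`. -/
def variation₂ {X ι : Type*} {R : X → ℕ} (F : X → X) (ω : ι → Set X) (φ₁ φ₂ : Tower R → ℝ)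
    (n : ℕ∞) : ℝ :=
  max (variation F ω φ₁ n) (variation F ω φ₂ n)

/-! ### Simultaneous returns -/

/-- The return time `R̂` to the ground level (it is `0` on the ground level). -/
def retTime {X : Type*} {R : X → ℕ} (T : Tower R → Tower R) (p : Tower R) : ℕ :=
  sInf {n : ℕ | T^[n] p ∈ base R}

/-- The defining property of the waiting time `n₀`: for some `γ₀ > 0`,
`m (T^{-n}(Δ₀) ∩ F(ω)) ≥ γ₀` for all partition elements `ω` and all `n ≥ n₀`. -/
def IsWaitingTime {X ι : Type*} [MeasurableSpace X] (m : Measure X) (F : X → X) (R : X → ℕ)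
    (hR : ∀ x, 0 < R x) (ω : ι → Set X) (n₀ : ℕ) : Prop :=
  0 < n₀ ∧ ∃ γ₀ : ℝ, 0 < γ₀ ∧ ∀ i, ∀ n ≥ n₀,
    ENNReal.ofReal γ₀ ≤
      m {x | x ∈ F '' ω i ∧ (towerMap F R hR)^[n] ⟨(x, 0), hR x⟩ ∈ base R}

/-- The stopping times `τ_k`; the odd ones use the first coordinate, the even ones the second. -/
def tau {X : Type*} {R : X → ℕ} (T : Tower R → Tower R) (n₀ : ℕ) :
    ℕ → Tower R × Tower R → ℕ
  | 0, _ => 0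
  | k + 1, u =>
      n₀ + tau T n₀ k u +
        retTime T (T^[n₀ + tau T n₀ k u] (if k % 2 = 0 then u.1 else u.2))

/-- The simultaneous return time `S`: the least `τ_i`, `i ≥ 2`, at which both coordinates are in
the ground level (`⊤` if there is none). -/
def simRet {X : Type*} {R : X → ℕ} (T : Tower R → Tower R) (n₀ : ℕ) (u : Tower R × Tower R) :
    ℕ∞ :=
  sInf ((fun i : ℕ => (tau T n₀ i u : ℕ∞)) ''
    {i : ℕ | 2 ≤ i ∧ T^[tau T n₀ i u] u.1 ∈ base R ∧ T^[tau T n₀ i u] u.2 ∈ base R})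

/-- The induced map `T̃ = (T × T)^S` (only used where `S` is finite). -/
def indMap {X : Type*} {R : X → ℕ} (T : Tower R → Tower R) (n₀ : ℕ) (u : Tower R × Tower R) :
    Tower R × Tower R :=
  (T^[(simRet T n₀ u).toNat] u.1, T^[(simRet T n₀ u).toNat] u.2)

/-- `u` and `v` lie in a common element of the partition `ξ̃`: `S` is finite and equal at `u` and
`v`, and the orbits of the coordinates visit the same elements of `η` before time `S`. -/
def SameXi {X ι : Type*} {R : X → ℕ} (T : Tower R → Tower R) (n₀ : ℕ) (ω : ι → Set X)
    (u v : Tower R × Tower R) : Prop :=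
  simRet T n₀ u ≠ ⊤ ∧ simRet T n₀ u = simRet T n₀ v ∧
    ∀ t < (simRet T n₀ u).toNat,
      TowerSame ω (T^[t] u.1) (T^[t] v.1) ∧ TowerSame ω (T^[t] u.2) (T^[t] v.2)

/-- The element `Ω_i(u)` of `ξ̃_i = ⋁_{j < i} T̃^{-j}(ξ̃)` that contains `u` (empty if `u` is in no
element). -/
def xiElt {X ι : Type*} {R : X → ℕ} (T : Tower R → Tower R) (n₀ : ℕ) (ω : ι → Set X) (i : ℕ)
    (u : Tower R × Tower R) : Set (Tower R × Tower R) :=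
  {v | ∀ j < i, SameXi T n₀ ω ((indMap T n₀)^[j] u) ((indMap T n₀)^[j] v)}

/-- The Jacobian of the tower map. -/
def towerJac {X : Type*} {R : X → ℕ} (J : X → ℝ) (p : Tower R) : ℝ :=
  if p.1.2 + 1 < R p.1.1 then 1 else J p.1.1

/-- The Jacobian of `T^n`. -/
def iterJac {X : Type*} {R : X → ℕ} (T : Tower R → Tower R) (J : X → ℝ) (n : ℕ) (p : Tower R) :
    ℝ :=
  ∏ t ∈ Finset.range n, towerJac J (T^[t] p)

/-- The Jacobian of `T̃^i`. -/
def indJac {X : Type*} {R : X → ℕ} (T : Tower R → Tower R) (n₀ : ℕ) (J : X → ℝ) (i : ℕ)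
    (u : Tower R × Tower R) : ℝ :=
  ∏ k ∈ Finset.range i,
    (iterJac T J (simRet T n₀ ((indMap T n₀)^[k] u)).toNat ((indMap T n₀)^[k] u).1 *
      iterJac T J (simRet T n₀ ((indMap T n₀)^[k] u)).toNat ((indMap T n₀)^[k] u).2)

/-- The densities `Φ̃_i`, with `Φ̃_0 = Φ` and
`Φ̃_i(u) = Φ̃_{i-1}(u) - ε_i J_{T̃^i}(u) inf_{v ∈ Ω_i(u)} Φ̃_{i-1}(v) / J_{T̃^i}(v)`. -/
def tildeDensity {X ι : Type*} {R : X → ℕ} (T : Tower R → Tower R) (n₀ : ℕ) (ω : ι → Set X)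
    (J : X → ℝ) (ε : ℕ → ℝ) (Φ : Tower R × Tower R → ℝ) : ℕ → Tower R × Tower R → ℝ
  | 0, u => Φ u
  | i + 1, u => tildeDensity T n₀ ω J ε Φ i u -
      ε (i + 1) * indJac T n₀ J (i + 1) u *
        sInf ((fun v => tildeDensity T n₀ ω J ε Φ i v / indJac T n₀ J (i + 1) v) ''
          xiElt T n₀ ω (i + 1) u)

/-- The conditions on the sequence `(ε'_i)_{i ≥ 1}`, for a given sequence `v_i` and constant
`D₃`. -/
structure IsEpsSeq (β D₃ : ℝ) (v : ℕ → ℝ) (ε' : ℕ → ℝ) : Prop where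
  pos : ∀ i ≥ 1, 0 < ε' i
  le_half : ∀ i ≥ 1, ε' i ≤ 1 / 2
  variation_bound : ∀ i ≥ 1, v i * ∏ j ∈ Finset.Icc 1 i, (1 + ε' j) ≤ D₃
  geometric_bound : ∀ i ≥ 1,
    ∑ j ∈ Finset.Icc 1 i, (∏ k ∈ Finset.Icc j i, (1 + ε' k)) * β ^ (i - j + 1) ≤ D₃

/-- The total variation norm `|μ - ν|` of the signed measure `μ - ν`. -/
def tvNorm {Y : Type*} [MeasurableSpace Y] (μ ν : Measure Y) [IsFiniteMeasure μ]
    [IsFiniteMeasure ν] : ℝ :=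
  ((μ.toSignedMeasure - ν.toSignedMeasure).totalVariation univ).toReal

end WGM

end

/-!
The statement is a coupling estimate for a tower over a weak Gibbs Markov map.

*Distortion.* On an element of `⋁_{j<i} T̃^{-j} ξ̃` both coordinates follow fixed itineraries up to
the `i`-th simultaneous return, so the logarithm of the Jacobian of `T̃^k` oscillates on it by a
multiple of `β^{i-k}`, and that of `Φ` by a multiple of `v_i(Φ) + β^i`. Removing from a density at
most the fraction `e_k / 2` of its infimum (relative to the Jacobian) multiplies the logarithmic
oscillation by at most `1 + e_k`. Iterating gives the bound `distBound`, and the two conditions on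
the sequence `ε'` say that it is bounded in `i` (`distBound_le`). Hence all normalised densities are
constant on elements up to one factor `D` (`partialDensity_ratio_le`), and the infimum that is
removed is at least the fraction `1 / D` of the value: this is the decay property of the densities
`Φ̃_i` (`tildeDensity_le`).

*Coupling.* The image of an element under `T̃^i` is a product `A × B` of two images of elements of
the base. A density on it that is a multiple of the Jacobian is mapped to a constant density on
`A × B`, and this has equal marginals under further iteration only if `A = B`. The coupling is
therefore carried out only at those returns for which both coordinates are in a common element of
the partition of the tower immediately before the return (`lastSame`, `couplingWeight`,
`couplingDensity`); then `A = B`, and the mass removed has equal marginals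
(`lintegral_matched_le`). The total variation is at most twice the mass that is not removed by time
`n` (`IsRegular.tvNorm_le_unmatchedMass`).

*Good returns.* By aperiodicity and the coprime block, there are an element `a` that covers itself
under `F` and, for any two elements of the base, a time `L` at which both can be in `a` at the
ground level. Two points that stay in `a` for a long time move in lockstep, so that their
simultaneous returns are of the kind used for the coupling. By the Markov property and the lower
bound for the measure of images, there are only finitely many cases, which yields `q` and `c > 0`
such that the `q`-th return is good with measure at least `c` on every image
(`exists_goodSet_lower_bound`). With bounded distortion, over any `q` consecutive returns the mass
on each element contracts by a factor `1 - const · ε'_{i+q}` (`IsRegular.pairCyl_decay`), and the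
mass uncoupled after `i` returns decays like `∏ (1 - δ' ε'_j)` for small `δ'`
(`le_prod_of_window_contraction`, `IsRegular.uncoupledMass_le_prod`).

*Waiting times.* If fewer than `i + 1` returns take place by time `n`, one of the first `i + 1`
waiting times exceeds `n / (i + 1)`. By bounded distortion, at each return the next waiting time is,
up to a constant, distributed as `S` is under the reference measure
(`IsRegular.uncoupledMass_waitSet_le`). Stopping the decay estimate at that return and continuing it
afterwards bounds the corresponding uncoupled mass by a multiple of the product and of the measure
of `{S > n / (i + 1)}` (`IsRegular.uncoupledMass_waitSet_le_prod`). The mass without any return by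
time `n` is at most `P {S > n}`.
-/

namespace WGM

/-! ### Separation times -/

section Separation

variable {X ι : Type*} {F : X → X} {ω : ι → Set X}

lemma SameElt.symm {x y : X} (h : SameElt ω x y) : SameElt ω y x := by
  obtain ⟨i, hx, hy⟩ := h
  exact ⟨i, hy, hx⟩

lemma SameElt.trans (hd : Pairwise fun i j => Disjoint (ω i) (ω j)) {x y z : X}
    (h : SameElt ω x y) (h' : SameElt ω y z) : SameElt ω x z := by
  obtain ⟨i, hx, hy⟩ := h
  obtain ⟨j, hy', hz⟩ := h'
  have hij : i = j := by
    by_contra hne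
    exact Set.disjoint_left.1 (hd hne) hy hy'
  subst hij
  exact ⟨i, hx, hz⟩

lemma le_sep_iff {x y : X} {n : ℕ} :
    (n : ℕ∞) ≤ sep F ω x y ↔ ∀ k < n, SameElt ω (F^[k] x) (F^[k] y) := by
  unfold sep
  rw [le_sInf_iff]
  constructor
  · intro h k hk
    by_contra hne
    have := h k ⟨k, hne, rfl⟩
    exact absurd (by exact_mod_cast this) (not_le.2 hk)
  · rintro h _ ⟨k, hk, rfl⟩
    by_contra hlt
    push Not at hlt
    exact hk (h k (by exact_mod_cast hlt))

lemma sep_succ_le {x y : X} (h : SameElt ω x y) : sep F ω (F x) (F y) + 1 ≤ sep F ω x y := by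
  refine le_of_forall_lt fun c hc => ?_
  have hc' : c ≠ ⊤ := hc.ne_top
  lift c to ℕ using hc'
  have h1 : (c : ℕ∞) ≤ sep F ω (F x) (F y) := Order.le_of_lt_add_one hc
  have h2 : ((c + 1 : ℕ) : ℕ∞) ≤ sep F ω x y := by
    rw [le_sep_iff] at h1 ⊢
    intro k hk
    cases k with
    | zero => exact h
    | succ k => exact h1 k (by omega)
  refine lt_of_lt_of_le ?_ h2
  exact_mod_cast Nat.lt_succ_self c

lemma epow_nonneg {b : ℝ} (hb : 0 ≤ b) (s : ℕ∞) : 0 ≤ epow b s := by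
  unfold epow
  split_ifs
  · exact le_rfl
  · positivity

lemma epow_coe (b : ℝ) (n : ℕ) : epow b n = b ^ n := by simp [epow]

lemma epow_anti {b : ℝ} (hb : 0 ≤ b) (hb1 : b ≤ 1) {s t : ℕ∞} (h : s ≤ t) :
    epow b t ≤ epow b s := by
  by_cases ht : t = ⊤
  · subst ht
    rw [show epow b ⊤ = 0 by simp [epow]]
    exact epow_nonneg hb s
  · have hs : s ≠ ⊤ := ne_top_of_le_ne_top ht h
    lift s to ℕ using hs
    lift t to ℕ using ht
    rw [epow_coe, epow_coe]
    exact pow_le_pow_of_le_one hb hb1 (by exact_mod_cast h)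

lemma epow_add_one (b : ℝ) (s : ℕ∞) : epow b (s + 1) = b * epow b s := by
  by_cases hs : s = ⊤
  · subst hs
    simp [epow]
  · lift s to ℕ using hs
    rw [show ((s : ℕ∞) + 1) = ((s + 1 : ℕ) : ℕ∞) by norm_cast, epow_coe, epow_coe, pow_succ']

lemma epow_le_pow {b : ℝ} (hb : 0 ≤ b) (hb1 : b ≤ 1) {n : ℕ} {s : ℕ∞} (h : (n : ℕ∞) ≤ s) :
    epow b s ≤ b ^ n := by
  rw [← epow_coe]
  exact epow_anti hb hb1 h

end Separation

/-! ### Itineraries on the tower -/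

section Itineraries

variable {X ι : Type*} {F : X → X} {R : X → ℕ} {hR : ∀ x, 0 < R x} {ω : ι → Set X}

lemma towerMap_of_lt {p : Tower R} (h : p.1.2 + 1 < R p.1.1) :
    towerMap F R hR p = ⟨(p.1.1, p.1.2 + 1), h⟩ := dif_pos h

lemma towerMap_of_not_lt {p : Tower R} (h : ¬ p.1.2 + 1 < R p.1.1) :
    towerMap F R hR p = ⟨(F p.1.1, 0), hR _⟩ := dif_neg h

lemma towerMap_mem_base_iff {p : Tower R} :
    towerMap F R hR p ∈ base R ↔ ¬ p.1.2 + 1 < R p.1.1 := by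
  by_cases h : p.1.2 + 1 < R p.1.1
  · simp [towerMap_of_lt h, base, h]
  · simp [towerMap_of_not_lt h, base, h]

lemma TowerSame.symm {p q : Tower R} (h : TowerSame ω p q) : TowerSame ω q p :=
  ⟨h.1.symm, h.2.symm⟩

lemma TowerSame.trans (hd : Pairwise fun i j => Disjoint (ω i) (ω j)) {p q r : Tower R}
    (h : TowerSame ω p q) (h' : TowerSame ω q r) : TowerSame ω p r :=
  ⟨h.1.trans h'.1, h.2.trans hd h'.2⟩

lemma TowerSame.lt_iff (hc : ∀ i, ∀ x ∈ ω i, ∀ y ∈ ω i, R x = R y) {p q : Tower R}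
    (h : TowerSame ω p q) : p.1.2 + 1 < R p.1.1 ↔ q.1.2 + 1 < R q.1.1 := by
  obtain ⟨h1, i, h2, h3⟩ := h
  rw [h1, hc i _ h2 _ h3]

/-- The `T`-orbits of `p` and `q` visit the same elements of the partition of the tower before
time `s`. -/
def Agree (T : Tower R → Tower R) (ω : ι → Set X) (s : ℕ) (p q : Tower R) : Prop :=
  ∀ t < s, TowerSame ω (T^[t] p) (T^[t] q)

lemma Agree.symm {T : Tower R → Tower R} {s : ℕ} {p q : Tower R} (h : Agree T ω s p q) :
    Agree T ω s q p := fun t ht => (h t ht).symm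

lemma Agree.trans (hd : Pairwise fun i j => Disjoint (ω i) (ω j)) {T : Tower R → Tower R} {s : ℕ}
    {p q r : Tower R} (h : Agree T ω s p q) (h' : Agree T ω s q r) : Agree T ω s p r :=
  fun t ht => (h t ht).trans hd (h' t ht)

lemma Agree.mono {T : Tower R → Tower R} {s s' : ℕ} {p q : Tower R} (h : Agree T ω s p q)
    (hs : s' ≤ s) : Agree T ω s' p q := fun t ht => h t (ht.trans_le hs)

lemma agree_add {T : Tower R → Tower R} {s s' : ℕ} {p q : Tower R} :
    Agree T ω (s + s') p q ↔ Agree T ω s p q ∧ Agree T ω s' (T^[s] p) (T^[s] q) := by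
  constructor
  · intro h
    refine ⟨h.mono (by omega), fun t ht => ?_⟩
    rw [← Function.iterate_add_apply, ← Function.iterate_add_apply]
    exact h _ (by omega)
  · rintro ⟨h, h'⟩ t ht
    by_cases hts : t < s
    · exact h t hts
    · obtain ⟨r, rfl⟩ := Nat.exists_eq_add_of_le (not_lt.1 hts)
      have := h' r (by omega)
      rwa [← Function.iterate_add_apply, ← Function.iterate_add_apply, add_comm r s] at this

lemma Agree.mem_base_iff (hc : ∀ i, ∀ x ∈ ω i, ∀ y ∈ ω i, R x = R y) {s : ℕ} {p q : Tower R}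
    (h : Agree (towerMap F R hR) ω s p q) {t : ℕ} (ht : 1 ≤ t) (hts : t ≤ s) :
    (towerMap F R hR)^[t] p ∈ base R ↔ (towerMap F R hR)^[t] q ∈ base R := by
  obtain ⟨t, rfl⟩ := Nat.exists_eq_add_of_le' ht
  rw [Function.iterate_succ_apply', Function.iterate_succ_apply', towerMap_mem_base_iff,
    towerMap_mem_base_iff, (h t (by omega)).lt_iff hc]

/-- Passing to the images under `T` does not increase the separation time of the base points of
two points in a common element. -/
lemma TowerSame.sep_le (hc : ∀ i, ∀ x ∈ ω i, ∀ y ∈ ω i, R x = R y) {p q : Tower R}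
    (h : TowerSame ω p q) :
    sep F ω (towerMap F R hR p).1.1 (towerMap F R hR q).1.1 ≤ sep F ω p.1.1 q.1.1 := by
  by_cases hp : p.1.2 + 1 < R p.1.1
  · rw [towerMap_of_lt hp, towerMap_of_lt ((h.lt_iff hc).1 hp)]
  · rw [towerMap_of_not_lt hp, towerMap_of_not_lt (fun hq => hp ((h.lt_iff hc).2 hq))]
    exact le_self_add.trans (sep_succ_le h.2)

lemma Agree.sep_le (hc : ∀ i, ∀ x ∈ ω i, ∀ y ∈ ω i, R x = R y) {s : ℕ} {p q : Tower R}
    (h : Agree (towerMap F R hR) ω s p q) :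
    sep F ω ((towerMap F R hR)^[s] p).1.1 ((towerMap F R hR)^[s] q).1.1 ≤
      sep F ω p.1.1 q.1.1 := by
  induction s with
  | zero => exact le_rfl
  | succ s ih =>
    rw [Function.iterate_succ_apply', Function.iterate_succ_apply']
    exact ((h s (by omega)).sep_le hc).trans (ih (h.mono (by omega)))

/-- A return to the ground level reduces the separation time by at least one. -/
lemma Agree.sep_succ_le (hc : ∀ i, ∀ x ∈ ω i, ∀ y ∈ ω i, R x = R y) {s : ℕ} {p q : Tower R}
    (h : Agree (towerMap F R hR) ω s p q) (hs : 1 ≤ s)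
    (hb : (towerMap F R hR)^[s] p ∈ base R) :
    sep F ω ((towerMap F R hR)^[s] p).1.1 ((towerMap F R hR)^[s] q).1.1 + 1 ≤
      sep F ω p.1.1 q.1.1 := by
  obtain ⟨s, rfl⟩ := Nat.exists_eq_add_of_le' hs
  have hsame := h s (by omega)
  refine le_trans ?_ ((h.mono (Nat.le_succ s)).sep_le hc)
  rw [Function.iterate_succ_apply'] at hb ⊢
  rw [Function.iterate_succ_apply']
  have hp := towerMap_mem_base_iff.1 hb
  rw [towerMap_of_not_lt hp, towerMap_of_not_lt (fun hq => hp ((hsame.lt_iff hc).2 hq))]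
  exact WGM.sep_succ_le hsame.2

lemma towerSep_eq {p q : Tower R} (h : p.1.2 = q.1.2) :
    towerSep F ω p q = sep F ω p.1.1 q.1.1 := if_pos h

end Itineraries

/-! ### Distortion of the Jacobians of the tower map -/

section Jacobian

variable {X ι : Type*} {F : X → X} {R : X → ℕ} {hR : ∀ x, 0 < R x} {ω : ι → Set X} {J : X → ℝ}
  {β : ℝ}

lemma towerJac_pos (hJ : ∀ x, 0 < J x) (p : Tower R) : 0 < towerJac J p := by
  unfold towerJac
  split_ifs
  · exact one_pos
  · exact hJ _

lemma iterJac_pos (hJ : ∀ x, 0 < J x) (T : Tower R → Tower R) (n : ℕ) (p : Tower R) :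
    0 < iterJac T J n p := Finset.prod_pos fun _ _ => towerJac_pos hJ _

lemma iterJac_succ (T : Tower R → Tower R) (n : ℕ) (p : Tower R) :
    iterJac T J (n + 1) p = iterJac T J n p * towerJac J (T^[n] p) :=
  Finset.prod_range_succ _ _

lemma iterJac_add (T : Tower R → Tower R) (n k : ℕ) (p : Tower R) :
    iterJac T J (n + k) p = iterJac T J n p * iterJac T J k (T^[n] p) := by
  unfold iterJac
  rw [Finset.prod_range_add]
  congr 1
  refine Finset.prod_congr rfl fun t _ => ?_
  rw [add_comm n t, Function.iterate_add_apply]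

/-- The distortion constant `c / (1 - β)` is the fixed point of `K ↦ β K + c`: each return to the
ground level contributes at most `c β ^ s`, and all earlier contributions shrink by `β`. -/
lemma Agree.iterJac_le (hc : ∀ i, ∀ x ∈ ω i, ∀ y ∈ ω i, R x = R y) (hJ : ∀ x, 0 < J x)
    (hβ : 0 < β) (hβ1 : β < 1) {c : ℝ} (hc0 : 0 ≤ c)
    (hG : ∀ i, ∀ x ∈ ω i, ∀ y ∈ ω i, Real.log (J x / J y) ≤ c * epow β (sep F ω (F x) (F y)))
    {s : ℕ} {p q : Tower R} (h : Agree (towerMap F R hR) ω s p q) :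
    iterJac (towerMap F R hR) J s p ≤
      Real.exp (c / (1 - β) *
        epow β (sep F ω ((towerMap F R hR)^[s] p).1.1 ((towerMap F R hR)^[s] q).1.1)) *
        iterJac (towerMap F R hR) J s q := by
  have hK : 0 ≤ c / (1 - β) := div_nonneg hc0 (by linarith)
  induction s with
  | zero =>
    simp only [iterJac, Finset.range_zero, Finset.prod_empty, mul_one]
    exact Real.one_le_exp (mul_nonneg hK (epow_nonneg hβ.le _))
  | succ s ih =>
    have ih := ih (h.mono (Nat.le_succ s))
    have hsame := h s (by omega)
    rw [iterJac_succ, iterJac_succ, Function.iterate_succ_apply', Function.iterate_succ_apply']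
    set P := (towerMap F R hR)^[s] p
    set Q := (towerMap F R hR)^[s] q
    have hp0 := iterJac_pos hJ (towerMap F R hR) s p
    have hq0 := iterJac_pos hJ (towerMap F R hR) s q
    by_cases hP : P.1.2 + 1 < R P.1.1
    · have hQ := (hsame.lt_iff hc).1 hP
      rw [towerMap_of_lt hP, towerMap_of_lt hQ]
      simpa [towerJac, hP, hQ] using ih
    · have hQ : ¬ Q.1.2 + 1 < R Q.1.1 := fun hq => hP ((hsame.lt_iff hc).2 hq)
      rw [towerMap_of_not_lt hP, towerMap_of_not_lt hQ]
      simp only [towerJac, hP, hQ, if_false]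
      obtain ⟨i, hPi, hQi⟩ := hsame.2
      set σ := sep F ω (F P.1.1) (F Q.1.1)
      have h1 : epow β (sep F ω P.1.1 Q.1.1) ≤ β * epow β σ := by
        rw [← epow_add_one]
        exact epow_anti hβ.le hβ1.le (WGM.sep_succ_le hsame.2)
      have h2 : J P.1.1 ≤ Real.exp (c * epow β σ) * J Q.1.1 := by
        have := hG i _ hPi _ hQi
        rw [Real.log_le_iff_le_exp (div_pos (hJ _) (hJ _)), div_le_iff₀ (hJ _)] at this
        exact this
      have h3 : Real.exp (c / (1 - β) * epow β σ) =
          Real.exp (c / (1 - β) * (β * epow β σ)) * Real.exp (c * epow β σ) := by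
        rw [← Real.exp_add]
        congr 1
        have : (1 - β) ≠ 0 := by linarith
        field_simp
        ring
      calc iterJac (towerMap F R hR) J s p * J P.1.1
          ≤ (Real.exp (c / (1 - β) * (β * epow β σ)) * iterJac (towerMap F R hR) J s q) *
            (Real.exp (c * epow β σ) * J Q.1.1) := by
            refine mul_le_mul (ih.trans ?_) h2 (hJ _).le (by positivity)
            gcongr
        _ = _ := by rw [h3]; ring

end Jacobian

/-! ### Simultaneous returns are determined by itineraries -/

section Returns

variable {X ι : Type*} {F : X → X} {R : X → ℕ} {hR : ∀ x, 0 < R x} {ω : ι → Set X} {n₀ : ℕ}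

lemma iterate_towerMap_of_lt (x : X) (l : ℕ) (h : l < R x) (k : ℕ) (hk : l + k < R x) :
    (towerMap F R hR)^[k] ⟨(x, l), h⟩ = ⟨(x, l + k), hk⟩ := by
  induction k with
  | zero => rfl
  | succ k ih =>
    rw [Function.iterate_succ_apply', ih (by omega)]
    exact towerMap_of_lt _

lemma iterate_towerMap_mem_base (p : Tower R) :
    (towerMap F R hR)^[R p.1.1 - p.1.2] p ∈ base R := by
  obtain ⟨⟨x, l⟩, h⟩ := p
  simp only at h ⊢
  obtain ⟨k, hk⟩ : ∃ k, R x - l = k + 1 := ⟨R x - l - 1, by omega⟩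
  rw [hk, Function.iterate_succ_apply', iterate_towerMap_of_lt x l h k (by omega),
    towerMap_mem_base_iff]
  simp only
  omega

lemma retTime_le_of_mem {T : Tower R → Tower R} {p : Tower R} {n : ℕ} (h : T^[n] p ∈ base R) :
    retTime T p ≤ n := Nat.sInf_le h

lemma retTime_mem (p : Tower R) :
    (towerMap F R hR)^[retTime (towerMap F R hR) p] p ∈ base R :=
  Nat.sInf_mem (s := {n | (towerMap F R hR)^[n] p ∈ base R}) ⟨_, iterate_towerMap_mem_base p⟩

lemma tau_succ_le {T : Tower R → Tower R} (k : ℕ) (u : Tower R × Tower R) :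
    tau T n₀ k u + n₀ ≤ tau T n₀ (k + 1) u := by
  simp only [tau]
  omega

lemma mul_le_tau {T : Tower R → Tower R} (k : ℕ) (u : Tower R × Tower R) :
    k * n₀ ≤ tau T n₀ k u := by
  induction k with
  | zero => simp
  | succ k ih =>
    have := tau_succ_le (T := T) (n₀ := n₀) k u
    rw [Nat.succ_mul]
    omega

/-- At each time `τ_{k+1}` one of the coordinates is in the ground level. -/
lemma tau_succ_mem_base (k : ℕ) (u : Tower R × Tower R) :
    (towerMap F R hR)^[tau (towerMap F R hR) n₀ (k + 1) u] (if k % 2 = 0 then u.1 else u.2) ∈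
      base R := by
  have h := retTime_mem (F := F) (hR := hR)
    ((towerMap F R hR)^[n₀ + tau (towerMap F R hR) n₀ k u] (if k % 2 = 0 then u.1 else u.2))
  rw [← Function.iterate_add_apply, add_comm] at h
  exact h

lemma simRet_le {T : Tower R → Tower R} {u : Tower R × Tower R} {i : ℕ} (hi : 2 ≤ i)
    (h1 : T^[tau T n₀ i u] u.1 ∈ base R) (h2 : T^[tau T n₀ i u] u.2 ∈ base R) :
    simRet T n₀ u ≤ (tau T n₀ i u : ℕ) :=
  sInf_le ⟨i, ⟨hi, h1, h2⟩, rfl⟩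

lemma exists_tau_eq_simRet {T : Tower R → Tower R} {u : Tower R × Tower R}
    (h : simRet T n₀ u ≠ ⊤) :
    ∃ i, 2 ≤ i ∧ simRet T n₀ u = (tau T n₀ i u : ℕ) ∧ T^[tau T n₀ i u] u.1 ∈ base R ∧
      T^[tau T n₀ i u] u.2 ∈ base R := by
  have hne : ((fun i : ℕ => (tau T n₀ i u : ℕ∞)) ''
    {i : ℕ | 2 ≤ i ∧ T^[tau T n₀ i u] u.1 ∈ base R ∧ T^[tau T n₀ i u] u.2 ∈ base R}).Nonempty := by
    by_contra hemp
    rw [not_nonempty_iff_eq_empty] at hemp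
    exact h (by rw [simRet, hemp, sInf_empty])
  obtain ⟨i, ⟨hi, h1, h2⟩, h3⟩ := csInf_mem hne
  exact ⟨i, hi, h3.symm, h1, h2⟩

lemma iterate_simRet_mem_base {T : Tower R → Tower R} {u : Tower R × Tower R}
    (h : simRet T n₀ u ≠ ⊤) :
    T^[(simRet T n₀ u).toNat] u.1 ∈ base R ∧ T^[(simRet T n₀ u).toNat] u.2 ∈ base R := by
  obtain ⟨i, -, h1, h2, h3⟩ := exists_tau_eq_simRet h
  rw [h1]
  exact ⟨h2, h3⟩

lemma two_mul_le_simRet {T : Tower R → Tower R} (u : Tower R × Tower R) :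
    ((2 * n₀ : ℕ) : ℕ∞) ≤ simRet T n₀ u := by
  refine le_sInf ?_
  rintro _ ⟨i, ⟨hi, -⟩, rfl⟩
  have := mul_le_tau (T := T) (n₀ := n₀) i u
  have h2 := Nat.mul_le_mul_right n₀ hi
  have h3 : 2 * n₀ ≤ tau T n₀ i u := h2.trans this
  exact Nat.cast_le.2 h3

lemma one_le_simRet {T : Tower R → Tower R} (hn : 0 < n₀) {u : Tower R × Tower R}
    (h : simRet T n₀ u ≠ ⊤) : 1 ≤ (simRet T n₀ u).toNat := by
  have h2 := two_mul_le_simRet (T := T) (n₀ := n₀) u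
  lift simRet T n₀ u to ℕ using h with s
  have : 2 * n₀ ≤ s := by exact_mod_cast h2
  simp
  omega

lemma simRet_le_iff {T : Tower R → Tower R} {u : Tower R × Tower R} {k : ℕ} :
    simRet T n₀ u ≤ k ↔ ∃ i, 2 ≤ i ∧ tau T n₀ i u ≤ k ∧ T^[tau T n₀ i u] u.1 ∈ base R ∧
      T^[tau T n₀ i u] u.2 ∈ base R := by
  constructor
  · intro h
    obtain ⟨i, hi, h1, h2, h3⟩ := exists_tau_eq_simRet
      (ne_top_of_le_ne_top (ENat.natCast_ne_top k) h)
    rw [h1] at h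
    exact ⟨i, hi, by exact_mod_cast h, h2, h3⟩
  · rintro ⟨i, hi, h1, h2, h3⟩
    exact (simRet_le hi h2 h3).trans (by exact_mod_cast h1)

lemma retTime_eq_of_agree (hc : ∀ i, ∀ x ∈ ω i, ∀ y ∈ ω i, R x = R y) {s t : ℕ} {p q : Tower R}
    (h : Agree (towerMap F R hR) ω s p q) (ht : 1 ≤ t)
    (hs : t + retTime (towerMap F R hR) ((towerMap F R hR)^[t] p) ≤ s) :
    retTime (towerMap F R hR) ((towerMap F R hR)^[t] q) =
      retTime (towerMap F R hR) ((towerMap F R hR)^[t] p) := by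
  have hle : retTime (towerMap F R hR) ((towerMap F R hR)^[t] q) ≤
      retTime (towerMap F R hR) ((towerMap F R hR)^[t] p) := by
    refine retTime_le_of_mem ?_
    have := retTime_mem (F := F) (hR := hR) ((towerMap F R hR)^[t] p)
    rw [← Function.iterate_add_apply] at this ⊢
    exact (h.mem_base_iff hc (by omega) (by omega)).1 this
  refine le_antisymm hle (retTime_le_of_mem ?_)
  have := retTime_mem (F := F) (hR := hR) ((towerMap F R hR)^[t] q)
  rw [← Function.iterate_add_apply] at this ⊢
  exact (h.mem_base_iff hc (by omega) (by omega)).2 this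

lemma tau_eq_of_agree (hn : 0 < n₀) (hc : ∀ i, ∀ x ∈ ω i, ∀ y ∈ ω i, R x = R y) {s : ℕ}
    {u v : Tower R × Tower R} (h1 : Agree (towerMap F R hR) ω s u.1 v.1)
    (h2 : Agree (towerMap F R hR) ω s u.2 v.2) (k : ℕ)
    (hk : tau (towerMap F R hR) n₀ k u ≤ s) :
    tau (towerMap F R hR) n₀ k v = tau (towerMap F R hR) n₀ k u := by
  induction k with
  | zero => rfl
  | succ k ih =>
    have hle := tau_succ_le (T := towerMap F R hR) (n₀ := n₀) k u
    have ih := ih (by omega)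
    simp only [tau] at hk ⊢
    rw [ih]
    congr 1
    split_ifs at hk ⊢
    · exact retTime_eq_of_agree hc h1 (by omega) (by omega)
    · exact retTime_eq_of_agree hc h2 (by omega) (by omega)

lemma simRet_le_of_agree (hn : 0 < n₀) (hc : ∀ i, ∀ x ∈ ω i, ∀ y ∈ ω i, R x = R y) {s : ℕ}
    {u v : Tower R × Tower R} (h1 : Agree (towerMap F R hR) ω s u.1 v.1)
    (h2 : Agree (towerMap F R hR) ω s u.2 v.2)
    (hs : simRet (towerMap F R hR) n₀ u ≤ s) :
    simRet (towerMap F R hR) n₀ v ≤ simRet (towerMap F R hR) n₀ u := by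
  obtain ⟨i, hi, h3, h4, h5⟩ := exists_tau_eq_simRet
    (ne_top_of_le_ne_top (ENat.natCast_ne_top s) hs)
  rw [h3] at hs ⊢
  have hs' : tau (towerMap F R hR) n₀ i u ≤ s := by exact_mod_cast hs
  have htau := tau_eq_of_agree hn hc h1 h2 i hs'
  have hpos : 1 ≤ tau (towerMap F R hR) n₀ i u := by
    have := mul_le_tau (T := towerMap F R hR) (n₀ := n₀) i u
    have := Nat.mul_le_mul hi hn
    omega
  rw [← htau]
  refine simRet_le hi ?_ ?_
  · rw [htau]
    exact (h1.mem_base_iff hc hpos hs').1 h4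
  · rw [htau]
    exact (h2.mem_base_iff hc hpos hs').1 h5

/-- The simultaneous return time is a stopping time: it depends only on the itineraries before
it. -/
lemma simRet_eq_of_agree (hn : 0 < n₀) (hc : ∀ i, ∀ x ∈ ω i, ∀ y ∈ ω i, R x = R y) {s : ℕ}
    {u v : Tower R × Tower R} (h1 : Agree (towerMap F R hR) ω s u.1 v.1)
    (h2 : Agree (towerMap F R hR) ω s u.2 v.2)
    (hs : simRet (towerMap F R hR) n₀ u ≤ s) :
    simRet (towerMap F R hR) n₀ v = simRet (towerMap F R hR) n₀ u := by
  have h := simRet_le_of_agree hn hc h1 h2 hs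
  exact le_antisymm h (simRet_le_of_agree hn hc h1.symm h2.symm (h.trans hs))

end Returns

/-! ### The cylinders of the induced map -/

section Cylinders

variable {X ι : Type*} {F : X → X} {R : X → ℕ} {hR : ∀ x, 0 < R x} {ω : ι → Set X} {n₀ : ℕ}

/-- The `i`-th simultaneous return time `S_i = ∑_{k < i} S ∘ T̃^k`, meaningful where all summands
are finite. -/
noncomputable def stopTime (T : Tower R → Tower R) (n₀ i : ℕ) (u : Tower R × Tower R) : ℕ :=
  ∑ k ∈ Finset.range i, (simRet T n₀ ((indMap T n₀)^[k] u)).toNat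

lemma stopTime_succ (T : Tower R → Tower R) (n₀ i : ℕ) (u : Tower R × Tower R) :
    stopTime T n₀ (i + 1) u =
      stopTime T n₀ i u + (simRet T n₀ ((indMap T n₀)^[i] u)).toNat :=
  Finset.sum_range_succ _ _

lemma indMap_iterate (T : Tower R → Tower R) (n₀ i : ℕ) (u : Tower R × Tower R) :
    (indMap T n₀)^[i] u = (T^[stopTime T n₀ i u] u.1, T^[stopTime T n₀ i u] u.2) := by
  induction i with
  | zero => rfl
  | succ i ih =>
    rw [Function.iterate_succ_apply', indMap, stopTime_succ]
    have h1 : ((indMap T n₀)^[i] u).1 = T^[stopTime T n₀ i u] u.1 := by rw [ih]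
    have h2 : ((indMap T n₀)^[i] u).2 = T^[stopTime T n₀ i u] u.2 := by rw [ih]
    rw [add_comm (stopTime T n₀ i u), Function.iterate_add_apply, Function.iterate_add_apply,
      h1, h2]

lemma sameXi_iff {T : Tower R → Tower R} {u v : Tower R × Tower R} :
    SameXi T n₀ ω u v ↔ simRet T n₀ u ≠ ⊤ ∧ simRet T n₀ u = simRet T n₀ v ∧
      Agree T ω (simRet T n₀ u).toNat u.1 v.1 ∧ Agree T ω (simRet T n₀ u).toNat u.2 v.2 := by
  unfold SameXi Agree
  refine and_congr_right fun _ => and_congr_right fun _ => ?_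
  exact ⟨fun h => ⟨fun t ht => (h t ht).1, fun t ht => (h t ht).2⟩,
    fun h t ht => ⟨h.1 t ht, h.2 t ht⟩⟩

lemma mem_xiElt_add {T : Tower R → Tower R} {i k : ℕ} {u v : Tower R × Tower R} :
    v ∈ xiElt T n₀ ω (i + k) u ↔
      v ∈ xiElt T n₀ ω i u ∧ (indMap T n₀)^[i] v ∈ xiElt T n₀ ω k ((indMap T n₀)^[i] u) := by
  simp only [xiElt, mem_ofPred_eq]
  constructor
  · intro h
    refine ⟨fun j hj => h j (by omega), fun j hj => ?_⟩
    rw [← Function.iterate_add_apply, ← Function.iterate_add_apply]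
    exact h _ (by omega)
  · rintro ⟨h, h'⟩ j hj
    by_cases hji : j < i
    · exact h j hji
    · obtain ⟨r, rfl⟩ := Nat.exists_eq_add_of_le (not_lt.1 hji)
      have := h' r (by omega)
      rwa [← Function.iterate_add_apply, ← Function.iterate_add_apply, add_comm r i] at this

lemma mem_xiElt_zero {T : Tower R → Tower R} {u v : Tower R × Tower R} :
    v ∈ xiElt T n₀ ω 0 u := fun _ hj => absurd hj (Nat.not_lt_zero _)

lemma mem_xiElt_one {T : Tower R → Tower R} {u v : Tower R × Tower R} :
    v ∈ xiElt T n₀ ω 1 u ↔ SameXi T n₀ ω u v := by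
  simp only [xiElt, mem_ofPred_eq, Nat.lt_one_iff, forall_eq]
  rfl

lemma xiElt_anti {T : Tower R → Tower R} {i k : ℕ} (h : k ≤ i) (u : Tower R × Tower R) :
    xiElt T n₀ ω i u ⊆ xiElt T n₀ ω k u := fun _ hv j hj => hv j (hj.trans_le h)

/-- The element of `⋁_{j<i} T̃^{-j} ξ̃` containing `u` is a product of two cylinders of the same
length `S_i(u)`. -/
lemma mem_xiElt_iff (hn : 0 < n₀) (hc : ∀ i, ∀ x ∈ ω i, ∀ y ∈ ω i, R x = R y) (i : ℕ)
    {u v : Tower R × Tower R} (hu : u ∈ xiElt (towerMap F R hR) n₀ ω i u) :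
    v ∈ xiElt (towerMap F R hR) n₀ ω i u ↔
      Agree (towerMap F R hR) ω (stopTime (towerMap F R hR) n₀ i u) u.1 v.1 ∧
      Agree (towerMap F R hR) ω (stopTime (towerMap F R hR) n₀ i u) u.2 v.2 := by
  have key : ∀ i, u ∈ xiElt (towerMap F R hR) n₀ ω i u →
      ((v ∈ xiElt (towerMap F R hR) n₀ ω i u ↔
      Agree (towerMap F R hR) ω (stopTime (towerMap F R hR) n₀ i u) u.1 v.1 ∧
      Agree (towerMap F R hR) ω (stopTime (towerMap F R hR) n₀ i u) u.2 v.2) ∧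
      (v ∈ xiElt (towerMap F R hR) n₀ ω i u →
        stopTime (towerMap F R hR) n₀ i v = stopTime (towerMap F R hR) n₀ i u)) := by
    clear hu i
    intro i
    induction i with
    | zero =>
      intro _
      refine ⟨⟨fun _ => ?_, fun _ => mem_xiElt_zero⟩, fun _ => rfl⟩
      exact ⟨fun t ht => absurd ht (by simp [stopTime]), fun t ht => absurd ht (by simp [stopTime])⟩
    | succ i ih =>
      intro hu
      obtain ⟨ih1, ih2⟩ := ih (xiElt_anti (Nat.le_succ i) u hu)
      have hui := (mem_xiElt_one.1 (mem_xiElt_add.1 hu).2).1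
      refine ⟨?_, fun hv => ?_⟩
      · rw [mem_xiElt_add, mem_xiElt_one, sameXi_iff, stopTime_succ, agree_add, agree_add]
        constructor
        · rintro ⟨hv, -, -, h3, h4⟩
          have hS := ih2 hv
          obtain ⟨h5, h6⟩ := ih1.1 hv
          rw [indMap_iterate _ _ i u, indMap_iterate _ _ i v, hS] at h3 h4
          rw [indMap_iterate _ _ i u]
          exact ⟨⟨h5, h3⟩, ⟨h6, h4⟩⟩
        · rintro ⟨⟨h5, h3⟩, ⟨h6, h4⟩⟩
          have hv := ih1.2 ⟨h5, h6⟩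
          have hS := ih2 hv
          have h3' : Agree (towerMap F R hR) ω
              (simRet (towerMap F R hR) n₀ ((indMap (towerMap F R hR) n₀)^[i] u)).toNat
              ((indMap (towerMap F R hR) n₀)^[i] u).1
              ((indMap (towerMap F R hR) n₀)^[i] v).1 := by
            rw [indMap_iterate _ _ i v, hS]
            rw [indMap_iterate _ _ i u] at h3 ⊢
            exact h3
          have h4' : Agree (towerMap F R hR) ω
              (simRet (towerMap F R hR) n₀ ((indMap (towerMap F R hR) n₀)^[i] u)).toNat
              ((indMap (towerMap F R hR) n₀)^[i] u).2
              ((indMap (towerMap F R hR) n₀)^[i] v).2 := by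
            rw [indMap_iterate _ _ i v, hS]
            rw [indMap_iterate _ _ i u] at h4 ⊢
            exact h4
          refine ⟨hv, hui, ?_, h3', h4'⟩
          refine (simRet_eq_of_agree hn hc h3' h4' ?_).symm
          rw [ENat.natCast_toNat hui]
      · rw [stopTime_succ, stopTime_succ, ih2 (xiElt_anti (Nat.le_succ i) u hv)]
        rw [(mem_xiElt_one.1 (mem_xiElt_add.1 hv).2).2.1]
  exact (key i hu).1

lemma stopTime_eq_of_mem {T : Tower R → Tower R} {i : ℕ} {u v : Tower R × Tower R}
    (hv : v ∈ xiElt T n₀ ω i u) : stopTime T n₀ i v = stopTime T n₀ i u :=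
  Finset.sum_congr rfl fun k hk => by rw [(hv k (Finset.mem_range.1 hk)).2.1]

lemma SameXi.symm {T : Tower R → Tower R} {u v : Tower R × Tower R} (h : SameXi T n₀ ω u v) :
    SameXi T n₀ ω v u := by
  rw [sameXi_iff] at h ⊢
  obtain ⟨h1, h2, h3, h4⟩ := h
  rw [← h2]
  exact ⟨h1, rfl, h3.symm, h4.symm⟩

lemma SameXi.trans (hd : Pairwise fun i j => Disjoint (ω i) (ω j)) {T : Tower R → Tower R}
    {u v w : Tower R × Tower R} (h : SameXi T n₀ ω u v) (h' : SameXi T n₀ ω v w) :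
    SameXi T n₀ ω u w := by
  rw [sameXi_iff] at h h' ⊢
  obtain ⟨h1, h2, h3, h4⟩ := h
  rw [← h2] at h'
  exact ⟨h1, h'.2.1, h3.trans hd h'.2.2.1, h4.trans hd h'.2.2.2⟩

lemma mem_xiElt_comm {T : Tower R → Tower R} {i : ℕ} {u v : Tower R × Tower R}
    (h : v ∈ xiElt T n₀ ω i u) : u ∈ xiElt T n₀ ω i v := fun j hj => (h j hj).symm

lemma xiElt_eq_of_mem (hd : Pairwise fun i j => Disjoint (ω i) (ω j)) {T : Tower R → Tower R}
    {i : ℕ} {u v : Tower R × Tower R} (h : v ∈ xiElt T n₀ ω i u) :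
    xiElt T n₀ ω i v = xiElt T n₀ ω i u := by
  ext w
  exact ⟨fun hw j hj => (h j hj).trans hd (hw j hj),
    fun hw j hj => (h j hj).symm.trans hd (hw j hj)⟩

lemma mem_xiElt_self (hd : Pairwise fun i j => Disjoint (ω i) (ω j)) {T : Tower R → Tower R}
    {i : ℕ} {u v : Tower R × Tower R} (h : v ∈ xiElt T n₀ ω i u) :
    u ∈ xiElt T n₀ ω i u := by
  rw [← xiElt_eq_of_mem hd h]
  exact mem_xiElt_comm h

/-- Each of the `i` steps of `T̃` contains a return of both coordinates to the ground level, so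
points in a common element of `⋁_{j<i} T̃^{-j} ξ̃` separate after time `i` at the earliest. -/
lemma le_sep_of_mem_xiElt (hn : 0 < n₀) (hc : ∀ i, ∀ x ∈ ω i, ∀ y ∈ ω i, R x = R y) (i : ℕ) :
    ∀ u v : Tower R × Tower R, v ∈ xiElt (towerMap F R hR) n₀ ω i u →
      (i : ℕ∞) ≤ sep F ω u.1.1.1 v.1.1.1 ∧ (i : ℕ∞) ≤ sep F ω u.2.1.1 v.2.1.1 := by
  induction i with
  | zero => simp
  | succ i ih =>
    intro u v huv
    rw [add_comm, mem_xiElt_add, mem_xiElt_one, sameXi_iff] at huv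
    obtain ⟨⟨h1, h2, h3, h4⟩, h5⟩ := huv
    obtain ⟨h6, h7⟩ := ih _ _ h5
    simp only [Function.iterate_one, indMap] at h6 h7
    rw [← h2] at h6 h7
    have h8 := iterate_simRet_mem_base h1
    have h9 := one_le_simRet hn h1
    push_cast
    exact ⟨(add_le_add_left h6 1).trans (h3.sep_succ_le hc h9 h8.1),
      (add_le_add_left h7 1).trans (h4.sep_succ_le hc h9 h8.2)⟩

end Cylinders

/-! ### Distortion of the densities after partial subtraction -/

section Densities

variable {X ι : Type*} {F : X → X} {R : X → ℕ} {hR : ∀ x, 0 < R x} {ω : ι → Set X} {n₀ : ℕ}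
  {J : X → ℝ} {β : ℝ}

lemma indJac_pos (hJ : ∀ x, 0 < J x) (T : Tower R → Tower R) (n₀ i : ℕ) (u : Tower R × Tower R) :
    0 < indJac T n₀ J i u :=
  Finset.prod_pos fun _ _ => mul_pos (iterJac_pos hJ _ _ _) (iterJac_pos hJ _ _ _)

lemma indJac_succ (T : Tower R → Tower R) (n₀ i : ℕ) (u : Tower R × Tower R) :
    indJac T n₀ J (i + 1) u = indJac T n₀ J i u *
      (iterJac T J (simRet T n₀ ((indMap T n₀)^[i] u)).toNat ((indMap T n₀)^[i] u).1 *
        iterJac T J (simRet T n₀ ((indMap T n₀)^[i] u)).toNat ((indMap T n₀)^[i] u).2) :=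
  Finset.prod_range_succ _ _

lemma indJac_eq (T : Tower R → Tower R) (n₀ i : ℕ) (u : Tower R × Tower R) :
    indJac T n₀ J i u =
      iterJac T J (stopTime T n₀ i u) u.1 * iterJac T J (stopTime T n₀ i u) u.2 := by
  induction i with
  | zero => simp [indJac, iterJac, stopTime]
  | succ i ih =>
    rw [indJac_succ, ih, stopTime_succ, iterJac_add, iterJac_add, indMap_iterate]
    ring

/-- The contribution of a single step of `T̃` to the distortion of `J_{T̃^i}` on an element of
`⋁_{j<i} T̃^{-j} ξ̃`. -/
lemma indJac_step_le (hn : 0 < n₀) (hc : ∀ i, ∀ x ∈ ω i, ∀ y ∈ ω i, R x = R y)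
    (hJ : ∀ x, 0 < J x) (hβ : 0 < β) (hβ1 : β < 1) {c : ℝ} (hc0 : 0 ≤ c)
    (hG : ∀ i, ∀ x ∈ ω i, ∀ y ∈ ω i, Real.log (J x / J y) ≤ c * epow β (sep F ω (F x) (F y)))
    {i k : ℕ} (hk : k < i) {u v : Tower R × Tower R}
    (h : v ∈ xiElt (towerMap F R hR) n₀ ω i u) :
    let T := towerMap F R hR
    let U := (indMap T n₀)^[k] u
    let V := (indMap T n₀)^[k] v
    iterJac T J (simRet T n₀ U).toNat U.1 * iterJac T J (simRet T n₀ U).toNat U.2 ≤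
      Real.exp (2 * (c / (1 - β)) * β ^ (i - (k + 1))) *
        (iterJac T J (simRet T n₀ V).toNat V.1 * iterJac T J (simRet T n₀ V).toNat V.2) := by
  intro T U V
  obtain ⟨r, rfl⟩ := Nat.exists_eq_add_of_le (Nat.succ_le_of_lt hk)
  have hK : 0 ≤ c / (1 - β) := div_nonneg hc0 (by linarith)
  obtain ⟨h1, h2, h3, h4⟩ := sameXi_iff.1 (h k hk)
  have h5 := (mem_xiElt_add.1 h).2
  obtain ⟨h6, h7⟩ := le_sep_of_mem_xiElt hn hc r _ _ h5
  simp only [Function.iterate_succ_apply', indMap] at h6 h7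
  rw [← h2] at h6 h7
  have h8 := h3.iterJac_le hc hJ hβ hβ1 hc0 hG
  have h9 := h4.iterJac_le hc hJ hβ hβ1 hc0 hG
  have h10 := mul_le_mul_of_nonneg_left (epow_le_pow hβ.le hβ1.le h6) hK
  have h11 := mul_le_mul_of_nonneg_left (epow_le_pow hβ.le hβ1.le h7) hK
  have hV : simRet T n₀ V = simRet T n₀ U := h2.symm
  have hr : k + 1 + r - (k + 1) = r := by omega
  rw [hV, hr]
  have e1 := iterJac_pos hJ T (simRet T n₀ U).toNat U.1
  have e2 := iterJac_pos hJ T (simRet T n₀ U).toNat U.2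
  have e3 := iterJac_pos hJ T (simRet T n₀ U).toNat V.1
  have e4 := iterJac_pos hJ T (simRet T n₀ U).toNat V.2
  have e5 : Real.exp (2 * (c / (1 - β)) * β ^ r) =
      Real.exp (c / (1 - β) * β ^ r) * Real.exp (c / (1 - β) * β ^ r) := by
    rw [← Real.exp_add]; ring_nf
  rw [e5]
  calc _ ≤ (Real.exp (c / (1 - β) * β ^ r) * iterJac T J (simRet T n₀ U).toNat V.1) *
        (Real.exp (c / (1 - β) * β ^ r) * iterJac T J (simRet T n₀ U).toNat V.2) := by
        refine mul_le_mul (h8.trans ?_) (h9.trans ?_) e2.le (by positivity)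
        · exact mul_le_mul_of_nonneg_right (Real.exp_le_exp.2 h10) e3.le
        · exact mul_le_mul_of_nonneg_right (Real.exp_le_exp.2 h11) e4.le
    _ = _ := by ring

/-- Subtracting at most the proportion `e / 2` of a common lower bound `a` from two numbers whose
ratio is at most `exp d` gives numbers whose ratio is at most `exp ((1 + e) d)`. -/
lemma sub_mul_le_exp_mul {A A' a ε e d : ℝ} (ha : 0 ≤ a) (haA : a ≤ A') (hd : 0 ≤ d)
    (hA : A ≤ Real.exp d * A') (hε : 0 ≤ ε) (hεe : ε ≤ e / 2) (he : e ≤ 1 / 2) :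
    A - ε * a ≤ Real.exp ((1 + e) * d) * (A' - ε * a) := by
  have hy : 1 ≤ Real.exp d := Real.one_le_exp hd
  have hB := one_add_mul_self_le_rpow_one_add (s := Real.exp d - 1) (by linarith) (p := 1 + e)
    (by linarith)
  rw [add_sub_cancel, ← Real.exp_mul, mul_comm d] at hB
  have h1 : 0 ≤ A' - ε * a := by nlinarith
  have h2 : 0 ≤ (Real.exp d - 1) * (e * A' - ε * a * (1 + e)) := by
    refine mul_nonneg (by linarith) ?_
    have h3 : ε * (1 + e) ≤ e := by nlinarith
    have h4 : ε * (1 + e) * a ≤ e * A' := mul_le_mul h3 haA ha (by linarith)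
    linarith
  have h3 := mul_le_mul_of_nonneg_right hB h1
  nlinarith

/-- Densities built like the densities `Φ̃_i`, except that the proportion `ε_i` that is subtracted
may depend on the point. -/
noncomputable def partialDensity (T : Tower R → Tower R) (n₀ : ℕ) (ω : ι → Set X) (J : X → ℝ)
    (ε : ℕ → Tower R × Tower R → ℝ) (Φ : Tower R × Tower R → ℝ) : ℕ → Tower R × Tower R → ℝ
  | 0, u => Φ u
  | i + 1, u => partialDensity T n₀ ω J ε Φ i u -
      ε (i + 1) u * indJac T n₀ J (i + 1) u *
        sInf ((fun v => partialDensity T n₀ ω J ε Φ i v / indJac T n₀ J (i + 1) v) ''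
          xiElt T n₀ ω (i + 1) u)

lemma tildeDensity_eq_partialDensity (T : Tower R → Tower R) (n₀ : ℕ) (ω : ι → Set X) (J : X → ℝ)
    (ε : ℕ → ℝ) (Φ : Tower R × Tower R → ℝ) (i : ℕ) :
    tildeDensity T n₀ ω J ε Φ i = partialDensity T n₀ ω J (fun i _ => ε i) Φ i := by
  induction i with
  | zero => rfl
  | succ i ih =>
    funext u
    simp only [tildeDensity, partialDensity, ih]

/-- The weights are admissible for the sequence `e`: they lie between `0` and `e_k / 2`, and are
constant on the elements of `⋁_{j<k} T̃^{-j} ξ̃`. -/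
structure IsWeight (T : Tower R → Tower R) (n₀ : ℕ) (ω : ι → Set X) (e : ℕ → ℝ)
    (ε : ℕ → Tower R × Tower R → ℝ) : Prop where
  nonneg : ∀ k ≥ 1, ∀ u, 0 ≤ ε k u
  le : ∀ k ≥ 1, ∀ u, ε k u ≤ e k / 2
  le_half : ∀ k ≥ 1, e k ≤ 1 / 2
  const : ∀ k ≥ 1, ∀ u v, v ∈ xiElt T n₀ ω k u → ε k v = ε k u

section Steps

variable {T : Tower R → Tower R} {ε : ℕ → Tower R × Tower R → ℝ} {e : ℕ → ℝ}
  {Φ : Tower R × Tower R → ℝ}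

lemma IsWeight.le_quarter (h : IsWeight T n₀ ω e ε) {k : ℕ} (hk : 1 ≤ k) (u : Tower R × Tower R) :
    ε k u ≤ 1 / 4 := by
  have h1 := h.le k hk u
  have h2 := h.le_half k hk
  linarith

lemma sInf_ratio_mem (hd : Pairwise fun i j => Disjoint (ω i) (ω j)) (hJ : ∀ x, 0 < J x) {k : ℕ}
    {ψ : Tower R × Tower R → ℝ} (hψ : ∀ v, v ∈ xiElt T n₀ ω (k + 1) v → 0 < ψ v)
    (u : Tower R × Tower R) :
    0 ≤ sInf ((fun v => ψ v / indJac T n₀ J (k + 1) v) '' xiElt T n₀ ω (k + 1) u) ∧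
      ∀ v ∈ xiElt T n₀ ω (k + 1) u,
        sInf ((fun v => ψ v / indJac T n₀ J (k + 1) v) '' xiElt T n₀ ω (k + 1) u) ≤
          ψ v / indJac T n₀ J (k + 1) v := by
  have hpos : ∀ v ∈ xiElt T n₀ ω (k + 1) u, 0 < ψ v / indJac T n₀ J (k + 1) v := fun v hv =>
    div_pos (hψ v (mem_xiElt_self hd (mem_xiElt_comm hv))) (indJac_pos hJ _ _ _ _)
  constructor
  · refine Real.sInf_nonneg ?_
    rintro _ ⟨v, hv, rfl⟩
    exact (hpos v hv).le
  · intro v hv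
    refine csInf_le ⟨0, ?_⟩ ⟨v, hv, rfl⟩
    rintro _ ⟨w, hw, rfl⟩
    exact (hpos w hw).le

/-- Outside the elements of `⋁_{j<k+1} T̃^{-j} ξ̃` nothing is subtracted. -/
lemma partialDensity_succ_of_notMem (hd : Pairwise fun i j => Disjoint (ω i) (ω j)) {k : ℕ}
    {u : Tower R × Tower R} (hu : u ∉ xiElt T n₀ ω (k + 1) u) :
    partialDensity T n₀ ω J ε Φ (k + 1) u = partialDensity T n₀ ω J ε Φ k u := by
  have : xiElt T n₀ ω (k + 1) u = ∅ := by
    rw [eq_empty_iff_forall_notMem]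
    exact fun v hv => hu (mem_xiElt_self hd hv)
  simp [partialDensity, this]

/-- Each step removes at most half of the density, and adds nothing. -/
lemma partialDensity_pos_and_bounds (hd : Pairwise fun i j => Disjoint (ω i) (ω j))
    (hJ : ∀ x, 0 < J x) (hε : IsWeight T n₀ ω e ε)
    (hΦ : ∀ u, u ∈ xiElt T n₀ ω 1 u → 0 < Φ u) (k : ℕ) :
    (∀ u, u ∈ xiElt T n₀ ω 1 u → 0 < partialDensity T n₀ ω J ε Φ k u) ∧
    ∀ u, u ∈ xiElt T n₀ ω 1 u →
      partialDensity T n₀ ω J ε Φ (k + 1) u ≤ partialDensity T n₀ ω J ε Φ k u ∧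
      1 / 2 * partialDensity T n₀ ω J ε Φ k u ≤ partialDensity T n₀ ω J ε Φ (k + 1) u := by
  have step : ∀ k, (∀ u, u ∈ xiElt T n₀ ω 1 u → 0 < partialDensity T n₀ ω J ε Φ k u) →
      ∀ u, u ∈ xiElt T n₀ ω 1 u →
      partialDensity T n₀ ω J ε Φ (k + 1) u ≤ partialDensity T n₀ ω J ε Φ k u ∧
      1 / 2 * partialDensity T n₀ ω J ε Φ k u ≤ partialDensity T n₀ ω J ε Φ (k + 1) u := by
    intro k hpos u hu1
    by_cases hu : u ∈ xiElt T n₀ ω (k + 1) u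
    · obtain ⟨h0, hle⟩ := sInf_ratio_mem (n₀ := n₀) (T := T) hd hJ
        (fun v hv => hpos v (xiElt_anti (Nat.le_add_left 1 k) v hv)) u
      have hJu := indJac_pos hJ T n₀ (k + 1) u
      have h1 := hle u hu
      rw [le_div_iff₀ hJu] at h1
      have h2 := hε.nonneg (k + 1) (by omega) u
      have h3 := hε.le_quarter (k := k + 1) (by omega) u
      have h4 := hpos u hu1
      simp only [partialDensity]
      set a := sInf ((fun v => partialDensity T n₀ ω J ε Φ k v / indJac T n₀ J (k + 1) v) ''
          xiElt T n₀ ω (k + 1) u)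
      have h5 : ε (k + 1) u * indJac T n₀ J (k + 1) u * a ≤
          1 / 4 * partialDensity T n₀ ω J ε Φ k u := by
        calc _ = ε (k + 1) u * (a * indJac T n₀ J (k + 1) u) := by ring
          _ ≤ _ := mul_le_mul h3 h1 (by positivity) (by norm_num)
      have h6 : 0 ≤ ε (k + 1) u * indJac T n₀ J (k + 1) u * a := by positivity
      constructor <;> linarith
    · rw [partialDensity_succ_of_notMem hd hu]
      have := hpos u hu1
      constructor <;> linarith
  have hpos : ∀ u, u ∈ xiElt T n₀ ω 1 u → 0 < partialDensity T n₀ ω J ε Φ k u := by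
    induction k with
    | zero => exact hΦ
    | succ k ih =>
      intro u hu
      have h1 := (step k ih u hu).2
      have h2 := ih u hu
      linarith
  exact ⟨hpos, step k hpos⟩

/-- The bound for the distortion of the densities that is obtained by iterating the single
steps. -/
noncomputable def distBound (e : ℕ → ℝ) (g K β : ℝ) (i k : ℕ) : ℝ :=
  (∏ j ∈ Finset.Icc 1 k, (1 + e j)) * g +
    ∑ j ∈ Finset.Icc 1 (k + 1), (∏ l ∈ Finset.Icc j k, (1 + e l)) * (2 * K * β ^ (i - j))

lemma distBound_zero (e : ℕ → ℝ) (g K β : ℝ) (i : ℕ) :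
    distBound e g K β i 0 = g + 2 * K * β ^ (i - 1) := by simp [distBound]

lemma distBound_succ (e : ℕ → ℝ) (g K β : ℝ) (i k : ℕ) :
    distBound e g K β i (k + 1) =
      (1 + e (k + 1)) * distBound e g K β i k + 2 * K * β ^ (i - (k + 2)) := by
  unfold distBound
  rw [Finset.prod_Icc_succ_top (by omega), Finset.sum_Icc_succ_top (b := k + 1) (by omega)]
  have h1 : ∏ l ∈ Finset.Icc (k + 1 + 1) (k + 1), (1 + e l) = 1 := by
    rw [Finset.Icc_eq_empty (by omega), Finset.prod_empty]
  have h2 : ∑ j ∈ Finset.Icc 1 (k + 1),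
      (∏ l ∈ Finset.Icc j (k + 1), (1 + e l)) * (2 * K * β ^ (i - j)) =
      (1 + e (k + 1)) * ∑ j ∈ Finset.Icc 1 (k + 1),
        (∏ l ∈ Finset.Icc j k, (1 + e l)) * (2 * K * β ^ (i - j)) := by
    rw [Finset.mul_sum]
    refine Finset.sum_congr rfl fun j hj => ?_
    rw [Finset.prod_Icc_succ_top (Finset.mem_Icc.1 hj).2]
    ring
  rw [h1, h2]
  ring

lemma distBound_nonneg {e : ℕ → ℝ} {g K β : ℝ} (he : ∀ k ≥ 1, 0 ≤ e k) (hg : 0 ≤ g) (hK : 0 ≤ K)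
    (hβ : 0 ≤ β) (i k : ℕ) : 0 ≤ distBound e g K β i k := by
  induction k with
  | zero => rw [distBound_zero]; positivity
  | succ k ih =>
    rw [distBound_succ]
    have := he (k + 1) (by omega)
    positivity

end Steps

/-- On an element of `⋁_{j<i} T̃^{-j} ξ̃` the ratios of the normalised densities
`Ψ_k / J_{T̃^{k+1}}` are controlled by iterating two estimates: subtracting the infimum multiplies
the logarithm of the ratio by at most `1 + e_k`, and dividing by the next Jacobian adds at most
`2 K β ^ (i - k)`. -/
lemma partialDensity_ratio_le_distBound (hn : 0 < n₀)
    (hd : Pairwise fun i j => Disjoint (ω i) (ω j))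
    (hc : ∀ i, ∀ x ∈ ω i, ∀ y ∈ ω i, R x = R y)
    (hJ : ∀ x, 0 < J x) (hβ : 0 < β) (hβ1 : β < 1) {c : ℝ} (hc0 : 0 ≤ c)
    (hG : ∀ i, ∀ x ∈ ω i, ∀ y ∈ ω i, Real.log (J x / J y) ≤ c * epow β (sep F ω (F x) (F y)))
    {ε : ℕ → Tower R × Tower R → ℝ} {e : ℕ → ℝ} {Φ : Tower R × Tower R → ℝ}
    (hε : IsWeight (towerMap F R hR) n₀ ω e ε) (he : ∀ k ≥ 1, 0 ≤ e k)
    (hΦ : ∀ u, u ∈ xiElt (towerMap F R hR) n₀ ω 1 u → 0 < Φ u)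
    {g : ℝ} (hg : 0 ≤ g) {i : ℕ}
    (hΦg : ∀ u v, v ∈ xiElt (towerMap F R hR) n₀ ω i u → Φ u ≤ Real.exp g * Φ v)
    (k : ℕ) (hk : k < i) (u v : Tower R × Tower R)
    (h : v ∈ xiElt (towerMap F R hR) n₀ ω i u) :
    partialDensity (towerMap F R hR) n₀ ω J ε Φ k u / indJac (towerMap F R hR) n₀ J (k + 1) u ≤
      Real.exp (distBound e g (c / (1 - β)) β i k) *
        (partialDensity (towerMap F R hR) n₀ ω J ε Φ k v /
          indJac (towerMap F R hR) n₀ J (k + 1) v) := by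
  have hK : 0 ≤ c / (1 - β) := div_nonneg hc0 (by linarith)
  set T := towerMap F R hR with hT
  -- dividing by the Jacobian of one more step of the induced map
  have hdiv : ∀ k < i, ∀ (ψ ψ' d : ℝ), 0 ≤ ψ' →
      ψ / indJac T n₀ J k u ≤ Real.exp d * (ψ' / indJac T n₀ J k v) →
      ψ / indJac T n₀ J (k + 1) u ≤
        Real.exp (d + 2 * (c / (1 - β)) * β ^ (i - (k + 1))) *
          (ψ' / indJac T n₀ J (k + 1) v) := by
    intro k hk ψ ψ' d hψ' hle
    have h1 := indJac_step_le hn hc hJ hβ hβ1 hc0 hG hk (mem_xiElt_comm h)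
    simp only [← hT] at h1
    rw [indJac_succ, indJac_succ, Real.exp_add]
    have p1 := mul_pos (iterJac_pos hJ T (simRet T n₀ ((indMap T n₀)^[k] u)).toNat
      ((indMap T n₀)^[k] u).1) (iterJac_pos hJ T (simRet T n₀ ((indMap T n₀)^[k] u)).toNat
      ((indMap T n₀)^[k] u).2)
    have p2 := mul_pos (iterJac_pos hJ T (simRet T n₀ ((indMap T n₀)^[k] v)).toNat
      ((indMap T n₀)^[k] v).1) (iterJac_pos hJ T (simRet T n₀ ((indMap T n₀)^[k] v)).toNat
      ((indMap T n₀)^[k] v).2)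
    have p3 : 0 ≤ ψ' / indJac T n₀ J k v := div_nonneg hψ' (indJac_pos hJ _ _ _ _).le
    set a := iterJac T J (simRet T n₀ ((indMap T n₀)^[k] u)).toNat ((indMap T n₀)^[k] u).1 *
      iterJac T J (simRet T n₀ ((indMap T n₀)^[k] u)).toNat ((indMap T n₀)^[k] u).2
    set b := iterJac T J (simRet T n₀ ((indMap T n₀)^[k] v)).toNat ((indMap T n₀)^[k] v).1 *
      iterJac T J (simRet T n₀ ((indMap T n₀)^[k] v)).toNat ((indMap T n₀)^[k] v).2
    set E := Real.exp (2 * (c / (1 - β)) * β ^ (i - (k + 1)))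
    rw [← div_div ψ, ← div_div ψ', div_le_iff₀ p1]
    calc ψ / indJac T n₀ J k u ≤ Real.exp d * (ψ' / indJac T n₀ J k v) := hle
      _ = Real.exp d * (ψ' / indJac T n₀ J k v / b) * b := by field_simp
      _ ≤ Real.exp d * (ψ' / indJac T n₀ J k v / b) * (E * a) := by gcongr
      _ = _ := by ring
  have hmem : ∀ k < i, u ∈ xiElt T n₀ ω (k + 1) u ∧ v ∈ xiElt T n₀ ω (k + 1) u := fun k hk =>
    ⟨xiElt_anti hk u (mem_xiElt_self hd h), xiElt_anti hk u h⟩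
  have hi1 : 1 ≤ i := by omega
  have hu1 : u ∈ xiElt T n₀ ω 1 u := xiElt_anti hi1 u (mem_xiElt_self hd h)
  have hv1 : v ∈ xiElt T n₀ ω 1 v :=
    xiElt_anti hi1 v (mem_xiElt_self hd (mem_xiElt_comm h))
  induction k with
  | zero =>
    rw [distBound_zero]
    refine hdiv 0 hk _ _ g (hΦ v hv1).le ?_
    simpa [indJac, partialDensity] using hΦg u v h
  | succ k ih =>
    have ih := ih (by omega)
    rw [distBound_succ]
    have hpos := (partialDensity_pos_and_bounds hd hJ hε hΦ k).1
    refine hdiv (k + 1) hk _ _ _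
      ((partialDensity_pos_and_bounds hd hJ hε hΦ (k + 1)).1 v hv1).le ?_
    obtain ⟨hu, hv⟩ := hmem k (by omega)
    obtain ⟨h0, hle⟩ := sInf_ratio_mem (n₀ := n₀) (T := T) hd hJ (k := k)
        (fun w hw => hpos w (xiElt_anti (Nat.le_add_left 1 k) w hw)) u
    simp only [partialDensity]
    rw [hε.const (k + 1) (by omega) u v hv, xiElt_eq_of_mem hd hv]
    have hJu := (indJac_pos hJ T n₀ (k + 1) u).ne'
    have hJv := (indJac_pos hJ T n₀ (k + 1) v).ne'
    set a := sInf ((fun v => partialDensity T n₀ ω J ε Φ k v / indJac T n₀ J (k + 1) v) ''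
          xiElt T n₀ ω (k + 1) u)
    have e1 : ∀ x w, indJac T n₀ J (k + 1) w ≠ 0 →
        (x - ε (k + 1) u * indJac T n₀ J (k + 1) w * a) / indJac T n₀ J (k + 1) w =
        x / indJac T n₀ J (k + 1) w - ε (k + 1) u * a := by
      intro x w hw
      field_simp
    rw [e1 _ u hJu, e1 _ v hJv]
    exact sub_mul_le_exp_mul h0 (hle v hv) (distBound_nonneg he hg hK hβ.le i k) ih
      (hε.nonneg _ (by omega) u) (hε.le _ (by omega) u) (hε.le_half _ (by omega))

/-- The conditions on the sequence `ε'` bound the distortion uniformly. -/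
lemma distBound_le {e w : ℕ → ℝ} {C C'' K D₃ : ℝ} (hβ : 0 < β)
    (he : IsEpsSeq β D₃ w e) (hC : 0 ≤ C) (hC'' : 0 ≤ C'') (hK : 0 ≤ K)
    (i : ℕ) (hw : 0 ≤ w (i + 1)) :
    distBound e (C * w (i + 1) + 2 * C'' * β ^ (i + 1)) K β (i + 1) i ≤
      C * D₃ + 2 * C'' * D₃ + 2 * K / β * D₃ := by
  have hone : ∀ k ≥ 1, 1 ≤ 1 + e k := fun k hk => by have := he.pos k hk; linarith
  have hprod : ∀ j ≥ 1, ∀ k, 0 ≤ ∏ l ∈ Finset.Icc j k, (1 + e l) := fun j hj k =>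
    Finset.prod_nonneg fun l hl => by
      have := hone l (hj.trans (Finset.mem_Icc.1 hl).1)
      linarith
  have hmono : ∀ j ≥ 1, j ≤ i + 1 →
      ∏ l ∈ Finset.Icc j i, (1 + e l) ≤ ∏ l ∈ Finset.Icc j (i + 1), (1 + e l) := by
    intro j hj hji
    rw [Finset.prod_Icc_succ_top hji]
    exact le_mul_of_one_le_right (hprod j hj i) (hone _ (by omega))
  have h1 := he.variation_bound (i + 1) (by omega)
  have h2 := he.geometric_bound (i + 1) (by omega)
  -- the first summand of the geometric bound
  have h3 : (∏ l ∈ Finset.Icc 1 (i + 1), (1 + e l)) * β ^ (i + 1) ≤ D₃ := by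
    refine le_trans ?_ h2
    have := Finset.single_le_sum (f := fun j => (∏ k ∈ Finset.Icc j (i + 1), (1 + e k)) *
      β ^ (i + 1 - j + 1)) (s := Finset.Icc 1 (i + 1))
      (fun j hj => mul_nonneg (hprod j (Finset.mem_Icc.1 hj).1 _) (by positivity))
      (Finset.mem_Icc.2 ⟨le_rfl, by omega⟩)
    simpa using this
  have h4 : ∑ j ∈ Finset.Icc 1 (i + 1), (∏ l ∈ Finset.Icc j i, (1 + e l)) *
      (2 * K * β ^ (i + 1 - j)) ≤ 2 * K / β * D₃ := by
    calc _ ≤ ∑ j ∈ Finset.Icc 1 (i + 1), 2 * K / β *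
          ((∏ l ∈ Finset.Icc j (i + 1), (1 + e l)) * β ^ (i + 1 - j + 1)) := by
          refine Finset.sum_le_sum fun j hj => ?_
          obtain ⟨hj1, hj2⟩ := Finset.mem_Icc.1 hj
          have := hmono j hj1 hj2
          calc _ ≤ (∏ l ∈ Finset.Icc j (i + 1), (1 + e l)) * (2 * K * β ^ (i + 1 - j)) := by
                gcongr
            _ = _ := by rw [pow_succ]; field_simp
      _ = 2 * K / β * ∑ j ∈ Finset.Icc 1 (i + 1),
          ((∏ l ∈ Finset.Icc j (i + 1), (1 + e l)) * β ^ (i + 1 - j + 1)) := by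
          rw [Finset.mul_sum]
      _ ≤ _ := by gcongr
  have h5 := hmono 1 le_rfl (by omega)
  unfold distBound
  have h6 : (∏ j ∈ Finset.Icc 1 i, (1 + e j)) * (C * w (i + 1) + 2 * C'' * β ^ (i + 1)) ≤
      C * D₃ + 2 * C'' * D₃ := by
    calc _ ≤ (∏ j ∈ Finset.Icc 1 (i + 1), (1 + e j)) *
          (C * w (i + 1) + 2 * C'' * β ^ (i + 1)) := by gcongr
      _ = C * (w (i + 1) * ∏ j ∈ Finset.Icc 1 (i + 1), (1 + e j)) +
          2 * C'' * ((∏ l ∈ Finset.Icc 1 (i + 1), (1 + e l)) * β ^ (i + 1)) := by ring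
      _ ≤ _ := by gcongr
  linarith

/-- If the ratios of the normalised densities on the elements are at most `D`, a step removes at
least the proportion `ε / D`. -/
lemma partialDensity_succ_le (hJ : ∀ x, 0 < J x) {T : Tower R → Tower R}
    {ε : ℕ → Tower R × Tower R → ℝ}
    {Φ : Tower R × Tower R → ℝ} {k : ℕ} {D : ℝ} (hD : 0 < D) {u : Tower R × Tower R}
    (hε : 0 ≤ ε (k + 1) u) (hu : u ∈ xiElt T n₀ ω (k + 1) u)
    (hratio : ∀ v ∈ xiElt T n₀ ω (k + 1) u,
      partialDensity T n₀ ω J ε Φ k u / indJac T n₀ J (k + 1) u ≤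
        D * (partialDensity T n₀ ω J ε Φ k v / indJac T n₀ J (k + 1) v)) :
    partialDensity T n₀ ω J ε Φ (k + 1) u ≤
      (1 - ε (k + 1) u / D) * partialDensity T n₀ ω J ε Φ k u := by
  have hJu := indJac_pos hJ T n₀ (k + 1) u
  have h1 : partialDensity T n₀ ω J ε Φ k u / indJac T n₀ J (k + 1) u / D ≤
      sInf ((fun v => partialDensity T n₀ ω J ε Φ k v / indJac T n₀ J (k + 1) v) ''
          xiElt T n₀ ω (k + 1) u) := by
    refine le_csInf ⟨_, u, hu, rfl⟩ ?_
    rintro _ ⟨v, hv, rfl⟩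
    rw [div_le_iff₀ hD, mul_comm]
    exact hratio v hv
  simp only [partialDensity]
  have h2 := mul_le_mul_of_nonneg_left h1 (mul_nonneg hε hJu.le)
  have h3 : ε (k + 1) u * indJac T n₀ J (k + 1) u *
      (partialDensity T n₀ ω J ε Φ k u / indJac T n₀ J (k + 1) u / D) =
      ε (k + 1) u / D * partialDensity T n₀ ω J ε Φ k u := by
    field_simp
  linarith

end Densities

/-! ### Product densities -/

section ProductDensity

variable {X ι : Type*} {F : X → X} {R : X → ℕ} {hR : ∀ x, 0 < R x} {ω : ι → Set X} {n₀ : ℕ}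
  {β : ℝ} {φ₁ φ₂ : Tower R → ℝ}

lemma bddAbove_variation {φ : Tower R → ℝ} (h : ∃ K : ℝ, ∀ p, |φ p| ≤ K) (n : ℕ∞) :
    BddAbove {r | ∃ p q : Tower R, n ≤ towerSep F ω p q ∧ r = |φ p - φ q|} := by
  obtain ⟨K, hK⟩ := h
  refine ⟨K + K, ?_⟩
  rintro _ ⟨p, q, -, rfl⟩
  exact (abs_sub _ _).trans (add_le_add (hK p) (hK q))

lemma variation_nonneg (φ : Tower R → ℝ) (n : ℕ∞) : 0 ≤ variation F ω φ n := by
  refine Real.sSup_nonneg ?_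
  rintro _ ⟨p, q, -, rfl⟩
  exact abs_nonneg _

lemma abs_sub_le_variation {φ : Tower R → ℝ} (h : ∃ K : ℝ, ∀ p, |φ p| ≤ K) {n : ℕ∞}
    {p q : Tower R} (hpq : n ≤ towerSep F ω p q) : |φ p - φ q| ≤ variation F ω φ n :=
  le_csSup (bddAbove_variation h n) ⟨p, q, hpq, rfl⟩

lemma variation_anti {φ : Tower R → ℝ} (h : ∃ K : ℝ, ∀ p, |φ p| ≤ K) {n k : ℕ∞} (hnk : n ≤ k) :
    variation F ω φ k ≤ variation F ω φ n := by
  refine Real.sSup_le ?_ (variation_nonneg _ _)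
  rintro _ ⟨p, q, hpq, rfl⟩
  exact abs_sub_le_variation h (hnk.trans hpq)

lemma variation₂_anti (h₁ : ∃ K : ℝ, ∀ p, |φ₁ p| ≤ K) (h₂ : ∃ K : ℝ, ∀ p, |φ₂ p| ≤ K) {n k : ℕ∞}
    (hnk : n ≤ k) : variation₂ F ω φ₁ φ₂ k ≤ variation₂ F ω φ₁ φ₂ n :=
  max_le_max (variation_anti h₁ hnk) (variation_anti h₂ hnk)

lemma variation₂_nonneg (n : ℕ∞) : 0 ≤ variation₂ F ω φ₁ φ₂ n :=
  (variation_nonneg _ _).trans (le_max_left _ _)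

lemma xiElt_one_towerSame (hn : 0 < n₀) {u v : Tower R × Tower R}
    {T : Tower R → Tower R} {i : ℕ} (hi : 1 ≤ i) (h : v ∈ xiElt T n₀ ω i u) :
    TowerSame ω u.1 v.1 ∧ TowerSame ω u.2 v.2 := by
  have h1 := mem_xiElt_one.1 (xiElt_anti hi u h)
  exact h1.2.2 0 (one_le_simRet hn h1.1)

/-- The distortion of `Φ = φ₁ ⊗ φ₂` on the elements of `⋁_{j<i} T̃^{-j} ξ̃`. -/
lemma product_ratio_le (hn : 0 < n₀) (hc : ∀ i, ∀ x ∈ ω i, ∀ y ∈ ω i, R x = R y)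
    (hβ : 0 < β) (hβ1 : β < 1) {C C₁ C₂ C'' : ℝ} (hC'' : 0 ≤ C'')
    (h₁ : ∃ K : ℝ, ∀ p, |φ₁ p| ≤ K) (h₂ : ∃ K : ℝ, ∀ p, |φ₂ p| ≤ K)
    (hpos₁ : ∀ p q : Tower R, TowerSame ω p q → 0 < φ₁ p)
    (hpos₂ : ∀ p q : Tower R, TowerSame ω p q → 0 < φ₂ p)
    (hC₁ : 0 ≤ C₁) (hC₂ : 0 ≤ C₂) (hC : C₁ + C₂ ≤ C)
    (hlog₁ : ∀ p q : Tower R, TowerSame ω p q → |Real.log (φ₁ p / φ₁ q)| ≤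
      C₁ * variation₂ F ω φ₁ φ₂ (towerSep F ω p q) + C'' * epow β (towerSep F ω p q))
    (hlog₂ : ∀ p q : Tower R, TowerSame ω p q → |Real.log (φ₂ p / φ₂ q)| ≤
      C₂ * variation₂ F ω φ₁ φ₂ (towerSep F ω p q) + C'' * epow β (towerSep F ω p q))
    {i : ℕ} (hi : 1 ≤ i) {u v : Tower R × Tower R}
    (h : v ∈ xiElt (towerMap F R hR) n₀ ω i u) :
    φ₁ u.1 * φ₂ u.2 ≤ Real.exp (C * variation₂ F ω φ₁ φ₂ i + 2 * C'' * β ^ i) *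
      (φ₁ v.1 * φ₂ v.2) := by
  obtain ⟨s1, s2⟩ := xiElt_one_towerSame hn hi h
  obtain ⟨h3, h4⟩ := le_sep_of_mem_xiElt hn hc i u v h
  rw [← towerSep_eq s1.1] at h3
  rw [← towerSep_eq s2.1] at h4
  have key : ∀ (φ : Tower R → ℝ) (c : ℝ) (p q : Tower R), 0 < φ p → 0 < φ q → 0 ≤ c →
      (i : ℕ∞) ≤ towerSep F ω p q →
      |Real.log (φ p / φ q)| ≤
      c * variation₂ F ω φ₁ φ₂ (towerSep F ω p q) + C'' * epow β (towerSep F ω p q) →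
      φ p ≤ Real.exp (c * variation₂ F ω φ₁ φ₂ i + C'' * β ^ i) * φ q := by
    intro φ c p q hp hq hc0 hs hlog
    rw [← div_le_iff₀ hq, ← Real.log_le_iff_le_exp (div_pos hp hq)]
    refine (le_abs_self _).trans (hlog.trans ?_)
    have := variation₂_anti (F := F) (ω := ω) h₁ h₂ hs
    have := epow_le_pow hβ.le hβ1.le hs
    gcongr
  have k1 := key φ₁ C₁ u.1 v.1 (hpos₁ _ _ s1) (hpos₁ _ _ s1.symm) hC₁ h3 (hlog₁ _ _ s1)
  have k2 := key φ₂ C₂ u.2 v.2 (hpos₂ _ _ s2) (hpos₂ _ _ s2.symm) hC₂ h4 (hlog₂ _ _ s2)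
  have q1 := hpos₁ _ _ s1.symm
  have q2 := hpos₂ _ _ s2.symm
  have hv := variation₂_nonneg (F := F) (ω := ω) (φ₁ := φ₁) (φ₂ := φ₂) (i : ℕ∞)
  calc φ₁ u.1 * φ₂ u.2 ≤
      (Real.exp (C₁ * variation₂ F ω φ₁ φ₂ i + C'' * β ^ i) * φ₁ v.1) *
      (Real.exp (C₂ * variation₂ F ω φ₁ φ₂ i + C'' * β ^ i) * φ₂ v.2) :=
        mul_le_mul k1 k2 (hpos₂ _ _ s2).le (by positivity)
    _ = Real.exp ((C₁ + C₂) * variation₂ F ω φ₁ φ₂ i + 2 * C'' * β ^ i) *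
      (φ₁ v.1 * φ₂ v.2) := by
        have : Real.exp ((C₁ + C₂) * variation₂ F ω φ₁ φ₂ i + 2 * C'' * β ^ i) =
            Real.exp (C₁ * variation₂ F ω φ₁ φ₂ i + C'' * β ^ i) *
            Real.exp (C₂ * variation₂ F ω φ₁ φ₂ i + C'' * β ^ i) := by
          rw [← Real.exp_add]
          ring_nf
        rw [this]
        ring
    _ ≤ _ := by gcongr

end ProductDensity

/-! ### The reference measure of the tower -/

section TowerPoints

variable {X ι : Type*} {R : X → ℕ} {hR : ∀ x, 0 < R x} {ω : ι → Set X}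

/-- The point of level `l` over `x` (of level `0` if the tower does not reach level `l`). -/
def levelPt (hR : ∀ x, 0 < R x) (l : ℕ) (x : X) : Tower R :=
  if h : l < R x then ⟨(x, l), h⟩ else ⟨(x, 0), hR x⟩

lemma levelPt_of_lt {l : ℕ} {x : X} (h : l < R x) : levelPt hR l x = ⟨(x, l), h⟩ := dif_pos h

lemma levelPt_eq (p : Tower R) : levelPt hR p.1.2 p.1.1 = p := levelPt_of_lt p.2

/-- The element `Δ_{l,i}` of the partition of the tower. -/
def towerElt (R : X → ℕ) (ω : ι → Set X) (e : ι × ℕ) : Set (Tower R) :=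
  {p | p.1.2 = e.2 ∧ p.1.1 ∈ ω e.1}

lemma towerSame_iff {p q : Tower R} :
    TowerSame ω p q ↔ ∃ e, p ∈ towerElt R ω e ∧ q ∈ towerElt R ω e := by
  constructor
  · rintro ⟨h, i, hp, hq⟩
    exact ⟨(i, p.1.2), ⟨rfl, hp⟩, ⟨h.symm, hq⟩⟩
  · rintro ⟨e, ⟨h1, h2⟩, ⟨h3, h4⟩⟩
    exact ⟨h1.trans h3.symm, e.1, h2, h4⟩

end TowerPoints

section TowerMeasure

variable {X ι : Type*} [MeasurableSpace X] {m : Measure X} {F : X → X} {R : X → ℕ}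
  {hR : ∀ x, 0 < R x} {ω : ι → Set X} {J : X → ℝ} {β : ℝ}

lemma measurableSet_lt_of_measurable (hRm : Measurable R) :
    MeasurableSet {q : X × ℕ | q.2 < R q.1} :=
  measurableSet_lt measurable_snd (hRm.comp measurable_fst)

lemma measurableEmbedding_towerVal (hRm : Measurable R) :
    MeasurableEmbedding (Subtype.val : Tower R → X × ℕ) :=
  MeasurableEmbedding.subtype_coe (measurableSet_lt_of_measurable hRm)

lemma measurable_towerProj : Measurable fun p : Tower R => p.1.1 :=
  measurable_fst.comp measurable_subtype_coe

lemma measurable_towerLevel : Measurable fun p : Tower R => p.1.2 :=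
  measurable_snd.comp measurable_subtype_coe

lemma measurableSet_base : MeasurableSet (base R) :=
  measurable_towerLevel (measurableSet_singleton 0)

lemma towerMeasure_level (hRm : Measurable R) [SFinite m] (A : Set X) (l : ℕ) :
    towerMeasure m R {p | p.1.2 = l ∧ p.1.1 ∈ A} = m (A ∩ {x | l < R x}) := by
  have himg : (Subtype.val : Tower R → X × ℕ) '' {p | p.1.2 = l ∧ p.1.1 ∈ A} =
      (A ∩ {x | l < R x}) ×ˢ {l} := by
    ext ⟨x, k⟩
    simp only [mem_image, Subtype.exists, mem_prod, mem_inter_iff, mem_singleton_iff]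
    constructor
    · rintro ⟨⟨y, k'⟩, h, ⟨rfl, hy⟩, he⟩
      obtain ⟨rfl, rfl⟩ := Prod.mk.inj he
      exact ⟨⟨hy, h⟩, rfl⟩
    · rintro ⟨⟨hx, hl⟩, rfl⟩
      exact ⟨(x, k), hl, ⟨rfl, hx⟩, rfl⟩
  rw [towerMeasure, (measurableEmbedding_towerVal hRm).comap_apply, himg, Measure.prod_prod,
    Measure.count_singleton, mul_one]

lemma towerMeasure_finite (hRm : Measurable R) [IsFiniteMeasure m]
    (hRint : Integrable (fun x => (R x : ℝ)) m) : IsFiniteMeasure (towerMeasure m R) := by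
  refine ⟨?_⟩
  rw [towerMeasure, (measurableEmbedding_towerVal hRm).comap_apply, image_univ,
    Subtype.range_coe_subtype]
  change (m.prod Measure.count) {q : X × ℕ | q.2 < R q.1} < ⊤
  rw [Measure.prod_apply (measurableSet_lt_of_measurable hRm)]
  have h1 : ∀ x, Measure.count (Prod.mk x ⁻¹' {q : X × ℕ | q.2 < R q.1}) =
      ENNReal.ofReal (R x) := by
    intro x
    have : Prod.mk x ⁻¹' {q : X × ℕ | q.2 < R q.1} = ↑(Finset.range (R x)) := by
      ext k; simp
    rw [this, Measure.count_apply_finset, Finset.card_range, ENNReal.ofReal_natCast]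
  simp_rw [h1]
  have := hRint.2
  rw [hasFiniteIntegral_iff_ofReal (ae_of_all _ fun x => by positivity)] at this
  exact this

lemma measurable_levelPt (hRm : Measurable R) (l : ℕ) : Measurable (levelPt hR l) := by
  rw [← (measurableEmbedding_towerVal hRm).measurable_comp_iff]
  have : (Subtype.val ∘ levelPt hR l : X → X × ℕ) =
      fun x => if l < R x then (x, l) else (x, 0) := by
    funext x
    simp only [Function.comp_apply, levelPt]
    split_ifs <;> rfl
  rw [this]
  exact Measurable.ite (measurableSet_lt measurable_const hRm) (by fun_prop) (by fun_prop)

lemma measurable_towerMap (hRm : Measurable R) (hFm : Measurable F) :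
    Measurable (towerMap F R hR) := by
  rw [← (measurableEmbedding_towerVal hRm).measurable_comp_iff]
  have : (Subtype.val ∘ towerMap F R hR : Tower R → X × ℕ) = fun p =>
      if p.1.2 + 1 < R p.1.1 then (p.1.1, p.1.2 + 1) else (F p.1.1, 0) := by
    funext x
    simp only [Function.comp_apply, towerMap]
    split_ifs <;> rfl
  rw [this]
  have h1 : Measurable fun p : Tower R => p.1.1 := measurable_towerProj
  have h2 : Measurable fun p : Tower R => p.1.2 := measurable_towerLevel
  exact Measurable.ite (measurableSet_lt (h2.add_const 1) (hRm.comp h1))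
    (h1.prodMk (h2.add_const 1)) ((hFm.comp h1).prodMk measurable_const)

lemma measurable_towerJac (hRm : Measurable R) (hJm : Measurable J) :
    Measurable (towerJac (R := R) J) := by
  have h1 : Measurable fun p : Tower R => p.1.1 := measurable_towerProj
  have h2 : Measurable fun p : Tower R => p.1.2 := measurable_towerLevel
  exact Measurable.ite (measurableSet_lt (h2.add_const 1) (hRm.comp h1)) measurable_const
    (hJm.comp h1)

lemma measurable_iterJac (hRm : Measurable R) (hJm : Measurable J) {T : Tower R → Tower R}
    (hT : Measurable T) (n : ℕ) : Measurable (iterJac T J n) :=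
  Finset.measurable_prod _ fun t _ => (measurable_towerJac hRm hJm).comp (hT.iterate t)

lemma setLIntegral_level (hRm : Measurable R) [SFinite m] {A : Set X} (hA : MeasurableSet A)
    (l : ℕ) {f : Tower R → ℝ≥0∞} (hf : Measurable f) :
    ∫⁻ p in {p | p.1.2 = l ∧ p.1.1 ∈ A}, f p ∂(towerMeasure m R) =
      ∫⁻ x in A ∩ {x | l < R x}, f (levelPt hR l x) ∂m := by
  have hset : ∀ B : Set X, MeasurableSet B →
      MeasurableSet {p : Tower R | p.1.2 = l ∧ p.1.1 ∈ B} := fun B hB =>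
    (measurable_towerLevel (measurableSet_singleton l)).inter (measurable_towerProj hB)
  have hmap : Measure.map (fun p : Tower R => p.1.1)
      ((towerMeasure m R).restrict {p | p.1.2 = l ∧ p.1.1 ∈ A}) =
      m.restrict (A ∩ {x | l < R x}) := by
    ext B hB
    rw [Measure.map_apply measurable_towerProj hB, Measure.restrict_apply
      (measurable_towerProj hB), Measure.restrict_apply hB]
    have : (fun p : Tower R => p.1.1) ⁻¹' B ∩ {p | p.1.2 = l ∧ p.1.1 ∈ A} =
        {p | p.1.2 = l ∧ p.1.1 ∈ B ∩ A} := by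
      ext p
      simp only [mem_inter_iff, mem_preimage, mem_ofPred_eq]
      tauto
    rw [this, towerMeasure_level hRm, inter_assoc]
  rw [← hmap, lintegral_map (f := fun x => f (levelPt hR l x))
    (hf.comp (measurable_levelPt hRm l)) measurable_towerProj]
  refine setLIntegral_congr_fun (hset A hA) ?_
  rintro p ⟨rfl, -⟩
  simp only [levelPt_eq]

lemma measurableSet_towerElt (hω : ∀ i, MeasurableSet (ω i)) (e : ι × ℕ) :
    MeasurableSet (towerElt R ω e) :=
  (measurable_towerLevel (measurableSet_singleton e.2)).inter (measurable_towerProj (hω e.1))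

/-- Change of variables on an element of the partition of the base. -/
lemma IsWGM.lintegral_image (hF : IsWGM m F ω J β) (i : ι) {g : X → ℝ≥0∞} (hg : Measurable g) :
    ∫⁻ x in ω i, ENNReal.ofReal (J x) * g (F x) ∂m = ∫⁻ y in F '' ω i, g y ∂m := by
  have hJm : Measurable fun x => ENNReal.ofReal (J x) := hF.measurable_jac.ennreal_ofReal
  have hmap : Measure.map F ((m.restrict (ω i)).withDensity fun x => ENNReal.ofReal (J x)) =
      m.restrict (F '' ω i) := by
    ext E hE
    have hFE := hF.measurable_map hE
    rw [Measure.map_apply hF.measurable_map hE, withDensity_apply _ hFE,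
      Measure.restrict_restrict hFE, Measure.restrict_apply hE,
      ← hF.measure_image i _ inter_subset_right (hFE.inter (hF.measurableSet_elt i)),
      inter_comm (F ⁻¹' E), image_inter_preimage, inter_comm]
  rw [← hmap, lintegral_map hg hF.measurable_map, lintegral_withDensity_eq_lintegral_mul _ hJm
    (g := fun x => g (F x)) (hg.comp hF.measurable_map)]
  rfl

/-- Each element is mapped over any other element, or meets its image in a null set only. -/
lemma IsWGM.inter_null_or_diff_null (hF : IsWGM m F ω J β) (i j : ι) :
    m (F '' ω i ∩ ω j) = 0 ∨ m (ω j \ F '' ω i) = 0 := by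
  obtain ⟨I, hI⟩ := hF.markov i
  by_cases hmem : j ∈ I
  · right
    rw [← ae_le_set]
    exact (LE.le.eventuallyLE (subset_biUnion_of_mem (u := ω) hmem)).trans hI.symm.le
  · left
    have h1 : (F '' ω i ∩ ω j : Set X) =ᵐ[m] ((⋃ k ∈ I, ω k) ∩ ω j : Set X) :=
      hI.inter (ae_eq_refl _)
    rw [measure_congr h1]
    convert measure_empty (μ := m)
    rw [eq_empty_iff_forall_notMem]
    rintro y ⟨h1, h2⟩
    obtain ⟨k, hk, hy⟩ := mem_iUnion₂.1 h1
    have : j ≠ k := fun h => hmem (h ▸ hk)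
    exact Set.disjoint_left.1 (hF.disjoint this) h2 hy

lemma IsReturnTime.lt_of_mem (hRt : IsReturnTime R ω) {i : ι} {x y : X} (hx : x ∈ ω i)
    (hy : y ∈ ω i) {l : ℕ} (h : l < R x) : l < R y := by
  rwa [← hRt.const i x hx y hy]

lemma towerElt_eq_empty (hRt : IsReturnTime R ω) {e : ι × ℕ} {x : X} (hx : x ∈ ω e.1)
    (h : ¬ e.2 < R x) : towerElt R ω e = ∅ := by
  rw [eq_empty_iff_forall_notMem]
  rintro p ⟨h1, h2⟩
  exact h (hRt.lt_of_mem h2 hx (h1 ▸ p.2))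

lemma image_towerElt_of_lt (hRt : IsReturnTime R ω) {e : ι × ℕ} {x : X} (hx : x ∈ ω e.1)
    (h : e.2 + 1 < R x) :
    towerMap F R hR '' towerElt R ω e = {p | p.1.2 = e.2 + 1 ∧ p.1.1 ∈ ω e.1} := by
  ext q
  constructor
  · rintro ⟨p, ⟨h1, h2⟩, rfl⟩
    have := hRt.lt_of_mem hx h2 h
    rw [← h1] at this
    rw [towerMap_of_lt this]
    exact ⟨by simp [h1], h2⟩
  · rintro ⟨h1, h2⟩
    have h3 : e.2 < R q.1.1 := by have := q.2; omega
    refine ⟨⟨(q.1.1, e.2), h3⟩, ⟨rfl, h2⟩, ?_⟩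
    rw [towerMap_of_lt (by exact hRt.lt_of_mem hx h2 h)]
    apply Subtype.ext
    simp only
    rw [← h1]

lemma image_towerElt_of_eq (hRt : IsReturnTime R ω) {e : ι × ℕ} {x : X} (hx : x ∈ ω e.1)
    (h : e.2 + 1 = R x) :
    towerMap F R hR '' towerElt R ω e = {p | p.1.2 = 0 ∧ p.1.1 ∈ F '' ω e.1} := by
  ext q
  constructor
  · rintro ⟨p, ⟨h1, h2⟩, rfl⟩
    have := hRt.const _ x hx _ h2
    rw [towerMap_of_not_lt (by omega)]
    exact ⟨rfl, _, h2, rfl⟩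
  · rintro ⟨h1, y, hy, h2⟩
    have h3 := hRt.const _ x hx _ hy
    refine ⟨⟨(y, e.2), by simp only; omega⟩, ⟨rfl, hy⟩, ?_⟩
    rw [towerMap_of_not_lt (by simp only; omega)]
    apply Subtype.ext
    simp only
    rw [← h1, h2]

lemma measurableSet_image_towerElt (hF : IsWGM m F ω J β) (hRt : IsReturnTime R ω)
    (e : ι × ℕ) : MeasurableSet (towerMap F R hR '' towerElt R ω e) := by
  rcases (ω e.1).eq_empty_or_nonempty with h | ⟨x, hx⟩
  · simp [towerElt, h]
  have hset : ∀ l, ∀ B : Set X, MeasurableSet B →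
      MeasurableSet {p : Tower R | p.1.2 = l ∧ p.1.1 ∈ B} := fun l B hB =>
    (measurable_towerLevel (measurableSet_singleton l)).inter (measurable_towerProj hB)
  rcases lt_trichotomy (e.2 + 1) (R x) with h | h | h
  · rw [image_towerElt_of_lt hRt hx h]
    exact hset _ _ (hF.measurableSet_elt _)
  · rw [image_towerElt_of_eq hRt hx h]
    exact hset _ _ (hF.measurableSet_image _ _ subset_rfl (hF.measurableSet_elt _))
  · rw [towerElt_eq_empty hRt hx (by omega), image_empty]
    exact MeasurableSet.empty

/-- Change of variables on an element of the partition of the tower. -/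
lemma lintegral_image_towerElt [SFinite m] (hF : IsWGM m F ω J β) (hRt : IsReturnTime R ω)
    (e : ι × ℕ) {g : Tower R → ℝ≥0∞} (hg : Measurable g) :
    ∫⁻ p in towerElt R ω e, ENNReal.ofReal (towerJac J p) * g (towerMap F R hR p)
        ∂(towerMeasure m R) =
      ∫⁻ p in towerMap F R hR '' towerElt R ω e, g p ∂(towerMeasure m R) := by
  have hRm := hRt.measurable
  have hm1 : Measurable fun p : Tower R => ENNReal.ofReal (towerJac J p) *
      g (towerMap F R hR p) :=
    (measurable_towerJac hRm hF.measurable_jac).ennreal_ofReal.mul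
      (hg.comp (measurable_towerMap hRm hF.measurable_map))
  rcases (ω e.1).eq_empty_or_nonempty with h | ⟨x, hx⟩
  · simp [towerElt, h]
  have hsub : ∀ l < R x, ω e.1 ∩ {x | l < R x} = ω e.1 := fun l hl =>
    inter_eq_left.2 fun y hy => hRt.lt_of_mem hx hy hl
  rcases lt_trichotomy (e.2 + 1) (R x) with h | h | h
  · rw [image_towerElt_of_lt hRt hx h, setLIntegral_level (hR := hR) hRm
      (hF.measurableSet_elt _) _ hg, towerElt, setLIntegral_level (hR := hR) hRm
      (hF.measurableSet_elt _) _ hm1, hsub _ h, hsub _ (by omega)]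
    refine setLIntegral_congr_fun (hF.measurableSet_elt _) fun y hy => ?_
    have h1 : e.2 + 1 < R y := hRt.lt_of_mem hx hy h
    have h2 : e.2 < R y := by omega
    rw [levelPt_of_lt h1, levelPt_of_lt h2, towerMap_of_lt (by exact h1)]
    simp [towerJac, h1]
  · have hFi := hF.measurableSet_image _ _ subset_rfl (hF.measurableSet_elt e.1)
    rw [image_towerElt_of_eq hRt hx h, setLIntegral_level (hR := hR) hRm
      hFi _ hg, towerElt, setLIntegral_level (hR := hR) hRm
      (hF.measurableSet_elt _) _ hm1, hsub _ (by omega),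
      show F '' ω e.1 ∩ {x | 0 < R x} = F '' ω e.1 from inter_eq_left.2 fun y _ => hR y,
      ← hF.lintegral_image e.1 (g := fun y => g (levelPt hR 0 y))
        (hg.comp (measurable_levelPt hRm 0))]
    refine setLIntegral_congr_fun (hF.measurableSet_elt _) fun y hy => ?_
    have h1 := hRt.const _ x hx _ hy
    have h2 : e.2 < R y := by omega
    rw [levelPt_of_lt h2, levelPt_of_lt (hR _), towerMap_of_not_lt (by simp only; omega)]
    have h3 : ¬ e.2 + 1 < R y := by omega
    simp [towerJac, h3]
  · rw [towerElt_eq_empty hRt hx (by omega)]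
    simp

/-- The Markov property of the tower map. -/
lemma towerElt_markov [SFinite m] (hF : IsWGM m F ω J β) (hRt : IsReturnTime R ω)
    (e e' : ι × ℕ) :
    towerMeasure m R (towerMap F R hR '' towerElt R ω e ∩ towerElt R ω e') = 0 ∨
      towerMeasure m R (towerElt R ω e' \ towerMap F R hR '' towerElt R ω e) = 0 := by
  have hRm := hRt.measurable
  rcases (ω e.1).eq_empty_or_nonempty with h | ⟨x, hx⟩
  · simp [towerElt, h]
  rcases lt_trichotomy (e.2 + 1) (R x) with h | h | h
  · rw [image_towerElt_of_lt hRt hx h]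
    by_cases he : e' = (e.1, e.2 + 1)
    · right
      subst he
      simp [towerElt]
    · left
      convert measure_empty (μ := towerMeasure m R)
      rw [eq_empty_iff_forall_notMem]
      rintro p ⟨⟨h1, h2⟩, h3, h4⟩
      refine he (Prod.ext ?_ (h3.symm.trans h1))
      by_contra hne
      exact Set.disjoint_left.1 (hF.disjoint hne) h4 h2
  · rw [image_towerElt_of_eq hRt hx h]
    by_cases he : e'.2 = 0
    · rcases hF.inter_null_or_diff_null e.1 e'.1 with h0 | h0
      · left
        have : {p : Tower R | p.1.2 = 0 ∧ p.1.1 ∈ F '' ω e.1} ∩ towerElt R ω e' =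
            {p | p.1.2 = 0 ∧ p.1.1 ∈ F '' ω e.1 ∩ ω e'.1} := by
          ext p
          simp only [towerElt, mem_inter_iff, mem_ofPred_eq, he]
          tauto
        rw [this, towerMeasure_level hRm]
        exact measure_mono_null inter_subset_left h0
      · right
        have : towerElt R ω e' \ {p | p.1.2 = 0 ∧ p.1.1 ∈ F '' ω e.1} =
            {p | p.1.2 = 0 ∧ p.1.1 ∈ ω e'.1 \ F '' ω e.1} := by
          ext p
          simp only [towerElt, Set.mem_sdiff, mem_ofPred_eq, he]
          tauto
        rw [this, towerMeasure_level hRm]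
        exact measure_mono_null inter_subset_left h0
    · left
      convert measure_empty (μ := towerMeasure m R)
      rw [eq_empty_iff_forall_notMem]
      rintro p ⟨⟨h1, h2⟩, h3, h4⟩
      exact he (h3.symm.trans h1)
  · left
    rw [towerElt_eq_empty hRt hx (by omega)]
    simp

lemma iUnion_towerElt_compl_null [SFinite m] (hF : IsWGM m F ω J β) (hRt : IsReturnTime R ω)
    [Countable ι] : towerMeasure m R (⋃ e, towerElt R ω e)ᶜ = 0 := by
  have hsub : (⋃ e, towerElt R ω e)ᶜ ⊆
      ⋃ l : ℕ, {p : Tower R | p.1.2 = l ∧ p.1.1 ∈ (⋃ i, ω i)ᶜ} := by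
    intro p hp
    refine mem_iUnion.2 ⟨p.1.2, rfl, fun h => hp ?_⟩
    obtain ⟨i, hi⟩ := mem_iUnion.1 h
    exact mem_iUnion.2 ⟨(i, p.1.2), rfl, hi⟩
  refine measure_mono_null hsub (measure_iUnion_null fun l => ?_)
  rw [towerMeasure_level hRt.measurable]
  exact measure_mono_null inter_subset_left hF.cover

/-- The tower map is nonsingular. -/
lemma towerMap_preimage_null [SFinite m] (hF : IsWGM m F ω J β) (hRt : IsReturnTime R ω)
    [Countable ι] {N : Set (Tower R)} (hN : MeasurableSet N) (h0 : towerMeasure m R N = 0) :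
    towerMeasure m R (towerMap F R hR ⁻¹' N) = 0 := by
  have hRm := hRt.measurable
  have hTm : Measurable (towerMap F R hR) := measurable_towerMap hRm hF.measurable_map
  have hJm := measurable_towerJac (R := R) hRm hF.measurable_jac
  have hsub : towerMap F R hR ⁻¹' N ⊆ (⋃ e, towerElt R ω e)ᶜ ∪
      ⋃ e, (towerMap F R hR ⁻¹' N ∩ towerElt R ω e) := by
    intro p hp
    by_cases h : p ∈ ⋃ e, towerElt R ω e
    · obtain ⟨e, he⟩ := mem_iUnion.1 h
      exact Or.inr (mem_iUnion.2 ⟨e, hp, he⟩)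
    · exact Or.inl h
  refine measure_mono_null hsub (measure_union_null (iUnion_towerElt_compl_null hF hRt)
    (measure_iUnion_null fun e => ?_))
  have h1 := lintegral_image_towerElt (hR := hR) hF hRt e (g := N.indicator 1)
    (measurable_one.indicator hN)
  have h2 : ∫⁻ p in towerMap F R hR '' towerElt R ω e, N.indicator 1 p ∂(towerMeasure m R) = 0 := by
    rw [lintegral_indicator_one hN]
    exact le_antisymm ((Measure.restrict_apply_le _ _).trans h0.le) zero_le
  have hm2 : Measurable fun p => ENNReal.ofReal (towerJac J p) *
      N.indicator 1 (towerMap F R hR p) :=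
    hJm.ennreal_ofReal.mul ((measurable_one.indicator hN).comp hTm)
  rw [h2, lintegral_eq_zero_iff hm2] at h1
  have h3 : ∀ᵐ p ∂((towerMeasure m R).restrict (towerElt R ω e)), p ∉ towerMap F R hR ⁻¹' N := by
    filter_upwards [h1] with p hp hpN
    have hpN' : towerMap F R hR p ∈ N := hpN
    simp only [indicator_of_mem hpN', Pi.one_apply, mul_one, Pi.zero_apply,
      ENNReal.ofReal_eq_zero] at hp
    exact absurd hp (not_le.2 (towerJac_pos hF.jac_pos p))
  rw [ae_iff] at h3
  simp only [not_not] at h3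
  rw [← Measure.restrict_apply (hTm hN)]
  exact h3

end TowerMeasure
/-! ### Cylinders of the tower map -/

section WordCylinders

variable {X ι : Type*} {F : X → X} {R : X → ℕ} {hR : ∀ x, 0 < R x} {ω : ι → Set X}

/-- The cylinder of the points whose `T`-orbit visits the elements of the list `w` one after the
other. -/
def wordCyl (T : Tower R → Tower R) (ω : ι → Set X) : List (ι × ℕ) → Set (Tower R)
  | [] => univ
  | e :: w => towerElt R ω e ∩ T ⁻¹' wordCyl T ω w

lemma towerElt_eq_of_mem (hd : Pairwise fun i j => Disjoint (ω i) (ω j)) {e e' : ι × ℕ}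
    {p : Tower R} (h : p ∈ towerElt R ω e) (h' : p ∈ towerElt R ω e') : e = e' := by
  refine Prod.ext ?_ (h.1.symm.trans h'.1)
  by_contra hne
  exact Set.disjoint_left.1 (hd hne) h.2 h'.2

lemma towerSame_iff_mem (hd : Pairwise fun i j => Disjoint (ω i) (ω j)) {e : ι × ℕ}
    {p q : Tower R} (h : p ∈ towerElt R ω e) : TowerSame ω p q ↔ q ∈ towerElt R ω e := by
  rw [towerSame_iff]
  constructor
  · rintro ⟨e', hp, hq⟩
    rwa [towerElt_eq_of_mem hd h hp]
  · exact fun hq => ⟨e, h, hq⟩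

lemma agree_succ {T : Tower R → Tower R} {s : ℕ} {p q : Tower R} :
    Agree T ω (s + 1) p q ↔ TowerSame ω p q ∧ Agree T ω s (T p) (T q) := by
  rw [add_comm, agree_add, Function.iterate_one]
  refine and_congr_left fun _ => ?_
  simp [Agree]

lemma mem_wordCyl_iff (hd : Pairwise fun i j => Disjoint (ω i) (ω j)) {T : Tower R → Tower R}
    (w : List (ι × ℕ)) {p q : Tower R} (h : p ∈ wordCyl T ω w) :
    q ∈ wordCyl T ω w ↔ Agree T ω w.length p q := by
  induction w generalizing p q with
  | nil => simp [wordCyl, Agree]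
  | cons e w ih =>
    rw [List.length_cons, agree_succ, towerSame_iff_mem hd h.1, ← ih h.2]
    rfl

lemma exists_mem_wordCyl {T : Tower R → Tower R} (s : ℕ) {p : Tower R} (h : Agree T ω s p p) :
    ∃ w : List (ι × ℕ), w.length = s ∧ p ∈ wordCyl T ω w := by
  induction s generalizing p with
  | zero => exact ⟨[], rfl, mem_univ _⟩
  | succ s ih =>
    rw [agree_succ, towerSame_iff] at h
    obtain ⟨⟨e, he, -⟩, h2⟩ := h
    obtain ⟨w, hw, hp⟩ := ih h2
    exact ⟨e :: w, by simp [hw], he, hp⟩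

lemma wordCyl_injective (hd : Pairwise fun i j => Disjoint (ω i) (ω j)) {T : Tower R → Tower R}
    (w w' : List (ι × ℕ)) (hl : w.length = w'.length) {p : Tower R} (h : p ∈ wordCyl T ω w)
    (h' : p ∈ wordCyl T ω w') : w = w' := by
  induction w generalizing w' p with
  | nil => exact (List.length_eq_zero_iff.1 hl.symm).symm
  | cons e w ih =>
    cases w' with
    | nil => simp at hl
    | cons e' w' =>
      rw [towerElt_eq_of_mem hd h.1 h'.1, ih w' (by simpa using hl) h.2 h'.2]

lemma iterate_mem_towerElt_getLast {T : Tower R → Tower R} (w : List (ι × ℕ)) (hw : w ≠ [])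
    {p : Tower R} (h : p ∈ wordCyl T ω w) :
    T^[w.length - 1] p ∈ towerElt R ω (w.getLast hw) := by
  induction w generalizing p with
  | nil => exact absurd rfl hw
  | cons e w ih =>
    cases w with
    | nil => exact h.1
    | cons e' w =>
      have := ih (List.cons_ne_nil _ _) h.2
      rw [List.getLast_cons (List.cons_ne_nil _ _)]
      have hlen : (e :: e' :: w).length - 1 = ((e' :: w).length - 1) + 1 := by simp
      rw [hlen, Function.iterate_succ_apply]
      exact this

end WordCylinders

section ChangeOfVariables

variable {X ι : Type*} [MeasurableSpace X] {m : Measure X} {F : X → X} {R : X → ℕ}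
  {hR : ∀ x, 0 < R x} {ω : ι → Set X} {J : X → ℝ} {β : ℝ}

lemma measurableSet_wordCyl (hω : ∀ i, MeasurableSet (ω i)) {T : Tower R → Tower R}
    (hT : Measurable T) (w : List (ι × ℕ)) : MeasurableSet (wordCyl T ω w) := by
  induction w with
  | nil => exact MeasurableSet.univ
  | cons e w ih => exact (measurableSet_towerElt hω e).inter (hT ih)

/-- Change of variables on cylinders: by the Markov property a cylinder of positive measure is
mapped onto the image of its last element. -/
lemma lintegral_wordCyl [SFinite m] [Countable ι] (hF : IsWGM m F ω J β)
    (hRt : IsReturnTime R ω) (w : List (ι × ℕ)) (hw : w ≠ [])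
    (h0 : towerMeasure m R (wordCyl (towerMap F R hR) ω w) ≠ 0) {g : Tower R → ℝ≥0∞}
    (hg : Measurable g) :
    ∫⁻ p in wordCyl (towerMap F R hR) ω w,
        ENNReal.ofReal (iterJac (towerMap F R hR) J w.length p) *
          g ((towerMap F R hR)^[w.length] p) ∂(towerMeasure m R) =
      ∫⁻ p in towerMap F R hR '' towerElt R ω (w.getLast hw), g p ∂(towerMeasure m R) := by
  have hRm := hRt.measurable
  have hTm : Measurable (towerMap F R hR) := measurable_towerMap hRm hF.measurable_map
  induction w with
  | nil => exact absurd rfl hw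
  | cons e w ih =>
    cases w with
    | nil =>
      rw [List.getLast_singleton, ← lintegral_image_towerElt hF hRt e hg]
      simp [wordCyl, iterJac]
    | cons e' w =>
      have hne : e' :: w ≠ [] := List.cons_ne_nil _ _
      set C := wordCyl (towerMap F R hR) ω (e' :: w) with hC
      have hCm : MeasurableSet C := measurableSet_wordCyl hF.measurableSet_elt hTm _
      have hC0 : towerMeasure m R C ≠ 0 := by
        intro h
        refine h0 (measure_mono_null inter_subset_right (towerMap_preimage_null hF hRt hCm h))
      have ih := ih hne hC0
      rw [List.getLast_cons hne, ← ih]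
      set s := (e' :: w).length with hs
      set G : Tower R → ℝ≥0∞ := fun p => ENNReal.ofReal (iterJac (towerMap F R hR) J s p) *
          g ((towerMap F R hR)^[s] p) with hG
      have hGm : Measurable G :=
        (measurable_iterJac hRm hF.measurable_jac hTm s).ennreal_ofReal.mul
          (hg.comp (hTm.iterate s))
      have hlen : (e :: e' :: w).length = 1 + s := by rw [List.length_cons, add_comm]
      have hCinj : towerMeasure m R (C \ towerMap F R hR '' towerElt R ω e) = 0 := by
        rcases towerElt_markov (hR := hR) hF hRt e e' with h | h
        · exfalso
          refine h0 ?_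
          have h1 := towerMap_preimage_null (hR := hR) hF hRt
            ((measurableSet_image_towerElt hF hRt e).inter
              (measurableSet_towerElt hF.measurableSet_elt e')) h
          refine measure_mono_null ?_ h1
          rintro p ⟨hp1, hp2⟩
          exact ⟨⟨p, hp1, rfl⟩, hp2.1⟩
        · exact measure_mono_null (Set.sdiff_subset_sdiff_left inter_subset_left) h
      calc ∫⁻ p in wordCyl (towerMap F R hR) ω (e :: e' :: w),
            ENNReal.ofReal (iterJac (towerMap F R hR) J (e :: e' :: w).length p) *
            g ((towerMap F R hR)^[(e :: e' :: w).length] p) ∂(towerMeasure m R)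
          = ∫⁻ p in towerElt R ω e ∩ towerMap F R hR ⁻¹' C,
            ENNReal.ofReal (towerJac J p) * G (towerMap F R hR p) ∂(towerMeasure m R) := by
            refine setLIntegral_congr_fun (measurableSet_wordCyl hF.measurableSet_elt hTm _)
              fun p _ => ?_
            simp only [hG]
            have h1 : iterJac (towerMap F R hR) J (1 + s) p =
                towerJac J p * iterJac (towerMap F R hR) J s (towerMap F R hR p) := by
              rw [iterJac_add]
              simp [iterJac]
            rw [hlen, h1, ENNReal.ofReal_mul (towerJac_pos hF.jac_pos _).le, add_comm 1 s,
              Function.iterate_succ_apply, mul_assoc]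
        _ = ∫⁻ p in towerElt R ω e, ENNReal.ofReal (towerJac J p) *
              C.indicator G (towerMap F R hR p) ∂(towerMeasure m R) := by
            rw [inter_comm, ← Measure.restrict_restrict (hTm hCm), ← lintegral_indicator (hTm hCm)]
            refine lintegral_congr fun p => ?_
            by_cases hp : towerMap F R hR p ∈ C
            · rw [indicator_of_mem (by exact hp), indicator_of_mem hp]
            · rw [indicator_of_notMem (by exact hp), indicator_of_notMem hp, mul_zero]
        _ = ∫⁻ p in towerMap F R hR '' towerElt R ω e, C.indicator G p ∂(towerMeasure m R) :=
            lintegral_image_towerElt hF hRt e (hGm.indicator hCm)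
        _ = ∫⁻ p in C, G p ∂(towerMeasure m R) := by
            rw [lintegral_indicator hCm, Measure.restrict_restrict hCm]
            refine setLIntegral_congr ?_
            refine EventuallyLE.antisymm ?_ (ae_le_set.2 (measure_mono_null ?_ hCinj))
            · exact LE.le.eventuallyLE inter_subset_left
            · rintro p ⟨hp, hp'⟩
              exact ⟨hp, fun h => hp' ⟨hp, h⟩⟩

end ChangeOfVariables
/-! ### Measurability of the simultaneous return time -/

section Measurability

variable {X ι : Type*} [MeasurableSpace X] {F : X → X} {R : X → ℕ}
  {hR : ∀ x, 0 < R x} {ω : ι → Set X} {J : X → ℝ} {n₀ : ℕ}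

lemma measurable_iterate_of_measurable {Y : Type*} [MeasurableSpace Y] {T : Tower R → Tower R}
    (hT : Measurable T) {f : Y → ℕ} {g : Y → Tower R} (hf : Measurable f) (hg : Measurable g) :
    Measurable fun y => T^[f y] (g y) := by
  have h : Measurable fun q : ℕ × Tower R => T^[q.1] q.2 :=
    measurable_from_prod_countable_right fun n => hT.iterate n
  exact h.comp (hf.prodMk hg)

lemma measurable_retTime (hT : Measurable (towerMap F R hR)) :
    Measurable (retTime (towerMap F R hR)) := by
  classical
  have hex : ∀ p : Tower R, ∃ n, (towerMap F R hR)^[n] p ∈ base R := fun p =>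
    ⟨_, iterate_towerMap_mem_base p⟩
  have : retTime (towerMap F R hR) = fun p => Nat.find (hex p) := by
    funext p
    exact Nat.sInf_def (s := {n | (towerMap F R hR)^[n] p ∈ base R}) (hex p)
  rw [this]
  exact measurable_find hex fun k => hT.iterate k measurableSet_base

lemma measurable_tau (hT : Measurable (towerMap F R hR)) (k : ℕ) :
    Measurable (tau (towerMap F R hR) n₀ k) := by
  induction k with
  | zero => exact measurable_const
  | succ k ih =>
    have h1 : Measurable fun u : Tower R × Tower R => if k % 2 = 0 then u.1 else u.2 := by
      split_ifs
      · exact measurable_fst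
      · exact measurable_snd
    have h2 : Measurable fun u => n₀ + tau (towerMap F R hR) n₀ k u := ih.const_add n₀
    exact h2.add ((measurable_retTime hT).comp (measurable_iterate_of_measurable hT h2 h1))

lemma measurable_simRet (hT : Measurable (towerMap F R hR)) :
    Measurable (simRet (towerMap F R hR) n₀) := by
  have hle : ∀ k : ℕ, MeasurableSet {u | simRet (towerMap F R hR) n₀ u ≤ k} := by
    intro k
    simp only [simRet_le_iff]
    have : {u : Tower R × Tower R | ∃ i, 2 ≤ i ∧ tau (towerMap F R hR) n₀ i u ≤ k ∧
        (towerMap F R hR)^[tau (towerMap F R hR) n₀ i u] u.1 ∈ base R ∧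
        (towerMap F R hR)^[tau (towerMap F R hR) n₀ i u] u.2 ∈ base R} =
        ⋃ i, ⋃ (_ : 2 ≤ i), ({u | tau (towerMap F R hR) n₀ i u ≤ k} ∩
        ({u | (towerMap F R hR)^[tau (towerMap F R hR) n₀ i u] u.1 ∈ base R} ∩
        {u | (towerMap F R hR)^[tau (towerMap F R hR) n₀ i u] u.2 ∈ base R})) := by
      ext u
      simp only [mem_ofPred_eq, mem_iUnion, mem_inter_iff, exists_prop]
    rw [this]
    refine MeasurableSet.iUnion fun i => MeasurableSet.iUnion fun _ => ?_
    have htau := measurable_tau (n₀ := n₀) hT i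
    exact (measurableSet_le htau measurable_const).inter
      ((measurable_iterate_of_measurable hT htau measurable_fst measurableSet_base).inter
        (measurable_iterate_of_measurable hT htau measurable_snd measurableSet_base))
  refine measurable_to_countable' fun x => ?_
  induction x with
  | top =>
    have : simRet (towerMap F R hR) n₀ ⁻¹' {⊤} =
        ⋂ k : ℕ, {u | simRet (towerMap F R hR) n₀ u ≤ k}ᶜ := by
      ext u
      simp only [mem_preimage, mem_singleton_iff, mem_iInter, mem_compl_iff, mem_ofPred_eq, not_le]
      exact ⟨fun h k => by rw [h]; exact ENat.natCast_lt_top k,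
        fun h => ENat.eq_top_iff_forall_gt.2 h⟩
    rw [this]
    exact MeasurableSet.iInter fun k => (hle k).compl
  | coe n =>
    have : simRet (towerMap F R hR) n₀ ⁻¹' {(n : ℕ∞)} =
        {u | simRet (towerMap F R hR) n₀ u ≤ n} ∩
        ⋂ k : ℕ, ⋂ (_ : k < n), {u | simRet (towerMap F R hR) n₀ u ≤ k}ᶜ := by
      ext u
      simp only [mem_preimage, mem_singleton_iff, mem_iInter, mem_compl_iff, mem_ofPred_eq,
        mem_inter_iff]
      constructor
      · intro h
        rw [h]
        exact ⟨le_rfl, fun k hk h' => absurd (Nat.cast_le.1 h') (not_le.2 hk)⟩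
      · rintro ⟨h1, h2⟩
        refine le_antisymm h1 ?_
        by_contra hlt
        push Not at hlt
        lift simRet (towerMap F R hR) n₀ u to ℕ using hlt.ne_top with s
        exact h2 s (by exact_mod_cast hlt) le_rfl
    rw [this]
    exact (hle n).inter (MeasurableSet.iInter fun k => MeasurableSet.iInter fun _ => (hle k).compl)

lemma measurable_simRet_toNat (hT : Measurable (towerMap F R hR)) :
    Measurable fun u => (simRet (towerMap F R hR) n₀ u).toNat :=
  (measurable_of_countable ENat.toNat).comp (measurable_simRet hT)

lemma measurable_indMap (hT : Measurable (towerMap F R hR)) :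
    Measurable (indMap (towerMap F R hR) n₀) :=
  (measurable_iterate_of_measurable hT (measurable_simRet_toNat hT) measurable_fst).prodMk
    (measurable_iterate_of_measurable hT (measurable_simRet_toNat hT) measurable_snd)

lemma measurable_stopTime (hT : Measurable (towerMap F R hR)) (i : ℕ) :
    Measurable (stopTime (towerMap F R hR) n₀ i) :=
  Finset.measurable_sum _ fun k _ =>
    (measurable_simRet_toNat hT).comp ((measurable_indMap hT).iterate k)

lemma measurable_indJac (hRm : Measurable R) (hJm : Measurable J)
    (hT : Measurable (towerMap F R hR)) (i : ℕ) :
    Measurable (indJac (towerMap F R hR) n₀ J i) := by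
  have h : Measurable fun q : ℕ × Tower R => iterJac (towerMap F R hR) J q.1 q.2 :=
    measurable_from_prod_countable_right fun n => measurable_iterJac hRm hJm hT n
  have hS := measurable_stopTime (n₀ := n₀) hT i
  have : indJac (towerMap F R hR) n₀ J i = fun u =>
      iterJac (towerMap F R hR) J (stopTime (towerMap F R hR) n₀ i u) u.1 *
      iterJac (towerMap F R hR) J (stopTime (towerMap F R hR) n₀ i u) u.2 :=
    funext fun u => indJac_eq _ _ _ _
  rw [this]
  exact (h.comp (hS.prodMk measurable_fst)).mul (h.comp (hS.prodMk measurable_snd))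

end Measurability

/-! ### Elements of the partitions of the product as products of cylinders -/

section PairCylinders

variable {X ι : Type*} {F : X → X} {R : X → ℕ} {hR : ∀ x, 0 < R x} {ω : ι → Set X} {n₀ : ℕ}

/-- The product of two cylinders. -/
def pairCyl (T : Tower R → Tower R) (ω : ι → Set X) (w : List (ι × ℕ) × List (ι × ℕ)) :
    Set (Tower R × Tower R) := wordCyl T ω w.1 ×ˢ wordCyl T ω w.2

/-- The pairs of words whose cylinder is an element of `⋁_{j<i} T̃^{-j} ξ̃`. -/
def IsAdm (T : Tower R → Tower R) (n₀ : ℕ) (ω : ι → Set X) (i : ℕ)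
    (w : List (ι × ℕ) × List (ι × ℕ)) : Prop :=
  w.1.length = w.2.length ∧ ∃ u ∈ pairCyl T ω w, u ∈ xiElt T n₀ ω i u ∧
    stopTime T n₀ i u = w.1.length

/-- The union of the elements of `⋁_{j<i} T̃^{-j} ξ̃`. -/
def cylSet (T : Tower R → Tower R) (n₀ : ℕ) (ω : ι → Set X) (i : ℕ) : Set (Tower R × Tower R) :=
  {u | u ∈ xiElt T n₀ ω i u}

lemma cylSet_anti {T : Tower R → Tower R} {i k : ℕ} (h : k ≤ i) :
    cylSet T n₀ ω i ⊆ cylSet T n₀ ω k := fun u hu => xiElt_anti h u hu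

lemma cylSet_zero {T : Tower R → Tower R} : cylSet T n₀ ω 0 = univ :=
  eq_univ_of_forall fun _ => mem_xiElt_zero

lemma IsAdm.xiElt_eq (hn : 0 < n₀) (hd : Pairwise fun i j => Disjoint (ω i) (ω j))
    (hc : ∀ i, ∀ x ∈ ω i, ∀ y ∈ ω i, R x = R y) {i : ℕ} {w : List (ι × ℕ) × List (ι × ℕ)}
    (h : IsAdm (towerMap F R hR) n₀ ω i w) {u : Tower R × Tower R}
    (hu : u ∈ pairCyl (towerMap F R hR) ω w) :
    xiElt (towerMap F R hR) n₀ ω i u = pairCyl (towerMap F R hR) ω w ∧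
      u ∈ cylSet (towerMap F R hR) n₀ ω i ∧
      stopTime (towerMap F R hR) n₀ i u = w.1.length := by
  obtain ⟨hl, v, hvw, hv, hS⟩ := h
  have heq : xiElt (towerMap F R hR) n₀ ω i v = pairCyl (towerMap F R hR) ω w := by
    ext z
    rw [mem_xiElt_iff hn hc i hv, hS, pairCyl, mem_prod, mem_wordCyl_iff hd _ hvw.1,
      mem_wordCyl_iff hd _ hvw.2, ← hl]
  have huv : u ∈ xiElt (towerMap F R hR) n₀ ω i v := by rw [heq]; exact hu
  refine ⟨(xiElt_eq_of_mem hd huv).trans heq, mem_xiElt_self hd (mem_xiElt_comm huv), ?_⟩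
  rw [stopTime_eq_of_mem huv, hS]

lemma exists_isAdm (hn : 0 < n₀) (hc : ∀ i, ∀ x ∈ ω i, ∀ y ∈ ω i, R x = R y) {i : ℕ}
    {u : Tower R × Tower R} (hu : u ∈ cylSet (towerMap F R hR) n₀ ω i) :
    ∃ w, IsAdm (towerMap F R hR) n₀ ω i w ∧ u ∈ pairCyl (towerMap F R hR) ω w := by
  obtain ⟨h1, h2⟩ := (mem_xiElt_iff hn hc i hu).1 hu
  obtain ⟨w₁, hl₁, hw₁⟩ := exists_mem_wordCyl _ h1
  obtain ⟨w₂, hl₂, hw₂⟩ := exists_mem_wordCyl _ h2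
  exact ⟨(w₁, w₂), ⟨hl₁.trans hl₂.symm, u, ⟨hw₁, hw₂⟩, hu, hl₁.symm⟩, hw₁, hw₂⟩

lemma IsAdm.eq_of_mem (hn : 0 < n₀) (hd : Pairwise fun i j => Disjoint (ω i) (ω j))
    (hc : ∀ i, ∀ x ∈ ω i, ∀ y ∈ ω i, R x = R y) {i : ℕ} {w w' : List (ι × ℕ) × List (ι × ℕ)}
    (h : IsAdm (towerMap F R hR) n₀ ω i w) (h' : IsAdm (towerMap F R hR) n₀ ω i w')
    {u : Tower R × Tower R} (hu : u ∈ pairCyl (towerMap F R hR) ω w)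
    (hu' : u ∈ pairCyl (towerMap F R hR) ω w') : w = w' := by
  have e1 := (h.xiElt_eq hn hd hc hu).2.2
  have e2 := (h'.xiElt_eq hn hd hc hu').2.2
  have hl := h.1
  have hl' := h'.1
  exact Prod.ext (wordCyl_injective hd _ _ (by omega) hu.1 hu'.1)
    (wordCyl_injective hd _ _ (by omega) hu.2 hu'.2)

lemma cylSet_eq_iUnion (hn : 0 < n₀) (hd : Pairwise fun i j => Disjoint (ω i) (ω j))
    (hc : ∀ i, ∀ x ∈ ω i, ∀ y ∈ ω i, R x = R y) (i : ℕ) :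
    cylSet (towerMap F R hR) n₀ ω i =
      ⋃ w : {w // IsAdm (towerMap F R hR) n₀ ω i w}, pairCyl (towerMap F R hR) ω w.1 := by
  ext u
  rw [mem_iUnion]
  constructor
  · intro hu
    obtain ⟨w, hw, huw⟩ := exists_isAdm hn hc hu
    exact ⟨⟨w, hw⟩, huw⟩
  · rintro ⟨w, hw⟩
    exact (w.2.xiElt_eq hn hd hc hw).2.1

lemma length_le_stopTime (hn : 0 < n₀) {T : Tower R → Tower R} (i : ℕ) {u : Tower R × Tower R}
    (hu : u ∈ cylSet T n₀ ω i) : i ≤ stopTime T n₀ i u := by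
  induction i with
  | zero => exact Nat.zero_le _
  | succ i ih =>
    rw [stopTime_succ]
    have h1 := ih (cylSet_anti (Nat.le_succ i) hu)
    have h2 := one_le_simRet hn (hu i (Nat.lt_succ_self i)).1
    omega

lemma IsAdm.ne_nil (hn : 0 < n₀) {T : Tower R → Tower R} {i : ℕ} (hi : 1 ≤ i)
    {w : List (ι × ℕ) × List (ι × ℕ)} (h : IsAdm T n₀ ω i w) : w.1 ≠ [] ∧ w.2 ≠ [] := by
  obtain ⟨hl, u, -, hu, hS⟩ := h
  have h1 := length_le_stopTime hn i hu
  rw [hS] at h1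
  constructor
  · intro h; rw [h] at h1; simp at h1; omega
  · intro h; rw [hl, h] at h1; simp at h1; omega

/-- The coordinates of `u` are in a common element of the partition of the tower immediately
before the simultaneous return. -/
def lastSame (T : Tower R → Tower R) (n₀ : ℕ) (ω : ι → Set X) (u : Tower R × Tower R) : Prop :=
  TowerSame ω (T^[(simRet T n₀ u).toNat - 1] u.1) (T^[(simRet T n₀ u).toNat - 1] u.2)

lemma SameXi.lastSame_imp (hn : 0 < n₀) (hd : Pairwise fun i j => Disjoint (ω i) (ω j))
    {T : Tower R → Tower R} {u v : Tower R × Tower R} (h : SameXi T n₀ ω u v)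
    (hu : lastSame T n₀ ω u) : lastSame T n₀ ω v := by
  have h1 := one_le_simRet hn h.1
  obtain ⟨h2, h3⟩ := h.2.2 ((simRet T n₀ u).toNat - 1) (by omega)
  unfold lastSame at hu ⊢
  rw [← h.2.1]
  exact (h2.symm.trans hd hu).trans hd h3

lemma lastSame_iterate_iff (hn : 0 < n₀) {T : Tower R → Tower R} {i : ℕ}
    {u : Tower R × Tower R} (hu : u ∈ cylSet T n₀ ω (i + 1)) :
    lastSame T n₀ ω ((indMap T n₀)^[i] u) ↔
      TowerSame ω (T^[stopTime T n₀ (i + 1) u - 1] u.1) (T^[stopTime T n₀ (i + 1) u - 1] u.2) := by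
  have h1 := one_le_simRet hn (hu i (Nat.lt_succ_self i)).1
  unfold lastSame
  have h2 : stopTime T n₀ (i + 1) u - 1 =
      ((simRet T n₀ ((indMap T n₀)^[i] u)).toNat - 1) + stopTime T n₀ i u := by
    rw [stopTime_succ]; omega
  have h3 : ((indMap T n₀)^[i] u).1 = T^[stopTime T n₀ i u] u.1 := by rw [indMap_iterate]
  have h4 : ((indMap T n₀)^[i] u).2 = T^[stopTime T n₀ i u] u.2 := by rw [indMap_iterate]
  rw [h2, Function.iterate_add_apply, Function.iterate_add_apply, h3, h4]

end PairCylinders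

section PairMeasure

variable {X ι : Type*} [MeasurableSpace X] {m : Measure X} {F : X → X} {R : X → ℕ}
  {hR : ∀ x, 0 < R x} {ω : ι → Set X} {J : X → ℝ} {β : ℝ} {n₀ : ℕ}

lemma measurableSet_pairCyl (hω : ∀ i, MeasurableSet (ω i)) {T : Tower R → Tower R}
    (hT : Measurable T) (w : List (ι × ℕ) × List (ι × ℕ)) : MeasurableSet (pairCyl T ω w) :=
  (measurableSet_wordCyl hω hT _).prod (measurableSet_wordCyl hω hT _)

variable [Countable ι]

lemma measurableSet_cylSet (hF : IsWGM m F ω J β) (hRt : IsReturnTime R ω) (hn : 0 < n₀) (i : ℕ) :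
    MeasurableSet (cylSet (towerMap F R hR) n₀ ω i) := by
  rw [cylSet_eq_iUnion hn hF.disjoint hRt.const]
  exact MeasurableSet.iUnion fun w => measurableSet_pairCyl hF.measurableSet_elt
    (measurable_towerMap hRt.measurable hF.measurable_map) _

/-- Integrals over the union of the elements of `⋁_{j<i} T̃^{-j} ξ̃` can be compared element by
element. -/
lemma setLIntegral_cylSet_le (hF : IsWGM m F ω J β) (hRt : IsReturnTime R ω) (hn : 0 < n₀) (i : ℕ)
    (ν : Measure (Tower R × Tower R)) {f g : Tower R × Tower R → ℝ≥0∞}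
    (h : ∀ w, IsAdm (towerMap F R hR) n₀ ω i w →
      ∫⁻ u in pairCyl (towerMap F R hR) ω w, f u ∂ν ≤
        ∫⁻ u in pairCyl (towerMap F R hR) ω w, g u ∂ν) :
    ∫⁻ u in cylSet (towerMap F R hR) n₀ ω i, f u ∂ν ≤
      ∫⁻ u in cylSet (towerMap F R hR) n₀ ω i, g u ∂ν := by
  have hm : ∀ w : {w // IsAdm (towerMap F R hR) n₀ ω i w},
      MeasurableSet (pairCyl (towerMap F R hR) ω w.1) := fun w =>
    measurableSet_pairCyl hF.measurableSet_elt
      (measurable_towerMap hRt.measurable hF.measurable_map) _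
  have hdisj : Pairwise (Function.onFun Disjoint
      fun w : {w // IsAdm (towerMap F R hR) n₀ ω i w} => pairCyl (towerMap F R hR) ω w.1) := by
    intro w w' hne
    refine Set.disjoint_left.2 fun u hu hu' => hne (Subtype.ext ?_)
    exact w.2.eq_of_mem hn hF.disjoint hRt.const w'.2 hu hu'
  rw [cylSet_eq_iUnion hn hF.disjoint hRt.const, lintegral_iUnion hm hdisj,
    lintegral_iUnion hm hdisj]
  exact ENNReal.tsum_le_tsum fun w => h w.1 w.2

/-- A function that is constant on the elements of `⋁_{j<i} T̃^{-j} ξ̃`, and constant outside their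
union, is measurable. -/
lemma measurable_of_const_on_xiElt (hF : IsWGM m F ω J β) (hRt : IsReturnTime R ω) (hn : 0 < n₀)
    (i : ℕ) {f : Tower R × Tower R → ℝ}
    (h : ∀ u v, v ∈ xiElt (towerMap F R hR) n₀ ω i u → f v = f u) {a : ℝ}
    (ha : ∀ u ∉ cylSet (towerMap F R hR) n₀ ω i, f u = a) : Measurable f := by
  intro s hs
  have hT : Measurable (towerMap F R hR) := measurable_towerMap hRt.measurable hF.measurable_map
  have : f ⁻¹' s = (⋃ w : {w // IsAdm (towerMap F R hR) n₀ ω i w ∧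
      pairCyl (towerMap F R hR) ω w ⊆ f ⁻¹' s}, pairCyl (towerMap F R hR) ω w.1) ∪
      ((cylSet (towerMap F R hR) n₀ ω i)ᶜ ∩ {_u | a ∈ s}) := by
    ext u
    constructor
    · intro hu
      by_cases hc : u ∈ cylSet (towerMap F R hR) n₀ ω i
      · left
        obtain ⟨w, hw, huw⟩ := exists_isAdm hn hRt.const hc
        refine mem_iUnion.2 ⟨⟨w, hw, fun v hv => ?_⟩, huw⟩
        rw [← (hw.xiElt_eq hn hF.disjoint hRt.const huw).1] at hv
        rw [mem_preimage, h u v hv]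
        exact hu
      · right
        refine ⟨hc, ?_⟩
        rw [mem_preimage, ha u hc] at hu
        exact hu
    · rintro (hu | ⟨hc, hu⟩)
      · obtain ⟨w, hw⟩ := mem_iUnion.1 hu
        exact w.2.2 hw
      · rw [mem_preimage, ha u hc]
        exact hu
  rw [this]
  refine (MeasurableSet.iUnion fun w => measurableSet_pairCyl hF.measurableSet_elt hT _).union
    ((measurableSet_cylSet hF hRt hn i).compl.inter (MeasurableSet.const _))

lemma measurable_partialDensity (hF : IsWGM m F ω J β) (hRt : IsReturnTime R ω) (hn : 0 < n₀)
    {ε : ℕ → Tower R × Tower R → ℝ} (hε : ∀ k ≥ 1, Measurable (ε k))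
    {Φ : Tower R × Tower R → ℝ} (hΦ : Measurable Φ) (i : ℕ) :
    Measurable (partialDensity (towerMap F R hR) n₀ ω J ε Φ i) := by
  induction i with
  | zero => exact hΦ
  | succ i ih =>
    refine ih.sub (((hε (i + 1) (by omega)).mul (measurable_indJac hRt.measurable
      hF.measurable_jac (measurable_towerMap hRt.measurable hF.measurable_map) _)).mul ?_)
    refine measurable_of_const_on_xiElt (hR := hR) hF hRt hn (i + 1) (a := 0) ?_ ?_
    · intro u v hv
      simp only [xiElt_eq_of_mem hF.disjoint hv]
    · intro u hu
      have : xiElt (towerMap F R hR) n₀ ω (i + 1) u = ∅ :=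
        eq_empty_iff_forall_notMem.2 fun v hv => hu (mem_xiElt_self hF.disjoint hv)
      simp [this]

lemma measurableSet_lastSame (hF : IsWGM m F ω J β) (hRt : IsReturnTime R ω) :
    MeasurableSet {u | lastSame (towerMap F R hR) n₀ ω u} := by
  have hT : Measurable (towerMap F R hR) := measurable_towerMap hRt.measurable hF.measurable_map
  have hS : Measurable fun u => (simRet (towerMap F R hR) n₀ u).toNat - 1 :=
    (measurable_of_countable fun k : ℕ => k - 1).comp (measurable_simRet_toNat hT)
  have : {u | lastSame (towerMap F R hR) n₀ ω u} = ⋃ e,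
      {u | (towerMap F R hR)^[(simRet (towerMap F R hR) n₀ u).toNat - 1] u.1 ∈ towerElt R ω e} ∩
      {u | (towerMap F R hR)^[(simRet (towerMap F R hR) n₀ u).toNat - 1] u.2 ∈ towerElt R ω e} := by
    ext u
    simp only [mem_ofPred_eq, lastSame, towerSame_iff, mem_iUnion, mem_inter_iff]
  rw [this]
  exact MeasurableSet.iUnion fun e =>
    (measurable_iterate_of_measurable hT hS measurable_fst
      (measurableSet_towerElt hF.measurableSet_elt e)).inter
    (measurable_iterate_of_measurable hT hS measurable_snd
      (measurableSet_towerElt hF.measurableSet_elt e))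

/-- The image of the cylinder of a nonempty word, up to a null set. -/
def wordImage (T : Tower R → Tower R) (ω : ι → Set X) (w : List (ι × ℕ)) (hw : w ≠ []) :
    Set (Tower R) := T '' towerElt R ω (w.getLast hw)

/-- Change of variables for `T̃^i` on an element of positive measure. -/
lemma lintegral_pairCyl [SFinite m] [SFinite (towerMeasure m R)] (hF : IsWGM m F ω J β)
    (hRt : IsReturnTime R ω) (hn : 0 < n₀)
    {i : ℕ} {w : List (ι × ℕ) × List (ι × ℕ)} (hw₁ : w.1 ≠ []) (hw₂ : w.2 ≠ [])
    (hadm : IsAdm (towerMap F R hR) n₀ ω i w)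
    (h0 : ((towerMeasure m R).prod (towerMeasure m R)) (pairCyl (towerMap F R hR) ω w) ≠ 0)
    {G : Tower R × Tower R → ℝ≥0∞} (hG : Measurable G) :
    ∫⁻ u in pairCyl (towerMap F R hR) ω w,
        ENNReal.ofReal (indJac (towerMap F R hR) n₀ J i u) *
          G ((indMap (towerMap F R hR) n₀)^[i] u) ∂((towerMeasure m R).prod (towerMeasure m R)) =
      ∫⁻ u in wordImage (towerMap F R hR) ω w.1 hw₁ ×ˢ wordImage (towerMap F R hR) ω w.2 hw₂,
        G u ∂((towerMeasure m R).prod (towerMeasure m R)) := by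
  set T := towerMap F R hR with hTdef
  set μ := towerMeasure m R with hμ
  have hT : Measurable T := measurable_towerMap hRt.measurable hF.measurable_map
  have hJm : ∀ k, Measurable fun p => ENNReal.ofReal (iterJac T J k p) := fun k =>
    (measurable_iterJac hRt.measurable hF.measurable_jac hT k).ennreal_ofReal
  have hmw : ∀ w, MeasurableSet (wordCyl T ω w) := fun w =>
    measurableSet_wordCyl hF.measurableSet_elt hT w
  rw [pairCyl, Measure.prod_prod] at h0
  have h1 : μ (wordCyl T ω w.1) ≠ 0 := left_ne_zero_of_mul h0
  have h2 : μ (wordCyl T ω w.2) ≠ 0 := right_ne_zero_of_mul h0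
  have hl := hadm.1
  set s := w.1.length with hs
  have hTs := hT.iterate s
  calc ∫⁻ u in pairCyl T ω w, ENNReal.ofReal (indJac T n₀ J i u) *
        G ((indMap T n₀)^[i] u) ∂(μ.prod μ)
      = ∫⁻ u in wordCyl T ω w.1 ×ˢ wordCyl T ω w.2, ENNReal.ofReal (iterJac T J s u.1) *
          (ENNReal.ofReal (iterJac T J s u.2) * G (T^[s] u.1, T^[s] u.2)) ∂(μ.prod μ) := by
        refine setLIntegral_congr_fun ((hmw _).prod (hmw _)) fun u hu => ?_
        have hS := (hadm.xiElt_eq hn hF.disjoint hRt.const hu).2.2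
        rw [indJac_eq, indMap_iterate, hS, ENNReal.ofReal_mul (iterJac_pos hF.jac_pos _ _ _).le,
          mul_assoc]
    _ = ∫⁻ p in wordCyl T ω w.1, ∫⁻ q in wordCyl T ω w.2, ENNReal.ofReal (iterJac T J s p) *
          (ENNReal.ofReal (iterJac T J s q) * G (T^[s] p, T^[s] q)) ∂μ ∂μ := by
        refine setLIntegral_prod _ (Measurable.aemeasurable ?_)
        exact ((hJm s).comp measurable_fst).mul (((hJm s).comp measurable_snd).mul
          (hG.comp ((hTs.comp measurable_fst).prodMk (hTs.comp measurable_snd))))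
    _ = ∫⁻ p in wordCyl T ω w.1, ENNReal.ofReal (iterJac T J s p) *
          (∫⁻ q in wordImage T ω w.2 hw₂, G (T^[s] p, q) ∂μ) ∂μ := by
        refine lintegral_congr fun p => ?_
        rw [lintegral_const_mul]
        · congr 1
          rw [hl]
          exact lintegral_wordCyl hF hRt w.2 hw₂ h2 (g := fun q => G (T^[w.2.length] p, q))
            (hG.comp measurable_prodMk_left)
        · exact (hJm s).mul (hG.comp (measurable_const.prodMk hTs))
    _ = ∫⁻ p in wordImage T ω w.1 hw₁, ∫⁻ q in wordImage T ω w.2 hw₂, G (p, q) ∂μ ∂μ :=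
        lintegral_wordCyl hF hRt w.1 hw₁ h1
          (g := fun p => ∫⁻ q in wordImage T ω w.2 hw₂, G (p, q) ∂μ) hG.lintegral_prod_right'
    _ = _ := (setLIntegral_prod _ hG.aemeasurable).symm

/-- For a density whose ratio to the Jacobian oscillates by at most the factor `D` on an element,
the conditional distribution of `T̃^i` is comparable to the normalised reference measure on the
image. -/
lemma mass_compare [SFinite m] [SFinite (towerMeasure m R)] (hF : IsWGM m F ω J β)
    (hRt : IsReturnTime R ω) (hn : 0 < n₀)
    {i : ℕ} {w : List (ι × ℕ) × List (ι × ℕ)} (hw₁ : w.1 ≠ []) (hw₂ : w.2 ≠ [])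
    (hadm : IsAdm (towerMap F R hR) n₀ ω i w) {ψ : Tower R × Tower R → ℝ} {D : ℝ} (hD : 0 ≤ D)
    (hψ0 : ∀ u ∈ pairCyl (towerMap F R hR) ω w, 0 ≤ ψ u)
    (hψ : ∀ u ∈ pairCyl (towerMap F R hR) ω w, ∀ v ∈ pairCyl (towerMap F R hR) ω w,
      ψ u / indJac (towerMap F R hR) n₀ J i u ≤ D * (ψ v / indJac (towerMap F R hR) n₀ J i v))
    {E E' : Set (Tower R × Tower R)} (hE : MeasurableSet E) (hE' : MeasurableSet E') :
    let AB := wordImage (towerMap F R hR) ω w.1 hw₁ ×ˢ wordImage (towerMap F R hR) ω w.2 hw₂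
    let μ₂ := (towerMeasure m R).prod (towerMeasure m R)
    (∫⁻ u in pairCyl (towerMap F R hR) ω w, ((indMap (towerMap F R hR) n₀)^[i] ⁻¹' E).indicator
        (fun u => ENNReal.ofReal (ψ u)) u ∂μ₂) * μ₂ (E' ∩ AB) ≤
      ENNReal.ofReal D ^ 2 * μ₂ (E ∩ AB) * ∫⁻ u in pairCyl (towerMap F R hR) ω w,
        ((indMap (towerMap F R hR) n₀)^[i] ⁻¹' E').indicator
          (fun u => ENNReal.ofReal (ψ u)) u ∂μ₂ := by
  intro AB μ₂
  set T := towerMap F R hR with hTdef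
  have hT : Measurable T := measurable_towerMap hRt.measurable hF.measurable_map
  have hTi : Measurable ((indMap T n₀)^[i]) := (measurable_indMap hT).iterate i
  have hJm := (measurable_indJac (n₀ := n₀) hRt.measurable hF.measurable_jac hT i).ennreal_ofReal
  have hZm : MeasurableSet (pairCyl T ω w) := measurableSet_pairCyl hF.measurableSet_elt hT w
  by_cases h0 : μ₂ (pairCyl T ω w) = 0
  · rw [setLIntegral_measure_zero _ _ h0, zero_mul]
    exact zero_le
  obtain ⟨v₀, hv₀⟩ : (pairCyl T ω w).Nonempty := by
    by_contra h
    rw [not_nonempty_iff_eq_empty] at h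
    exact h0 (by rw [h, measure_empty])
  set θ := ψ v₀ / indJac T n₀ J i v₀ with hθ
  have hθ0 : 0 ≤ θ := div_nonneg (hψ0 _ hv₀) (indJac_pos hF.jac_pos _ _ _ _).le
  have hJE : ∀ E : Set (Tower R × Tower R), MeasurableSet E →
      ∫⁻ u in pairCyl T ω w, ((indMap T n₀)^[i] ⁻¹' E).indicator
        (fun u => ENNReal.ofReal (indJac T n₀ J i u)) u ∂μ₂ = μ₂ (E ∩ AB) := by
    intro E hE
    have := lintegral_pairCyl (J := J) hF hRt hn hw₁ hw₂ hadm h0 (G := E.indicator 1)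
      (measurable_one.indicator hE)
    rw [lintegral_indicator_one hE, Measure.restrict_apply hE] at this
    rw [← this]
    refine lintegral_congr fun u => ?_
    by_cases hu : (indMap T n₀)^[i] u ∈ E
    · rw [indicator_of_mem (by exact hu), indicator_of_mem hu, Pi.one_apply, mul_one]
    · rw [indicator_of_notMem (by exact hu), indicator_of_notMem hu, mul_zero]
  have hup : ∫⁻ u in pairCyl T ω w, ((indMap T n₀)^[i] ⁻¹' E).indicator
        (fun u => ENNReal.ofReal (ψ u)) u ∂μ₂ ≤
      ENNReal.ofReal D * ENNReal.ofReal θ * μ₂ (E ∩ AB) := by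
    rw [← hJE E hE, ← lintegral_const_mul _ (hJm.indicator (hTi hE))]
    refine setLIntegral_mono' hZm fun u hu => ?_
    by_cases huE : u ∈ (indMap T n₀)^[i] ⁻¹' E
    · rw [indicator_of_mem huE, indicator_of_mem huE, ← ENNReal.ofReal_mul hD,
        ← ENNReal.ofReal_mul (by positivity)]
      refine ENNReal.ofReal_le_ofReal ?_
      rw [← div_le_iff₀ (indJac_pos hF.jac_pos _ _ _ _)]
      exact hψ u hu v₀ hv₀
    · rw [indicator_of_notMem huE, indicator_of_notMem huE, mul_zero]
  have hlow : ENNReal.ofReal θ * μ₂ (E' ∩ AB) ≤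
      ENNReal.ofReal D * ∫⁻ u in pairCyl T ω w, ((indMap T n₀)^[i] ⁻¹' E').indicator
        (fun u => ENNReal.ofReal (ψ u)) u ∂μ₂ := by
    rw [← hJE E' hE', ← lintegral_const_mul _ (hJm.indicator (hTi hE')),
      ← lintegral_const_mul' _ _ ENNReal.ofReal_ne_top]
    refine setLIntegral_mono' hZm fun u hu => ?_
    by_cases huE : u ∈ (indMap T n₀)^[i] ⁻¹' E'
    · rw [indicator_of_mem huE, indicator_of_mem huE, ← ENNReal.ofReal_mul hD,
        ← ENNReal.ofReal_mul hθ0]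
      refine ENNReal.ofReal_le_ofReal ?_
      have hJu := indJac_pos hF.jac_pos T n₀ i u
      have := mul_le_mul_of_nonneg_right (hψ v₀ hv₀ u hu) hJu.le
      calc θ * indJac T n₀ J i u ≤ D * (ψ u / indJac T n₀ J i u) * indJac T n₀ J i u := this
        _ = D * ψ u := by field_simp
    · rw [indicator_of_notMem huE, indicator_of_notMem huE, mul_zero, mul_zero]
  calc _ ≤ ENNReal.ofReal D * ENNReal.ofReal θ * μ₂ (E ∩ AB) * μ₂ (E' ∩ AB) := by gcongr
    _ = ENNReal.ofReal D * μ₂ (E ∩ AB) * (ENNReal.ofReal θ * μ₂ (E' ∩ AB)) := by ring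
    _ ≤ ENNReal.ofReal D * μ₂ (E ∩ AB) * (ENNReal.ofReal D *
        ∫⁻ u in pairCyl T ω w, ((indMap T n₀)^[i] ⁻¹' E').indicator
        (fun u => ENNReal.ofReal (ψ u)) u ∂μ₂) := by gcongr
    _ = _ := by ring

end PairMeasure
/-! ### Simultaneous arrival in a common element -/

section Lockstep

variable {X ι : Type*} {F : X → X} {R : X → ℕ} {hR : ∀ x, 0 < R x} {ω : ι → Set X} {n₀ : ℕ}

lemma iterate_towerMap_returnTime (x : X) :
    (towerMap F R hR)^[R x] ⟨(x, 0), hR x⟩ = ⟨(F x, 0), hR (F x)⟩ := by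
  obtain ⟨k, hk⟩ := Nat.exists_eq_add_of_le' (hR x)
  rw [hk, Function.iterate_succ_apply', iterate_towerMap_of_lt x 0 (hR x) k (by omega),
    towerMap_of_not_lt (by simp only; omega)]

/-- The points whose first `k + 1` iterates under `F` stay in the element `ω a`. -/
def loopSet (F : X → X) (ω : ι → Set X) (a : ι) (k : ℕ) : Set X := {y | ∀ t ≤ k, F^[t] y ∈ ω a}

lemma loopSet_subset (a : ι) (k : ℕ) : loopSet F ω a k ⊆ ω a := fun _ hy => hy 0 (Nat.zero_le k)

lemma map_mem_loopSet {a : ι} {k : ℕ} {y : X} (h : y ∈ loopSet F ω a (k + 1)) :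
    F y ∈ loopSet F ω a k := fun t ht => by
  rw [← Function.iterate_succ_apply]
  exact h (t + 1) (by omega)

lemma loopSet_anti (a : ι) {k k' : ℕ} (h : k ≤ k') : loopSet F ω a k' ⊆ loopSet F ω a k :=
  fun _ hy t ht => hy t (ht.trans h)

/-- Two points on the same level over `loopSet F ω a k` move in lockstep for `k` steps. -/
lemma lockstep (hc : ∀ i, ∀ x ∈ ω i, ∀ y ∈ ω i, R x = R y) {a : ι} (t : ℕ) {k : ℕ}
    {p q : Tower R} (h : p.1.2 = q.1.2) (hp : p.1.1 ∈ loopSet F ω a (k + t))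
    (hq : q.1.1 ∈ loopSet F ω a (k + t)) :
    ((towerMap F R hR)^[t] p).1.2 = ((towerMap F R hR)^[t] q).1.2 ∧
      ((towerMap F R hR)^[t] p).1.1 ∈ loopSet F ω a k ∧
      ((towerMap F R hR)^[t] q).1.1 ∈ loopSet F ω a k := by
  induction t generalizing p q with
  | zero => exact ⟨h, hp, hq⟩
  | succ t ih =>
    rw [Function.iterate_succ_apply, Function.iterate_succ_apply]
    have hRpq := hc a _ (loopSet_subset a _ hp) _ (loopSet_subset a _ hq)
    by_cases hlt : p.1.2 + 1 < R p.1.1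
    · have hlt' : q.1.2 + 1 < R q.1.1 := by rwa [← hRpq, ← h]
      rw [towerMap_of_lt hlt, towerMap_of_lt hlt']
      exact ih (by simp [h]) (loopSet_anti a (by omega) hp) (loopSet_anti a (by omega) hq)
    · have hlt' : ¬ q.1.2 + 1 < R q.1.1 := by rwa [← hRpq, ← h]
      rw [towerMap_of_not_lt hlt, towerMap_of_not_lt hlt']
      exact ih rfl (map_mem_loopSet hp) (map_mem_loopSet hq)

/-- If both coordinates are in the ground level over `loopSet F ω a K` at time `L`, where `K` is
large, then after that time each return is simultaneous; so the first `q` simultaneous returns take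
place within a bounded time, and the last of them leaves a common element if `L < q`. -/
lemma mem_cylSet_of_lockstep (hn : 0 < n₀) (hc : ∀ i, ∀ x ∈ ω i, ∀ y ∈ ω i, R x = R y) {a : ι}
    {r L q K : ℕ} (hr : ∀ x ∈ ω a, R x = r) (hq : L < q)
    (hK : q * ((L + 2) * (n₀ + L + r)) ≤ K) {u : Tower R × Tower R}
    (hu : ∀ t, TowerSame ω ((towerMap F R hR)^[t] u.1) ((towerMap F R hR)^[t] u.1) ∧
      TowerSame ω ((towerMap F R hR)^[t] u.2) ((towerMap F R hR)^[t] u.2))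
    (h1 : (towerMap F R hR)^[L] u.1 ∈ base R) (h2 : (towerMap F R hR)^[L] u.2 ∈ base R)
    (h1' : ((towerMap F R hR)^[L] u.1).1.1 ∈ loopSet F ω a K)
    (h2' : ((towerMap F R hR)^[L] u.2).1.1 ∈ loopSet F ω a K) :
    u ∈ cylSet (towerMap F R hR) n₀ ω q ∧
      lastSame (towerMap F R hR) n₀ ω ((indMap (towerMap F R hR) n₀)^[q - 1] u) := by
  set T := towerMap F R hR with hT
  set B := (L + 2) * (n₀ + L + r) with hB
  have hlock : ∀ t, L ≤ t → t ≤ L + K → (T^[t] u.1).1.2 = (T^[t] u.2).1.2 ∧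
      (T^[t] u.1).1.1 ∈ ω a ∧ (T^[t] u.2).1.1 ∈ ω a := by
    intro t ht htK
    obtain ⟨s, rfl⟩ := Nat.exists_eq_add_of_le ht
    have hsK : K - s + s = K := by omega
    have := lockstep (hR := hR) hc (a := a) (k := K - s) s (h1.trans h2.symm : (T^[L] u.1).1.2 = _)
      (by rw [hsK]; exact h1') (by rw [hsK]; exact h2')
    rw [← hT, ← Function.iterate_add_apply, ← Function.iterate_add_apply, add_comm s L] at this
    exact ⟨this.1, loopSet_subset _ _ this.2.1, loopSet_subset _ _ this.2.2⟩
  have hret : ∀ t, t ≤ L + K → retTime T (T^[t] u.1) ≤ L + r ∧ retTime T (T^[t] u.2) ≤ L + r := by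
    intro t htK
    by_cases htL : t ≤ L
    · have hs : L - t + t = L := by omega
      constructor
      · refine (retTime_le_of_mem (n := L - t) ?_).trans (by omega)
        rw [← Function.iterate_add_apply, hs]
        exact h1
      · refine (retTime_le_of_mem (n := L - t) ?_).trans (by omega)
        rw [← Function.iterate_add_apply, hs]
        exact h2
    · obtain ⟨-, h3, h4⟩ := hlock t (by omega) htK
      constructor
      · refine (retTime_le_of_mem (iterate_towerMap_mem_base _)).trans ?_
        rw [hr _ h3]
        omega
      · refine (retTime_le_of_mem (iterate_towerMap_mem_base _)).trans ?_
        rw [hr _ h4]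
        omega
  have hstep : ∀ t₀, t₀ + B ≤ L + K → simRet T n₀ (T^[t₀] u.1, T^[t₀] u.2) ≤ (B : ℕ) := by
    intro t₀ ht₀
    set U := (T^[t₀] u.1, T^[t₀] u.2) with hU
    have htau : ∀ k ≤ L + 2, tau T n₀ k U ≤ k * (n₀ + L + r) := by
      intro k hk
      induction k with
      | zero => simp [tau]
      | succ k ih =>
        have ih := ih (by omega)
        have hkB : (k + 1) * (n₀ + L + r) ≤ B := Nat.mul_le_mul_right _ hk
        rw [Nat.succ_mul] at hkB ⊢
        have hr' := hret (n₀ + tau T n₀ k U + t₀) (by omega)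
        have hle : retTime T (T^[n₀ + tau T n₀ k U] (if k % 2 = 0 then U.1 else U.2)) ≤ L + r := by
          split_ifs
          · rw [hU, ← Function.iterate_add_apply]
            exact hr'.1
          · rw [hU, ← Function.iterate_add_apply]
            exact hr'.2
        simp only [tau]
        omega
    have h3 := htau (L + 2) le_rfl
    have h4 := mul_le_tau (T := T) (n₀ := n₀) (L + 2) U
    have h5 : L + 2 ≤ (L + 2) * n₀ := Nat.le_mul_of_pos_right _ hn
    have hl := (hlock (tau T n₀ (L + 2) U + t₀) (by omega) (by omega)).1
    have hb := tau_succ_mem_base (F := F) (hR := hR) (n₀ := n₀) (L + 1) U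
    rw [← hT] at hb
    have hboth : T^[tau T n₀ (L + 2) U] U.1 ∈ base R ∧ T^[tau T n₀ (L + 2) U] U.2 ∈ base R := by
      rw [Function.iterate_add_apply, Function.iterate_add_apply] at hl
      split_ifs at hb
      · exact ⟨hb, (hl.symm.trans hb : (T^[tau T n₀ (L + 2) U] (T^[t₀] u.2)).1.2 = 0)⟩
      · exact ⟨(hl.trans hb : (T^[tau T n₀ (L + 2) U] (T^[t₀] u.1)).1.2 = 0), hb⟩
    refine (simRet_le (by omega) hboth.1 hboth.2).trans ?_
    exact_mod_cast h3
  have hSu : ∀ j ≤ q, stopTime T n₀ j u ≤ j * B := by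
    intro j hj
    induction j with
    | zero => simp [stopTime]
    | succ j ih =>
      have ih := ih (by omega)
      have hjB : (j + 1) * B ≤ q * B := Nat.mul_le_mul_right _ hj
      rw [Nat.succ_mul] at hjB ⊢
      have h3 := hstep (stopTime T n₀ j u) (by omega)
      rw [← indMap_iterate] at h3
      rw [stopTime_succ]
      have := ENat.toNat_le_of_le_natCast h3
      omega
  have hcyl : u ∈ cylSet T n₀ ω q := by
    intro j hj
    have hjB : (j + 1) * B ≤ q * B := Nat.mul_le_mul_right _ hj
    rw [Nat.succ_mul] at hjB
    have h3 := hSu j hj.le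
    have h4 := hstep (stopTime T n₀ j u) (by omega)
    rw [← indMap_iterate] at h4
    refine ⟨ne_top_of_le_ne_top (ENat.natCast_ne_top _) h4, rfl, fun t _ => ?_⟩
    rw [indMap_iterate, ← Function.iterate_add_apply, ← Function.iterate_add_apply]
    exact hu _
  refine ⟨hcyl, ?_⟩
  have hq1 : q - 1 + 1 = q := by omega
  have h3 := length_le_stopTime hn q hcyl
  have h4 := hSu q le_rfl
  rw [lastSame_iterate_iff hn (by rw [hq1]; exact hcyl), hq1]
  obtain ⟨h5, h6, h7⟩ := hlock (stopTime T n₀ q u - 1) (by omega) (by omega)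
  exact ⟨h5, a, h6, h7⟩

end Lockstep

section Reaches

variable {X ι : Type*} [MeasurableSpace X] {m : Measure X} {F : X → X} {R : X → ℕ}
  {hR : ∀ x, 0 < R x} {ω : ι → Set X} {J : X → ℝ} {β : ℝ} {n₀ : ℕ}

lemma IsWGM.inter_preimage_null_iff (hF : IsWGM m F ω J β) (i : ι) {E : Set X}
    (hE : MeasurableSet E) : m (ω i ∩ F ⁻¹' E) = 0 ↔ m (F '' ω i ∩ E) = 0 := by
  have hA : MeasurableSet (ω i ∩ F ⁻¹' E) :=
    (hF.measurableSet_elt i).inter (hF.measurable_map hE)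
  have h1 := hF.measure_image i _ inter_subset_left hA
  rw [image_inter_preimage] at h1
  have hJm : Measurable fun x => ENNReal.ofReal (J x) := hF.measurable_jac.ennreal_ofReal
  have h2 : (0 < ∫⁻ x in ω i ∩ F ⁻¹' E, ENNReal.ofReal (J x) ∂m) ↔ 0 < m (ω i ∩ F ⁻¹' E) := by
    rw [setLIntegral_pos_iff hJm]
    have : Function.support (fun x => ENNReal.ofReal (J x)) = univ := by
      ext x
      simp [hF.jac_pos x]
    rw [this, univ_inter]
  rw [h1, ← not_iff_not]
  exact (pos_iff_ne_zero.symm.trans h2.symm).trans pos_iff_ne_zero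

/-- Every subset of `ω j` of positive measure is reached, by a set of positive measure of points
`x ∈ ω i`, by `T^l (x, 0)` in the ground level. -/
def Reaches (m : Measure X) (F : X → X) (R : X → ℕ) (hR : ∀ x, 0 < R x) (ω : ι → Set X) (i : ι)
    (l : ℕ) (j : ι) : Prop :=
  ∀ E ⊆ ω j, MeasurableSet E → m E ≠ 0 →
    m {x | x ∈ ω i ∧ ((towerMap F R hR)^[l] ⟨(x, 0), hR x⟩).1.2 = 0 ∧
      ((towerMap F R hR)^[l] ⟨(x, 0), hR x⟩).1.1 ∈ E} ≠ 0

lemma measurableSet_reach (hF : IsWGM m F ω J β) (hRm : Measurable R) (i : ι) (l : ℕ) {E : Set X}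
    (hE : MeasurableSet E) :
    MeasurableSet {x | x ∈ ω i ∧ ((towerMap F R hR)^[l] ⟨(x, 0), hR x⟩).1.2 = 0 ∧
      ((towerMap F R hR)^[l] ⟨(x, 0), hR x⟩).1.1 ∈ E} := by
  have h1 : Measurable fun x => (towerMap F R hR)^[l] ⟨(x, 0), hR x⟩ :=
    ((measurable_towerMap hRm hF.measurable_map).iterate l).comp
      (Measurable.subtype_mk (by fun_prop))
  exact (hF.measurableSet_elt i).inter (((measurable_towerLevel.comp h1)
    (measurableSet_singleton 0)).inter ((measurable_towerProj.comp h1) hE))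

lemma Reaches.trans (hF : IsWGM m F ω J β) (hRm : Measurable R) {i j k : ι} {l l' : ℕ}
    (h : Reaches m F R hR ω i l j) (h' : Reaches m F R hR ω j l' k) :
    Reaches m F R hR ω i (l + l') k := by
  intro E hEk hE hE0
  have h1 := h _ (fun x hx => hx.1) (measurableSet_reach (hR := hR) hF hRm j l' hE)
    (h' E hEk hE hE0)
  intro h0
  refine h1 (measure_mono_null ?_ h0)
  rintro x ⟨hx, h2, -, h3, h4⟩
  have h5 : (towerMap F R hR)^[l] ⟨(x, 0), hR x⟩ =
      ⟨(((towerMap F R hR)^[l] ⟨(x, 0), hR x⟩).1.1, 0), hR _⟩ := Subtype.ext (Prod.ext rfl h2)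
  rw [← h5] at h3 h4
  rw [← Function.iterate_add_apply, add_comm] at h3 h4
  exact ⟨hx, h3, h4⟩

lemma Reaches.refl (hR : ∀ x, 0 < R x) (i : ι) : Reaches m F R hR ω i 0 i := by
  intro E hE _ h0 h
  refine h0 (measure_mono_null ?_ h)
  exact fun x hx => ⟨hE hx, rfl, hx⟩

lemma Reaches.of_image (hF : IsWGM m F ω J β) {i j : ι} {r : ℕ} (hr : ∀ x ∈ ω i, R x = r)
    (hij : m (ω j \ F '' ω i) = 0) : Reaches m F R hR ω i r j := by
  intro E hEj hE hE0 h0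
  have h1 : m (ω i ∩ F ⁻¹' E) = 0 := by
    refine measure_mono_null ?_ h0
    rintro x ⟨hx, hxE⟩
    have := iterate_towerMap_returnTime (F := F) (hR := hR) x
    rw [hr x hx] at this
    rw [mem_ofPred_eq, this]
    exact ⟨hx, rfl, hxE⟩
  rw [hF.inter_preimage_null_iff i hE] at h1
  refine hE0 (measure_mono_null (t := (F '' ω i ∩ E) ∪ (ω j \ F '' ω i)) ?_
    (measure_union_null h1 hij))
  intro x hx
  by_cases h : x ∈ F '' ω i
  · exact Or.inl ⟨h, hx⟩
  · exact Or.inr ⟨hEj hx, h⟩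

lemma exists_reaches [Countable ι] (hF : IsWGM m F ω J β) (hRt : IsReturnTime R ω) (j : ι) (n : ℕ) :
    ∀ i, m (ω i ∩ F^[n] ⁻¹' ω j) ≠ 0 → ∃ l, Reaches m F R hR ω i l j := by
  induction n with
  | zero =>
    intro i h
    have hij : i = j := by
      by_contra hne
      refine h ?_
      rw [Function.iterate_zero, preimage_id, (hF.disjoint hne).inter_eq, measure_empty]
    exact ⟨0, hij ▸ Reaches.refl hR i⟩
  | succ n ih =>
    intro i h
    have hmE : MeasurableSet (F^[n] ⁻¹' ω j) :=
      hF.measurable_map.iterate n (hF.measurableSet_elt j)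
    obtain ⟨k, hk⟩ : ∃ k, m (ω i ∩ F ⁻¹' (ω k ∩ F^[n] ⁻¹' ω j)) ≠ 0 := by
      by_contra hcon
      push Not at hcon
      refine h (measure_mono_null (t := (ω i ∩ F ⁻¹' (⋃ k, ω k)ᶜ) ∪
        ⋃ k, ω i ∩ F ⁻¹' (ω k ∩ F^[n] ⁻¹' ω j)) ?_ (measure_union_null ?_
        (measure_iUnion_null hcon)))
      · rintro x ⟨hx, hx'⟩
        rw [mem_preimage, Function.iterate_succ_apply] at hx'
        by_cases hc : F x ∈ ⋃ k, ω k
        · obtain ⟨k, hk⟩ := mem_iUnion.1 hc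
          exact Or.inr (mem_iUnion.2 ⟨k, hx, hk, hx'⟩)
        · exact Or.inl ⟨hx, hc⟩
      · rw [hF.inter_preimage_null_iff i (MeasurableSet.iUnion hF.measurableSet_elt).compl]
        exact measure_mono_null inter_subset_right hF.cover
    rw [Ne, hF.inter_preimage_null_iff i ((hF.measurableSet_elt k).inter hmE)] at hk
    obtain ⟨l, hl⟩ := ih k fun h0 => hk (measure_mono_null inter_subset_right h0)
    have hik : m (ω k \ F '' ω i) = 0 := (hF.inter_null_or_diff_null i k).resolve_left fun h0 =>
      hk (measure_mono_null (inter_subset_inter_right _ inter_subset_left) h0)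
    obtain ⟨x, hx⟩ : (ω i).Nonempty := by
      by_contra hne
      rw [not_nonempty_iff_eq_empty] at hne
      exact h (by rw [hne, empty_inter, measure_empty])
    exact ⟨R x + l, (Reaches.of_image hF (fun y hy => hRt.const i y hy x hx) hik).trans hF
      hRt.measurable hl⟩

/-- Two submonoid elements of `ℕ` with prescribed difference, if the submonoid contains a number
`r₀` and all `r₀ + r k`, where the `r k` are coprime. -/
lemma exists_sub_eq_of_gcd_eq_one {N : ℕ} {r : Fin N → ℕ} (hgcd : Finset.univ.gcd r = 1)
    {S : AddSubmonoid ℕ} {r₀ : ℕ} (h0 : r₀ ∈ S) (hr : ∀ k, r₀ + r k ∈ S) (d : ℤ) :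
    ∃ a ∈ S, ∃ b ∈ S, (a : ℤ) - b = d := by
  let H : AddSubgroup ℤ :=
    { carrier := {z | ∃ a ∈ S, ∃ b ∈ S, (a : ℤ) - b = z}
      add_mem' := by
        rintro _ _ ⟨a, ha, b, hb, rfl⟩ ⟨a', ha', b', hb', rfl⟩
        exact ⟨a + a', S.add_mem ha ha', b + b', S.add_mem hb hb', by push_cast; ring⟩
      zero_mem' := ⟨0, S.zero_mem, 0, S.zero_mem, by simp⟩
      neg_mem' := by
        rintro _ ⟨a, ha, b, hb, rfl⟩
        exact ⟨b, hb, a, ha, by ring⟩ }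
  have hmem : ∀ k, (r k : ℤ) ∈ H := fun k => ⟨r₀ + r k, hr k, r₀, h0, by push_cast; ring⟩
  obtain ⟨g, hg⟩ := Int.subgroup_cyclic H
  have hdvd : ∀ k, g ∣ (r k : ℤ) := fun k => by
    have := hmem k
    rw [hg, AddSubgroup.mem_closure_singleton] at this
    obtain ⟨n, hn⟩ := this
    exact ⟨n, by rw [← hn, smul_eq_mul, mul_comm]⟩
  have h1 : g.natAbs ∣ 1 := by
    rw [← hgcd]
    exact Finset.dvd_gcd fun k _ => Int.natAbs_dvd_natAbs.2 (hdvd k) |>.trans (by simp)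
  have hd : d ∈ H := by
    rw [hg, AddSubgroup.mem_closure_singleton]
    have : g ∣ d := Int.natAbs_dvd.1 (by rw [Nat.dvd_one.1 h1]; simp)
    obtain ⟨c, hc⟩ := this
    exact ⟨c, by rw [hc, smul_eq_mul, mul_comm]⟩
  exact hd

/-- Any two elements are connected to a fixed element of the coprime block by orbits of the same
length. -/
lemma exists_reaches_both [Countable ι] (hF : IsWGM m F ω J β) (hRt : IsReturnTime R ω)
    (hap : Aperiodic m F ω) (hcop : HasCoprimeBlock m F R ω) :
    ∃ a, m (ω a \ F '' ω a) = 0 ∧ ∀ i j, ∃ L, Reaches m F R hR ω i L a ∧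
      Reaches m F R hR ω j L a := by
  obtain ⟨N, hN, a, r, hr, hgcd, himg⟩ := hcop
  have himg' : ∀ k l, m (ω (a l) \ F '' ω (a k)) = 0 := fun k l =>
    measure_mono_null (Set.sdiff_subset_sdiff_left (subset_iUnion (fun l => ω (a l)) l))
      (ae_le_set.1 (himg k))
  have hone : ∀ k l, Reaches m F R hR ω (a k) (r k) (a l) := fun k l =>
    Reaches.of_image hF (hr k) (himg' k l)
  let z : Fin N := ⟨0, by omega⟩
  let S : AddSubmonoid ℕ :=
    { carrier := {t | Reaches m F R hR ω (a z) t (a z)}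
      add_mem' := fun h h' => Reaches.trans hF hRt.measurable h h'
      zero_mem' := Reaches.refl hR _ }
  have hreach : ∀ i, ∃ l, Reaches m F R hR ω i l (a z) := by
    intro i
    obtain ⟨k, hk⟩ := hap i (a z)
    exact exists_reaches hF hRt (a z) k i (hk k le_rfl).ne'
  refine ⟨a z, himg' z z, fun i j => ?_⟩
  obtain ⟨l, hl⟩ := hreach i
  obtain ⟨l', hl'⟩ := hreach j
  obtain ⟨t, ht, t', ht', htt⟩ := exists_sub_eq_of_gcd_eq_one hgcd (S := S) (r₀ := r z)
    (hone z z) (fun k => (hone z k).trans hF hRt.measurable (hone k z)) ((l' : ℤ) - l)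
  have hL : l + t = l' + t' := by omega
  refine ⟨l + t, hl.trans hF hRt.measurable ht, ?_⟩
  rw [hL]
  exact hl'.trans hF hRt.measurable ht'

lemma measure_elt_ne_zero (hF : IsWGM m F ω J β) (i : ι) : m (ω i) ≠ 0 := by
  obtain ⟨δ, hδ, h⟩ := hF.long_branches
  intro h0
  have h1 := hF.measure_image i (ω i) subset_rfl (hF.measurableSet_elt i)
  rw [setLIntegral_measure_zero _ _ h0] at h1
  have := h i
  rw [h1] at this
  exact absurd this (not_le.2 (ENNReal.ofReal_pos.2 hδ))

lemma measure_loopSet_ne_zero (hF : IsWGM m F ω J β) {a : ι} (ha : m (ω a \ F '' ω a) = 0) (k : ℕ) :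
    MeasurableSet (loopSet F ω a k) ∧ m (loopSet F ω a k) ≠ 0 := by
  have hmeas : ∀ k, MeasurableSet (loopSet F ω a k) := by
    intro k
    have : loopSet F ω a k = ⋂ t, ⋂ (_ : t ≤ k), F^[t] ⁻¹' ω a := by
      ext y
      simp [loopSet]
    rw [this]
    exact MeasurableSet.iInter fun t => MeasurableSet.iInter fun _ =>
      hF.measurable_map.iterate t (hF.measurableSet_elt a)
  refine ⟨hmeas k, ?_⟩
  induction k with
  | zero =>
    intro h
    refine measure_elt_ne_zero hF a (measure_mono_null ?_ h)
    intro y hy t ht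
    rw [Nat.le_zero.1 ht]
    exact hy
  | succ k ih =>
    intro h
    have h1 : m (ω a ∩ F ⁻¹' loopSet F ω a k) = 0 := by
      refine measure_mono_null ?_ h
      rintro y ⟨hy, hFy⟩ t ht
      cases t with
      | zero => exact hy
      | succ t => exact hFy t (by omega)
    rw [hF.inter_preimage_null_iff a (hmeas k)] at h1
    refine ih (measure_mono_null (t := (F '' ω a ∩ loopSet F ω a k) ∪ (ω a \ F '' ω a)) ?_
      (measure_union_null h1 ha))
    intro x hx
    by_cases hxF : x ∈ F '' ω a
    · exact Or.inl ⟨hxF, hx⟩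
    · exact Or.inr ⟨loopSet_subset a k hx, hxF⟩

/-- The pairs whose first `q` simultaneous returns exist, the last one coming from a common element
of the partition of the tower. -/
def goodSet (T : Tower R → Tower R) (n₀ : ℕ) (ω : ι → Set X) (q : ℕ) : Set (Tower R × Tower R) :=
  {u | u ∈ cylSet T n₀ ω q ∧ lastSame T n₀ ω ((indMap T n₀)^[q - 1] u)}

lemma ae_forall_towerSame [SFinite m] [Countable ι] (hF : IsWGM m F ω J β)
    (hRt : IsReturnTime R ω) :
    ∀ᵐ p ∂(towerMeasure m R), ∀ t, TowerSame ω ((towerMap F R hR)^[t] p)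
      ((towerMap F R hR)^[t] p) := by
  rw [ae_all_iff]
  intro t
  have hT : Measurable (towerMap F R hR) := measurable_towerMap hRt.measurable hF.measurable_map
  have hm : MeasurableSet (⋃ e, towerElt R ω e)ᶜ :=
    (MeasurableSet.iUnion fun e => measurableSet_towerElt hF.measurableSet_elt e).compl
  have h0 : ∀ t, towerMeasure m R ((towerMap F R hR)^[t] ⁻¹' (⋃ e, towerElt R ω e)ᶜ) = 0 := by
    intro t
    induction t with
    | zero => exact iUnion_towerElt_compl_null hF hRt
    | succ t ih =>
      rw [Function.iterate_succ, preimage_comp]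
      exact towerMap_preimage_null hF hRt (hT.iterate t hm) ih
  refine measure_mono_null ?_ (h0 t)
  intro p hp hmem
  obtain ⟨e, he⟩ := mem_iUnion.1 hmem
  exact hp (towerSame_iff.2 ⟨e, he, he⟩)

lemma measure_goodSet_inter_ne_zero [SFinite m] [Countable ι] [SFinite (towerMeasure m R)]
    (hF : IsWGM m F ω J β) (hRt : IsReturnTime R ω) (hn : 0 < n₀) {a : ι}
    (ha : m (ω a \ F '' ω a) = 0) {i j : ι} {L : ℕ} (hi : Reaches m F R hR ω i L a)
    (hj : Reaches m F R hR ω j L a) {q : ℕ} (hq : L < q) :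
    ((towerMeasure m R).prod (towerMeasure m R)) (goodSet (towerMap F R hR) n₀ ω q ∩
      towerElt R ω (i, 0) ×ˢ towerElt R ω (j, 0)) ≠ 0 := by
  obtain ⟨y, hy⟩ : (ω a).Nonempty := by
    by_contra hne
    rw [not_nonempty_iff_eq_empty] at hne
    exact measure_elt_ne_zero hF a (by rw [hne, measure_empty])
  set K := q * ((L + 2) * (n₀ + L + R y)) with hK
  obtain ⟨hEm, hE0⟩ := measure_loopSet_ne_zero hF ha K
  set N : Set (Tower R) := {p | ∀ t, TowerSame ω ((towerMap F R hR)^[t] p)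
      ((towerMap F R hR)^[t] p)}
  set P : ι → Set (Tower R) := fun i => {p | p.1.2 = 0 ∧ p.1.1 ∈ {x | x ∈ ω i ∧
    ((towerMap F R hR)^[L] ⟨(x, 0), hR x⟩).1.2 = 0 ∧
      ((towerMap F R hR)^[L] ⟨(x, 0), hR x⟩).1.1 ∈ loopSet F ω a K}} with hP
  have hP0 : ∀ i, Reaches m F R hR ω i L a → towerMeasure m R (P i ∩ N) ≠ 0 := by
    intro i hi
    rw [measure_inter_conull (ae_forall_towerSame hF hRt), hP, towerMeasure_level hRt.measurable,
      show {x | 0 < R x} = univ from eq_univ_of_forall hR, inter_univ]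
    exact hi _ (loopSet_subset a K) hEm hE0
  intro h0
  have h1 : ((towerMeasure m R).prod (towerMeasure m R)) ((P i ∩ N) ×ˢ (P j ∩ N)) = 0 := by
    refine measure_mono_null ?_ h0
    rintro ⟨p, p'⟩ ⟨⟨⟨hp1, hp2, hp3, hp4⟩, hpN⟩, ⟨hp1', hp2', hp3', hp4'⟩, hpN'⟩
    have e1 : p = ⟨(p.1.1, 0), hR _⟩ := Subtype.ext (Prod.ext rfl hp1)
    have e2 : p' = ⟨(p'.1.1, 0), hR _⟩ := Subtype.ext (Prod.ext rfl hp1')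
    rw [← e1] at hp3 hp4
    rw [← e2] at hp3' hp4'
    exact ⟨mem_cylSet_of_lockstep hn hRt.const (fun x hx => hRt.const a x hx y hy) hq le_rfl
      (fun t => ⟨hpN t, hpN' t⟩) hp3 hp3' hp4 hp4', ⟨hp1, hp2⟩, hp1', hp2'⟩
  rw [Measure.prod_prod, mul_eq_zero] at h1
  exact h1.elim (hP0 i hi) (hP0 j hj)

lemma exists_ne_zero_forall_le {κ : Type*} (s : Finset κ) {f : κ → ℝ≥0∞} (h : ∀ k ∈ s, f k ≠ 0) :
    ∃ c : ℝ≥0∞, c ≠ 0 ∧ ∀ k ∈ s, c ≤ f k := by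
  rcases s.eq_empty_or_nonempty with rfl | hs
  · exact ⟨1, one_ne_zero, by simp⟩
  · obtain ⟨k, hk, hmin⟩ := s.exists_min_image f hs
    exact ⟨f k, h k hk, hmin⟩

/-- Uniformly over the images of all elements, pairs of points in the ground level have a positive
proportion whose `q`-th simultaneous return comes from a common element: all images have measure
bounded below, so each of them contains one of finitely many elements. -/
lemma exists_goodSet_lower_bound [IsFiniteMeasure m] [Countable ι] [SFinite (towerMeasure m R)]
    (hF : IsWGM m F ω J β) (hRt : IsReturnTime R ω) (hap : Aperiodic m F ω)
    (hcop : HasCoprimeBlock m F R ω) (hR : ∀ x, 0 < R x) (hn : 0 < n₀) :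
    ∃ q ≥ 1, ∃ c : ℝ≥0∞, c ≠ 0 ∧ ∀ i j,
      c ≤ ((towerMeasure m R).prod (towerMeasure m R)) (goodSet (towerMap F R hR) n₀ ω q ∩
        {p : Tower R | p.1.2 = 0 ∧ p.1.1 ∈ F '' ω i} ×ˢ
        {p : Tower R | p.1.2 = 0 ∧ p.1.1 ∈ F '' ω j}) := by
  classical
  obtain ⟨δ, hδ, hlong⟩ := hF.long_branches
  have hsum : ∑' i, m (ω i) ≠ ⊤ := by
    rw [← measure_iUnion hF.disjoint hF.measurableSet_elt]
    exact measure_ne_top _ _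
  obtain ⟨Λ, hΛ⟩ := ((ENNReal.tendsto_tsum_compl_atTop_zero hsum).eventually
    (gt_mem_nhds (ENNReal.ofReal_pos.2 hδ))).exists
  -- each image contains an element with index in the finite set `Λ`
  have hcontains : ∀ i, ∃ k ∈ Λ, m (ω k \ F '' ω i) = 0 := by
    intro i
    by_contra hcon
    push Not at hcon
    have h1 : ∀ k ∈ Λ, m (F '' ω i ∩ ω k) = 0 := fun k hk =>
      (hF.inter_null_or_diff_null i k).resolve_right (hcon k hk)
    have h2 : F '' ω i ⊆ ((⋃ k, ω k)ᶜ ∪ ⋃ k ∈ Λ, F '' ω i ∩ ω k) ∪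
        ⋃ k : {k // k ∉ Λ}, ω k := by
      intro x hx
      by_cases hc : x ∈ ⋃ k, ω k
      · obtain ⟨k, hk⟩ := mem_iUnion.1 hc
        by_cases hkΛ : k ∈ Λ
        · exact Or.inl (Or.inr (mem_iUnion₂.2 ⟨k, hkΛ, hx, hk⟩))
        · exact Or.inr (mem_iUnion.2 ⟨⟨k, hkΛ⟩, hk⟩)
      · exact Or.inl (Or.inl hc)
    have h3 : m ((⋃ k, ω k)ᶜ ∪ ⋃ k ∈ Λ, F '' ω i ∩ ω k) = 0 :=
      measure_union_null hF.cover ((measure_biUnion_null_iff Λ.countable_toSet).2 h1)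
    have h4 : m (F '' ω i) < ENNReal.ofReal δ := by
      calc m (F '' ω i) ≤ m ((⋃ k, ω k)ᶜ ∪ ⋃ k ∈ Λ, F '' ω i ∩ ω k) +
            m (⋃ k : {k // k ∉ Λ}, ω k) := (measure_mono h2).trans (measure_union_le _ _)
        _ ≤ 0 + ∑' k : {k // k ∉ Λ}, m (ω k) := by
            rw [h3]
            gcongr
            exact measure_iUnion_le _
        _ < ENNReal.ofReal δ := by rw [zero_add]; exact hΛ
    exact absurd (hlong i) (not_le.2 h4)
  obtain ⟨a, ha, hreach⟩ := exists_reaches_both (hR := hR) hF hRt hap hcop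
  choose L hL₁ hL₂ using hreach
  set q := (Λ ×ˢ Λ).sup (fun k => L k.1 k.2) + 1 with hq
  have hqL : ∀ k ∈ Λ ×ˢ Λ, L k.1 k.2 < q := fun k hk =>
    Nat.lt_succ_of_le (Finset.le_sup (f := fun k : ι × ι => L k.1 k.2) hk)
  obtain ⟨c, hc0, hc⟩ := exists_ne_zero_forall_le (Λ ×ˢ Λ)
    (f := fun k => ((towerMeasure m R).prod (towerMeasure m R))
      (goodSet (towerMap F R hR) n₀ ω q ∩ towerElt R ω (k.1, 0) ×ˢ towerElt R ω (k.2, 0)))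
    fun k hk => measure_goodSet_inter_ne_zero hF hRt hn ha (hL₁ _ _) (hL₂ _ _) (hqL k hk)
  refine ⟨q, by omega, c, hc0, fun i j => ?_⟩
  obtain ⟨k, hk, hik⟩ := hcontains i
  obtain ⟨k', hk', hjk⟩ := hcontains j
  have hae : ∀ i k, m (ω k \ F '' ω i) = 0 → ∀ᵐ p ∂(towerMeasure m R),
      p ∈ towerElt R ω (k, 0) → p ∈ {p : Tower R | p.1.2 = 0 ∧ p.1.1 ∈ F '' ω i} := by
    intro i k hik
    have : towerMeasure m R {p | p.1.2 = 0 ∧ p.1.1 ∈ ω k \ F '' ω i} = 0 := by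
      rw [towerMeasure_level hRt.measurable]
      exact measure_mono_null inter_subset_left hik
    refine measure_mono_null ?_ this
    intro p hp
    simp only [mem_compl_iff, mem_ofPred_eq, Classical.not_imp] at hp
    exact ⟨hp.1.1, hp.1.2, fun h => hp.2 ⟨hp.1.1, h⟩⟩
  refine (hc (k, k') (Finset.mk_mem_product hk hk')).trans (measure_mono_ae ?_)
  have h1 := Measure.quasiMeasurePreserving_fst (μ := towerMeasure m R) (ν := towerMeasure m R)
    |>.ae (hae i k hik)
  have h2 := Measure.quasiMeasurePreserving_snd (μ := towerMeasure m R) (ν := towerMeasure m R)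
    |>.ae (hae j k' hjk)
  filter_upwards [h1, h2] with u hu1 hu2 hu
  exact ⟨hu.1, hu1 hu.2.1, hu2 hu.2.2⟩

end Reaches

/-! ### Decay of the uncoupled mass -/

section Sequences

lemma le_one_sub_mul {x Y Z : ℝ≥0∞} (hY : Y ≠ ⊤) (hx : x ≤ 1) (h : Z + x * Y ≤ Y) :
    Z ≤ (1 - x) * Y := by
  have hxY : x * Y ≠ ⊤ := ENNReal.mul_ne_top (ne_top_of_le_ne_top ENNReal.one_ne_top hx) hY
  rw [ENNReal.sub_mul (fun _ _ => hY), one_mul]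
  exact ENNReal.le_sub_of_add_le_right hxY h

lemma prod_Icc_le_pow_mul {b : ℕ → ℝ≥0∞} (hb : ∀ j, 2⁻¹ ≤ b j) (j₀ k : ℕ) :
    1 ≤ 2 ^ k * ∏ j ∈ Finset.Ico j₀ (j₀ + k), b j := by
  induction k with
  | zero => simp
  | succ k ih =>
    rw [← add_assoc, Finset.prod_Ico_succ_top (by omega), pow_succ]
    calc (1 : ℝ≥0∞) = 1 * (2 * 2⁻¹) := by
          rw [ENNReal.mul_inv_cancel two_ne_zero ENNReal.ofNat_ne_top, one_mul]
      _ ≤ (2 ^ k * ∏ j ∈ Finset.Ico j₀ (j₀ + k), b j) * (2 * b (j₀ + k)) := by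
          gcongr
          exact hb _
      _ = _ := by ring

/-- A nonincreasing sequence that contracts by `b_j ^ q` over each window of length `q` decays like
the product of the `b_j`: the products over `q` consecutive terms contract by `b_j ^ q` at each
step. -/
lemma le_prod_of_window_contraction {a b : ℕ → ℝ≥0∞} {q j₀ : ℕ} (hq : 1 ≤ q)
    (hb : ∀ j, 2⁻¹ ≤ b j) (ha : ∀ j ≥ j₀, a (j + 1) ≤ a j)
    (hstep : ∀ j ≥ j₀, a (j + q) ≤ b (j + q) ^ q * a j) {i : ℕ} (hi : j₀ ≤ i) :
    a i ≤ 2 ^ q * (∏ j ∈ Finset.Ico (j₀ + 1) (i + 1), b j) * a j₀ := by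
  have hanti : ∀ j ≥ j₀, ∀ k, a (j + k) ≤ a j := by
    intro j hj k
    induction k with
    | zero => exact le_rfl
    | succ k ih => exact (ha (j + k) (by omega)).trans ih
  obtain ⟨p, rfl⟩ := Nat.exists_eq_add_of_le' hq
  -- products of `q` consecutive terms
  have hwin : ∀ n, ∏ r ∈ Finset.range (p + 1), a (j₀ + n + r) ≤
      (∏ j ∈ Finset.Ico (j₀ + (p + 1)) (j₀ + (p + 1) + n), b j) ^ (p + 1) * a j₀ ^ (p + 1) := by
    intro n
    induction n with
    | zero =>
      simp only [add_zero, Finset.Ico_self, Finset.prod_empty, one_pow, one_mul]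
      calc ∏ r ∈ Finset.range (p + 1), a (j₀ + r) ≤ ∏ _r ∈ Finset.range (p + 1), a j₀ :=
            Finset.prod_le_prod' fun r _ => hanti j₀ le_rfl r
        _ = a j₀ ^ (p + 1) := by simp
    | succ n ih =>
      rw [Finset.prod_range_succ, ← add_assoc (j₀ + (p + 1)), Finset.prod_Ico_succ_top (by omega)]
      rw [Finset.prod_range_succ'] at ih
      have e1 : ∀ r, j₀ + (n + 1) + r = j₀ + n + (r + 1) := fun r => by omega
      have h1 := hstep (j₀ + n) (by omega)
      rw [show j₀ + n + (p + 1) = j₀ + (p + 1) + n by omega] at h1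
      calc (∏ r ∈ Finset.range p, a (j₀ + (n + 1) + r)) * a (j₀ + (n + 1) + p)
          = (∏ r ∈ Finset.range p, a (j₀ + n + (r + 1))) * a (j₀ + (p + 1) + n) := by
            simp_rw [e1]
            rw [show j₀ + n + (p + 1) = j₀ + (p + 1) + n by omega]
        _ ≤ (∏ r ∈ Finset.range p, a (j₀ + n + (r + 1))) *
            (b (j₀ + (p + 1) + n) ^ (p + 1) * a (j₀ + n)) := by gcongr
        _ = b (j₀ + (p + 1) + n) ^ (p + 1) *
            ((∏ r ∈ Finset.range p, a (j₀ + n + (r + 1))) * a (j₀ + n + 0)) := by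
            rw [add_zero]; ring
        _ ≤ b (j₀ + (p + 1) + n) ^ (p + 1) *
            ((∏ j ∈ Finset.Ico (j₀ + (p + 1)) (j₀ + (p + 1) + n), b j) ^ (p + 1) *
              a j₀ ^ (p + 1)) := by gcongr
        _ = _ := by ring
  by_cases hip : i < j₀ + (p + 1)
  · obtain ⟨k, rfl⟩ := Nat.exists_eq_add_of_le hi
    have h1 := prod_Icc_le_pow_mul hb (j₀ + 1) k
    have h2 : (2 : ℝ≥0∞) ^ k ≤ 2 ^ (p + 1) := pow_le_pow_right₀ (by norm_num) (by omega)
    calc a (j₀ + k) ≤ 1 * a j₀ := by rw [one_mul]; exact hanti j₀ le_rfl k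
      _ ≤ (2 ^ (p + 1) * ∏ j ∈ Finset.Ico (j₀ + 1) (j₀ + 1 + k), b j) * a j₀ := by
          gcongr
          exact h1.trans (by gcongr)
      _ = _ := by rw [show j₀ + 1 + k = j₀ + k + 1 by omega]
  · obtain ⟨n, rfl⟩ := Nat.exists_eq_add_of_le (not_lt.1 hip)
    have h1 : a (j₀ + (p + 1) + n) ^ (p + 1) ≤
        ((∏ j ∈ Finset.Ico (j₀ + (p + 1)) (j₀ + (p + 1) + (n + 1)), b j) * a j₀) ^ (p + 1) := by
      rw [mul_pow]
      refine le_trans ?_ (hwin (n + 1))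
      calc a (j₀ + (p + 1) + n) ^ (p + 1) =
            ∏ _r ∈ Finset.range (p + 1), a (j₀ + (p + 1) + n) := by simp
        _ ≤ _ := by
            refine Finset.prod_le_prod' fun r hr => ?_
            have hr' := Finset.mem_range.1 hr
            obtain ⟨d, hd⟩ := Nat.exists_eq_add_of_le (show r ≤ p by omega)
            rw [show j₀ + (p + 1) + n = j₀ + (n + 1) + r + d by omega]
            exact hanti _ (by omega) d
    have h2 := (ENNReal.pow_right_strictMono (Nat.succ_ne_zero p)).le_iff_le.1 h1
    have h3 := prod_Icc_le_pow_mul hb (j₀ + 1) p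
    have h4 : (2 : ℝ≥0∞) ^ p ≤ 2 ^ (p + 1) := pow_le_pow_right₀ (by norm_num) (by omega)
    have h5 : ∏ j ∈ Finset.Ico (j₀ + 1) (j₀ + (p + 1) + n + 1), b j =
        (∏ j ∈ Finset.Ico (j₀ + 1) (j₀ + 1 + p), b j) *
        ∏ j ∈ Finset.Ico (j₀ + (p + 1)) (j₀ + (p + 1) + (n + 1)), b j := by
      rw [show j₀ + (p + 1) = j₀ + 1 + p by omega,
        show j₀ + 1 + p + n + 1 = j₀ + 1 + p + (n + 1) by omega]
      exact (Finset.prod_Ico_consecutive _ (by omega) (by omega)).symm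
    rw [h5]
    calc a (j₀ + (p + 1) + n) ≤
          1 * ((∏ j ∈ Finset.Ico (j₀ + (p + 1)) (j₀ + (p + 1) + (n + 1)), b j) * a j₀) := by
          rw [one_mul]; exact h2
      _ ≤ (2 ^ (p + 1) * ∏ j ∈ Finset.Ico (j₀ + 1) (j₀ + 1 + p), b j) *
          ((∏ j ∈ Finset.Ico (j₀ + (p + 1)) (j₀ + (p + 1) + (n + 1)), b j) * a j₀) := by
          gcongr
          exact h3.trans (by gcongr)
      _ = _ := by ring

lemma ratio_le_two_mul {x x' y y' r s D : ℝ} (hr : 0 < r) (hs : 0 < s) (h1 : x' ≤ x)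
    (h2 : 1 / 2 * y ≤ y') (h3 : x / r ≤ D * (y / s)) (hD : 0 ≤ D) :
    x' / r ≤ 2 * D * (y' / s) := by
  calc x' / r ≤ x / r := by gcongr
    _ ≤ D * (y / s) := h3
    _ ≤ D * (2 * y' / s) := by
        gcongr
        linarith
    _ = 2 * D * (y' / s) := by ring

end Sequences

section CouplingDensity

lemma mem_cylSet_of_mem_xiElt {X ι : Type*} {R : X → ℕ} {ω : ι → Set X} {n₀ : ℕ}
    (hd : Pairwise fun i j => Disjoint (ω i) (ω j)) {T : Tower R → Tower R}
    {i : ℕ} {u v : Tower R × Tower R} (h : v ∈ xiElt T n₀ ω i u) : u ∈ cylSet T n₀ ω i :=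
  mem_xiElt_self hd h

variable {X ι : Type*} {F : X → X} {R : X → ℕ} {hR : ∀ x, 0 < R x} {ω : ι → Set X} {n₀ : ℕ}

open Classical in
/-- The proportion of the density that is coupled at the `k`-th simultaneous return: `e_k / 2` if
both coordinates come from a common element of the partition of the tower, so that the element of
`⋁_{j<k} T̃^{-j} ξ̃` is mapped onto a square, and zero otherwise. -/
noncomputable def couplingWeight (T : Tower R → Tower R) (n₀ : ℕ) (ω : ι → Set X) (e : ℕ → ℝ)
    (k : ℕ) (u : Tower R × Tower R) : ℝ :=
  if lastSame T n₀ ω ((indMap T n₀)^[k - 1] u) then e k / 2 else 0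

/-- The density of the mass that has not been coupled at the first `i` simultaneous returns. -/
noncomputable def couplingDensity (T : Tower R → Tower R) (n₀ : ℕ) (ω : ι → Set X) (J : X → ℝ)
    (e : ℕ → ℝ) (Φ : Tower R × Tower R → ℝ) : ℕ → Tower R × Tower R → ℝ :=
  partialDensity T n₀ ω J (couplingWeight T n₀ ω e) Φ

lemma couplingWeight_eq_of_mem (hn : 0 < n₀) (hd : Pairwise fun i j => Disjoint (ω i) (ω j))
    {T : Tower R → Tower R} {e : ℕ → ℝ} {k : ℕ} (hk : 1 ≤ k) {u v : Tower R × Tower R}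
    (hv : v ∈ xiElt T n₀ ω k u) :
    couplingWeight T n₀ ω e k v = couplingWeight T n₀ ω e k u := by
  have h := hv (k - 1) (by omega)
  have h' : lastSame T n₀ ω ((indMap T n₀)^[k - 1] v) ↔
      lastSame T n₀ ω ((indMap T n₀)^[k - 1] u) :=
    ⟨h.symm.lastSame_imp hn hd, h.lastSame_imp hn hd⟩
  unfold couplingWeight
  by_cases hu : lastSame T n₀ ω ((indMap T n₀)^[k - 1] u)
  · rw [if_pos hu, if_pos (h'.2 hu)]
  · rw [if_neg hu, if_neg (fun hv => hu (h'.1 hv))]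

lemma isWeight_couplingWeight (hn : 0 < n₀) (hd : Pairwise fun i j => Disjoint (ω i) (ω j))
    {T : Tower R → Tower R} {e : ℕ → ℝ} (he0 : ∀ k ≥ 1, 0 ≤ e k) (he : ∀ k ≥ 1, e k ≤ 1 / 2) :
    IsWeight T n₀ ω e (couplingWeight T n₀ ω e) where
  nonneg k hk u := by
    have := he0 k hk
    unfold couplingWeight
    split_ifs <;> linarith
  le k hk u := by
    have := he0 k hk
    unfold couplingWeight
    split_ifs <;> linarith
  le_half := he
  const k hk u v hv := couplingWeight_eq_of_mem hn hd hk hv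

/-- The event that the `(k+1)`-st waiting time lies in a given set. -/
def waitSet (T : Tower R → Tower R) (n₀ k : ℕ) (V : Set ℕ∞) : Set (Tower R × Tower R) :=
  {u | simRet T n₀ ((indMap T n₀)^[k] u) ∈ V}

/-- Each element of `⋁_{j<j₀} T̃^{-j} ξ̃` is contained in `H` or disjoint from it. -/
def Saturated (T : Tower R → Tower R) (n₀ : ℕ) (ω : ι → Set X) (j₀ : ℕ)
    (H : Set (Tower R × Tower R)) : Prop :=
  ∀ u v, v ∈ xiElt T n₀ ω j₀ u → (u ∈ H ↔ v ∈ H)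

lemma saturated_waitSet {T : Tower R → Tower R} (k : ℕ) (V : Set ℕ∞) :
    Saturated T n₀ ω (k + 1) (waitSet T n₀ k V) := by
  intro u v hv
  have := (hv k (Nat.lt_succ_self k)).2.1
  simp only [waitSet, mem_ofPred_eq, this]

end CouplingDensity

section Decay

variable {X ι : Type*} [MeasurableSpace X] {m : Measure X} {F : X → X} {R : X → ℕ}
  {hR : ∀ x, 0 < R x} {ω : ι → Set X} {J : X → ℝ} {β : ℝ} {n₀ : ℕ} {e : ℕ → ℝ}
  {Φ : Tower R × Tower R → ℝ}

/-- The standing assumptions on the density `Φ` and the sequence `e`: positivity on the elements,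
and the bound `D` for the oscillation of the normalised densities. -/
structure IsRegular (T : Tower R → Tower R) (n₀ : ℕ) (ω : ι → Set X) (J : X → ℝ) (e : ℕ → ℝ)
    (Φ : Tower R × Tower R → ℝ) (D : ℝ) : Prop where
  measurable : Measurable Φ
  pos : ∀ u ∈ cylSet T n₀ ω 1, 0 < Φ u
  nonneg_weight : ∀ k ≥ 1, 0 ≤ e k
  weight_le : ∀ k ≥ 1, e k ≤ 1 / 2
  one_le : 1 ≤ D
  ratio : ∀ k, ∀ u v, v ∈ xiElt T n₀ ω (k + 1) u →
    couplingDensity T n₀ ω J e Φ k u / indJac T n₀ J (k + 1) u ≤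
      D * (couplingDensity T n₀ ω J e Φ k v / indJac T n₀ J (k + 1) v)

variable {D : ℝ}

lemma IsRegular.bounds (hn : 0 < n₀) (hF : IsWGM m F ω J β)
    (h : IsRegular (towerMap F R hR) n₀ ω J e Φ D) {u : Tower R × Tower R}
    (hu : u ∈ cylSet (towerMap F R hR) n₀ ω 1) (k : ℕ) :
    0 < couplingDensity (towerMap F R hR) n₀ ω J e Φ k u ∧
    couplingDensity (towerMap F R hR) n₀ ω J e Φ (k + 1) u ≤
      couplingDensity (towerMap F R hR) n₀ ω J e Φ k u ∧
    1 / 2 * couplingDensity (towerMap F R hR) n₀ ω J e Φ k u ≤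
      couplingDensity (towerMap F R hR) n₀ ω J e Φ (k + 1) u := by
  have := partialDensity_pos_and_bounds hF.disjoint hF.jac_pos
    (isWeight_couplingWeight hn hF.disjoint h.nonneg_weight h.weight_le) h.pos k
  exact ⟨this.1 u hu, this.2 u hu⟩

lemma IsRegular.bounds_add (hn : 0 < n₀) (hF : IsWGM m F ω J β)
    (h : IsRegular (towerMap F R hR) n₀ ω J e Φ D) {u : Tower R × Tower R}
    (hu : u ∈ cylSet (towerMap F R hR) n₀ ω 1) (i k : ℕ) :
    couplingDensity (towerMap F R hR) n₀ ω J e Φ (i + k) u ≤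
      couplingDensity (towerMap F R hR) n₀ ω J e Φ i u ∧
    (1 / 2) ^ k * couplingDensity (towerMap F R hR) n₀ ω J e Φ i u ≤
      couplingDensity (towerMap F R hR) n₀ ω J e Φ (i + k) u := by
  induction k with
  | zero => simp
  | succ k ih =>
    obtain ⟨-, h1, h2⟩ := h.bounds hn hF hu (i + k)
    refine ⟨h1.trans ih.1, ?_⟩
    rw [pow_succ]
    rw [← add_assoc]
    linarith [ih.2]

/-- The densities after the `k`-th step are as regular as before, up to a factor of two. -/
lemma IsRegular.ratio_self (hn : 0 < n₀) (hF : IsWGM m F ω J β)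
    (h : IsRegular (towerMap F R hR) n₀ ω J e Φ D) {i : ℕ} (hi : 1 ≤ i) {u v : Tower R × Tower R}
    (hv : v ∈ xiElt (towerMap F R hR) n₀ ω i u) :
    couplingDensity (towerMap F R hR) n₀ ω J e Φ i u / indJac (towerMap F R hR) n₀ J i u ≤
      2 * D * (couplingDensity (towerMap F R hR) n₀ ω J e Φ i v /
        indJac (towerMap F R hR) n₀ J i v) := by
  obtain ⟨k, rfl⟩ := Nat.exists_eq_add_of_le' hi
  have hu : u ∈ cylSet (towerMap F R hR) n₀ ω (k + 1) := mem_cylSet_of_mem_xiElt hF.disjoint hv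
  have hv' : v ∈ cylSet (towerMap F R hR) n₀ ω (k + 1) :=
    mem_cylSet_of_mem_xiElt hF.disjoint (mem_xiElt_comm hv)
  have hu1 : u ∈ cylSet (towerMap F R hR) n₀ ω 1 := cylSet_anti hi hu
  have hv1 : v ∈ cylSet (towerMap F R hR) n₀ ω 1 := cylSet_anti hi hv'
  have h1 := (h.bounds hn hF hu1 k).2.1
  have h2 := (h.bounds hn hF hv1 k).2.2
  have h3 := h.ratio k u v hv
  have hJu := indJac_pos hF.jac_pos (towerMap F R hR) n₀ (k + 1) u
  have hJv := indJac_pos hF.jac_pos (towerMap F R hR) n₀ (k + 1) v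
  have hD := h.one_le
  exact ratio_le_two_mul hJu hJv h1 h2 h3 (by linarith)

/-- On the elements, the coupling at a later return in the good set removes a fixed proportion. -/
lemma IsRegular.good_le (hn : 0 < n₀) (hF : IsWGM m F ω J β)
    (h : IsRegular (towerMap F R hR) n₀ ω J e Φ D) {i q : ℕ} (hi : 1 ≤ i) (hq : 1 ≤ q)
    {u : Tower R × Tower R} (hu : u ∈ cylSet (towerMap F R hR) n₀ ω i)
    (hg : (indMap (towerMap F R hR) n₀)^[i] u ∈ goodSet (towerMap F R hR) n₀ ω q) :
    couplingDensity (towerMap F R hR) n₀ ω J e Φ (i + q) u ≤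
      (1 - (1 / 2) ^ q / (2 * D) * e (i + q)) *
        couplingDensity (towerMap F R hR) n₀ ω J e Φ i u := by
  obtain ⟨k, rfl⟩ := Nat.exists_eq_add_of_le' hq
  obtain ⟨hg1, hg2⟩ := hg
  have hcyl : u ∈ xiElt (towerMap F R hR) n₀ ω (i + k + 1) u := by
    rw [add_assoc]
    exact mem_xiElt_add.2 ⟨hu, hg1⟩
  have hu1 := cylSet_anti hi hu
  obtain ⟨h1, h2⟩ := h.bounds_add hn hF hu1 i k
  have h3 := partialDensity_succ_le hF.jac_pos (lt_of_lt_of_le one_pos h.one_le)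
    ((isWeight_couplingWeight hn hF.disjoint h.nonneg_weight h.weight_le).nonneg (i + k + 1)
      (by omega) u) hcyl (h.ratio (i + k) u)
  have h4 : couplingWeight (towerMap F R hR) n₀ ω e (i + k + 1) u = e (i + k + 1) / 2 := by
    rw [couplingWeight, if_pos]
    have : i + k + 1 - 1 = k + i := by omega
    rw [this, Function.iterate_add_apply]
    exact hg2
  rw [h4] at h3
  have he := h.nonneg_weight (i + k + 1) (by omega)
  have hpos := (h.bounds hn hF hu1 i).1
  have hD := h.one_le
  have h5 : e (i + k + 1) / 2 / D * ((1 / 2) ^ (k + 1) *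
      couplingDensity (towerMap F R hR) n₀ ω J e Φ i u) ≤ e (i + k + 1) / 2 / D *
      couplingDensity (towerMap F R hR) n₀ ω J e Φ (i + k) u := by
    refine mul_le_mul_of_nonneg_left (le_trans ?_ h2) (by positivity)
    refine mul_le_mul_of_nonneg_right ?_ hpos.le
    exact pow_le_pow_of_le_one (by norm_num) (by norm_num) (Nat.le_succ k)
  change couplingDensity (towerMap F R hR) n₀ ω J e Φ (i + k + 1) u ≤ _
  have h6 : couplingDensity (towerMap F R hR) n₀ ω J e Φ (i + k + 1) u ≤
      couplingDensity (towerMap F R hR) n₀ ω J e Φ (i + k) u - e (i + k + 1) / 2 / D *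
        couplingDensity (towerMap F R hR) n₀ ω J e Φ (i + k) u := by
    refine h3.trans (le_of_eq ?_)
    change _ * couplingDensity (towerMap F R hR) n₀ ω J e Φ (i + k) u = _
    ring
  calc _ ≤ couplingDensity (towerMap F R hR) n₀ ω J e Φ i u - e (i + k + 1) / 2 / D *
        ((1 / 2) ^ (k + 1) * couplingDensity (towerMap F R hR) n₀ ω J e Φ i u) := by linarith
    _ = _ := by rw [← add_assoc]; field_simp

/-- The image of an element is the product of two images of elements of the base. -/
lemma IsAdm.wordImage_eq (hRt : IsReturnTime R ω) {i : ℕ}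
    (hi : 1 ≤ i) {w : List (ι × ℕ) × List (ι × ℕ)} (h : IsAdm (towerMap F R hR) n₀ ω i w)
    (hw₁ : w.1 ≠ []) (hw₂ : w.2 ≠ []) :
    ∃ a b, wordImage (towerMap F R hR) ω w.1 hw₁ = {p | p.1.2 = 0 ∧ p.1.1 ∈ F '' ω a} ∧
      wordImage (towerMap F R hR) ω w.2 hw₂ = {p | p.1.2 = 0 ∧ p.1.1 ∈ F '' ω b} := by
  obtain ⟨hl, u, hu, hcyl, hS⟩ := h
  obtain ⟨k, rfl⟩ := Nat.exists_eq_add_of_le' hi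
  have hb := iterate_simRet_mem_base (hcyl k (Nat.lt_succ_self k)).1
  have hb1 : (towerMap F R hR)^[w.1.length] u.1 ∈ base R := by
    have h1 : ((indMap (towerMap F R hR) n₀)^[k] u).1 =
        (towerMap F R hR)^[stopTime (towerMap F R hR) n₀ k u] u.1 := by rw [indMap_iterate]
    have := hb.1
    rw [h1, ← Function.iterate_add_apply, add_comm, ← stopTime_succ, hS] at this
    exact this
  have hb2 : (towerMap F R hR)^[w.2.length] u.2 ∈ base R := by
    have h1 : ((indMap (towerMap F R hR) n₀)^[k] u).2 =
        (towerMap F R hR)^[stopTime (towerMap F R hR) n₀ k u] u.2 := by rw [indMap_iterate]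
    have := hb.2
    rw [h1, ← Function.iterate_add_apply, add_comm, ← stopTime_succ, hS, hl] at this
    exact this
  have key : ∀ (w : List (ι × ℕ)) (hw : w ≠ []) (p : Tower R),
      p ∈ wordCyl (towerMap F R hR) ω w → (towerMap F R hR)^[w.length] p ∈ base R →
      wordImage (towerMap F R hR) ω w hw =
        {p | p.1.2 = 0 ∧ p.1.1 ∈ F '' ω (w.getLast hw).1} := by
    intro w hw p hp hbp
    have h1 := iterate_mem_towerElt_getLast w hw hp
    have h2 : w.length = (w.length - 1) + 1 := by
      have := List.length_pos_iff.2 hw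
      omega
    rw [h2, Function.iterate_succ_apply', towerMap_mem_base_iff] at hbp
    refine image_towerElt_of_eq hRt h1.2 ?_
    have h3 := ((towerMap F R hR)^[w.length - 1] p).2
    rw [h1.1] at hbp h3
    omega
  exact ⟨_, _, key w.1 hw₁ u.1 hu.1 hb1, key w.2 hw₂ u.2 hu.2 hb2⟩

variable [Countable ι]

lemma measurable_couplingDensity (hF : IsWGM m F ω J β) (hRt : IsReturnTime R ω) (hn : 0 < n₀)
    (hΦ : Measurable Φ) (i : ℕ) :
    Measurable (couplingDensity (towerMap F R hR) n₀ ω J e Φ i) := by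
  refine measurable_partialDensity hF hRt hn (fun k _ => ?_) hΦ i
  have hT : Measurable (towerMap F R hR) := measurable_towerMap hRt.measurable hF.measurable_map
  exact Measurable.ite ((measurable_indMap hT).iterate (k - 1)
    (measurableSet_lastSame hF hRt)) measurable_const measurable_const

variable [IsFiniteMeasure m] [IsFiniteMeasure (towerMeasure m R)]

/-- Conditionally on an element of `⋁_{j<i} T̃^{-j} ξ̃`, a fixed proportion of the mass takes part
in the coupling at the `(i+q)`-th return. -/
lemma IsRegular.pairCyl_decay (hn : 0 < n₀) (hF : IsWGM m F ω J β) (hRt : IsReturnTime R ω)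
    (h : IsRegular (towerMap F R hR) n₀ ω J e Φ D) {q : ℕ} (hq : 1 ≤ q) {κ : ℝ} (hκ0 : 0 ≤ κ)
    (hκ1 : κ ≤ 1)
    (hκ : ∀ a b, ENNReal.ofReal κ * (ENNReal.ofReal (2 * D) ^ 2 *
      ((towerMeasure m R).prod (towerMeasure m R)) univ) ≤
      ((towerMeasure m R).prod (towerMeasure m R)) (goodSet (towerMap F R hR) n₀ ω q ∩
        {p : Tower R | p.1.2 = 0 ∧ p.1.1 ∈ F '' ω a} ×ˢ
        {p : Tower R | p.1.2 = 0 ∧ p.1.1 ∈ F '' ω b}))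
    (hμ0 : ((towerMeasure m R).prod (towerMeasure m R)) univ ≠ 0)
    (hfin : ∫⁻ u, ENNReal.ofReal (Φ u) ∂((towerMeasure m R).prod (towerMeasure m R)) ≠ ⊤)
    {i : ℕ} (hi : 1 ≤ i) {w : List (ι × ℕ) × List (ι × ℕ)}
    (hw : IsAdm (towerMap F R hR) n₀ ω i w) :
    ∫⁻ u in pairCyl (towerMap F R hR) ω w, (cylSet (towerMap F R hR) n₀ ω (i + q)).indicator
        (fun u => ENNReal.ofReal (couplingDensity (towerMap F R hR) n₀ ω J e Φ (i + q) u)) u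
        ∂((towerMeasure m R).prod (towerMeasure m R)) ≤
      (1 - ENNReal.ofReal ((1 / 2) ^ q / (2 * D) * κ * e (i + q))) *
      ∫⁻ u in pairCyl (towerMap F R hR) ω w,
        ENNReal.ofReal (couplingDensity (towerMap F R hR) n₀ ω J e Φ i u)
        ∂((towerMeasure m R).prod (towerMeasure m R)) := by
  set T := towerMap F R hR with hTdef
  set μ₂ := (towerMeasure m R).prod (towerMeasure m R) with hμ₂
  set ψ := couplingDensity T n₀ ω J e Φ with hψ
  have hT : Measurable T := measurable_towerMap hRt.measurable hF.measurable_map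
  have hZm : MeasurableSet (pairCyl T ω w) := measurableSet_pairCyl hF.measurableSet_elt hT w
  have hψm : ∀ k, Measurable fun u => ENNReal.ofReal (ψ k u) := fun k =>
    (measurable_couplingDensity hF hRt hn h.measurable k).ennreal_ofReal
  have hgm : MeasurableSet (goodSet T n₀ ω q) :=
    (measurableSet_cylSet hF hRt hn q).inter ((measurable_indMap hT).iterate (q - 1)
      (measurableSet_lastSame hF hRt))
  have hmem : ∀ u ∈ pairCyl T ω w, u ∈ cylSet T n₀ ω i := fun u hu =>
    (hw.xiElt_eq hn hF.disjoint hRt.const hu).2.1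
  have hmem1 : ∀ u ∈ pairCyl T ω w, u ∈ cylSet T n₀ ω 1 := fun u hu => cylSet_anti hi (hmem u hu)
  obtain ⟨hw₁, hw₂⟩ := hw.ne_nil hn hi
  obtain ⟨a, b, ha, hb⟩ := hw.wordImage_eq hRt hi hw₁ hw₂
  have hD := h.one_le
  have he := h.nonneg_weight (i + q) (by omega)
  have he2 := h.weight_le (i + q) (by omega)
  set G := ∫⁻ u in pairCyl T ω w, ((indMap T n₀)^[i] ⁻¹' goodSet T n₀ ω q).indicator
    (fun u => ENNReal.ofReal (ψ i u)) u ∂μ₂ with hG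
  set Y := ∫⁻ u in pairCyl T ω w, ENNReal.ofReal (ψ i u) ∂μ₂ with hY
  have hcomp := mass_compare hF hRt hn hw₁ hw₂ hw (ψ := ψ i) (D := 2 * D) (by linarith)
    (fun u hu => (h.bounds hn hF (hmem1 u hu) i).1.le)
    (fun u hu v hv => h.ratio_self hn hF hi
      (by rw [(hw.xiElt_eq hn hF.disjoint hRt.const hu).1]; exact hv))
    (E := univ) (E' := goodSet T n₀ ω q) MeasurableSet.univ hgm
  simp only [preimage_univ, indicator_univ] at hcomp
  rw [ha, hb] at hcomp
  -- the good set carries a proportion `κ` of the mass of the element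
  have hκG : ENNReal.ofReal κ * Y ≤ G := by
    set M := ENNReal.ofReal (2 * D) ^ 2 * μ₂ univ with hM
    have hM0 : M ≠ 0 := mul_ne_zero (pow_ne_zero _ (by simp; linarith)) hμ0
    have hMt : M ≠ ⊤ := ENNReal.mul_ne_top (ENNReal.pow_ne_top ENNReal.ofReal_ne_top)
      (measure_ne_top _ _)
    have h1 : Y * (ENNReal.ofReal κ * M) ≤ M * G := by
      calc Y * (ENNReal.ofReal κ * M) ≤ _ := mul_le_mul_right (hκ a b) Y
        _ ≤ _ := hcomp
        _ ≤ M * G := by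
          rw [hM]
          gcongr
          exact subset_univ _
    rw [← ENNReal.mul_le_mul_iff_right hM0 hMt]
    calc M * (ENNReal.ofReal κ * Y) = Y * (ENNReal.ofReal κ * M) := by ring
      _ ≤ _ := h1
  have hYfin : Y ≠ ⊤ := by
    refine ne_top_of_le_ne_top hfin ?_
    calc Y ≤ ∫⁻ u in pairCyl T ω w, ENNReal.ofReal (Φ u) ∂μ₂ := by
          refine setLIntegral_mono' hZm fun u hu => ENNReal.ofReal_le_ofReal ?_
          have := (h.bounds_add hn hF (hmem1 u hu) 0 i).1
          rw [zero_add] at this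
          exact this
      _ ≤ _ := setLIntegral_le_lintegral _ _
  set x := (1 / 2 : ℝ) ^ q / (2 * D) with hx
  have hx0 : 0 ≤ x := by positivity
  have hx1 : x ≤ 1 := by
    rw [hx, div_le_one (by linarith)]
    have : (1 / 2 : ℝ) ^ q ≤ 1 := pow_le_one₀ (by norm_num) (by norm_num)
    linarith
  refine le_one_sub_mul hYfin ?_ ?_
  · rw [← ENNReal.ofReal_one]
    refine ENNReal.ofReal_le_ofReal ?_
    have h1 : x * κ ≤ 1 := mul_le_one₀ hx1 hκ0 hκ1
    have h2 : x * κ * e (i + q) ≤ 1 * (1 / 2) := mul_le_mul h1 he2 he zero_le_one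
    linarith
  · calc _ ≤ (∫⁻ u in pairCyl T ω w, (cylSet T n₀ ω (i + q)).indicator
            (fun u => ENNReal.ofReal (ψ (i + q) u)) u ∂μ₂) +
            ENNReal.ofReal (x * e (i + q)) * G := by
          refine add_le_add le_rfl ?_
          calc ENNReal.ofReal (x * κ * e (i + q)) * Y
              = ENNReal.ofReal (x * e (i + q)) * (ENNReal.ofReal κ * Y) := by
                rw [← mul_assoc, ← ENNReal.ofReal_mul (by positivity)]
                ring_nf
            _ ≤ _ := by gcongr
      _ = ∫⁻ u in pairCyl T ω w, ((cylSet T n₀ ω (i + q)).indicator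
            (fun u => ENNReal.ofReal (ψ (i + q) u)) u + ENNReal.ofReal (x * e (i + q)) *
            ((indMap T n₀)^[i] ⁻¹' goodSet T n₀ ω q).indicator
              (fun u => ENNReal.ofReal (ψ i u)) u) ∂μ₂ := by
          rw [lintegral_add_left ((hψm _).indicator (measurableSet_cylSet hF hRt hn _)),
            lintegral_const_mul' _ _ ENNReal.ofReal_ne_top]
      _ ≤ Y := by
          refine setLIntegral_mono' hZm fun u hu => ?_
          have hpos := (h.bounds hn hF (hmem1 u hu) i).1
          by_cases hug : (indMap T n₀)^[i] u ∈ goodSet T n₀ ω q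
          · have hcyl : u ∈ cylSet T n₀ ω (i + q) := mem_xiElt_add.2 ⟨hmem u hu, hug.1⟩
            rw [indicator_of_mem hcyl, indicator_of_mem (by exact hug),
              ← ENNReal.ofReal_mul (by positivity), ← ENNReal.ofReal_add
              (h.bounds hn hF (hmem1 u hu) _).1.le (by positivity)]
            refine ENNReal.ofReal_le_ofReal ?_
            have := h.good_le hn hF hi hq (hmem u hu) hug
            linarith
          · rw [indicator_of_notMem (by exact hug : u ∉ (indMap T n₀)^[i] ⁻¹' _), mul_zero,
              add_zero]
            refine (indicator_le_self _ _ u).trans (ENNReal.ofReal_le_ofReal ?_)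
            exact (h.bounds_add hn hF (hmem1 u hu) i q).1

end Decay
/-! ### The mass that survives many returns -/

section Survival

variable {X ι : Type*} {F : X → X} {R : X → ℕ} {hR : ∀ x, 0 < R x} {ω : ι → Set X} {J : X → ℝ}
  {β : ℝ} {n₀ : ℕ} {e : ℕ → ℝ} {Φ : Tower R × Tower R → ℝ} {D : ℝ}

lemma Saturated.mono {T : Tower R → Tower R} {H : Set (Tower R × Tower R)} {i j : ℕ}
    (h : Saturated T n₀ ω i H) (hij : i ≤ j) : Saturated T n₀ ω j H :=
  fun u v hv => h u v (xiElt_anti hij u hv)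

/-- If `b_j ≥ 1/2`, the product over a set of indices exceeds the product over a larger one by at
most a power of two. -/
lemma prod_le_pow_mul_prod {b : ℕ → ℝ≥0∞} (hb : ∀ j, 2⁻¹ ≤ b j) {s t : Finset ℕ} (hst : s ⊆ t) :
    ∏ j ∈ s, b j ≤ 2 ^ (t \ s).card * ∏ j ∈ t, b j := by
  rw [← Finset.prod_sdiff hst, ← mul_assoc]
  have : (1 : ℝ≥0∞) ≤ 2 ^ (t \ s).card * ∏ j ∈ t \ s, b j := by
    rw [← Finset.prod_const, ← Finset.prod_mul_distrib]
    refine Finset.one_le_prod' fun j _ => ?_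
    rw [← ENNReal.mul_inv_cancel two_ne_zero ENNReal.ofNat_ne_top]
    gcongr
    exact hb j
  calc ∏ j ∈ s, b j = 1 * ∏ j ∈ s, b j := (one_mul _).symm
    _ ≤ _ := by gcongr

lemma one_sub_ofReal_le_pow {x c δ : ℝ} {q : ℕ} (hx : 0 ≤ x) (hx1 : x ≤ 1) (hδ : δ ≤ 1)
    (hc : q * δ ≤ c) (hδ0 : 0 ≤ δ) :
    1 - ENNReal.ofReal (c * x) ≤ ENNReal.ofReal (1 - δ * x) ^ q := by
  have h1 : δ * x ≤ 1 := mul_le_one₀ hδ hx hx1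
  have hc0 : 0 ≤ c := le_trans (by positivity) hc
  rw [← ENNReal.ofReal_pow (by linarith), ← ENNReal.ofReal_one,
    ← ENNReal.ofReal_sub _ (by positivity)]
  refine ENNReal.ofReal_le_ofReal ?_
  have h2 := one_add_mul_le_pow (a := -(δ * x)) (by linarith) q
  have h3 := mul_le_mul_of_nonneg_right hc hx
  rw [← sub_eq_add_neg] at h2
  linarith

variable [MeasurableSpace X] {m : Measure X}

/-- The mass in `H` that has returned `i` times and has not been coupled. -/
noncomputable def uncoupledMass (m : Measure X) (T : Tower R → Tower R) (n₀ : ℕ) (ω : ι → Set X)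
    (J : X → ℝ) (e : ℕ → ℝ) (Φ : Tower R × Tower R → ℝ) (H : Set (Tower R × Tower R)) (i : ℕ) :
    ℝ≥0∞ :=
  ∫⁻ u in cylSet T n₀ ω i, H.indicator
    (fun u => ENNReal.ofReal (couplingDensity T n₀ ω J e Φ i u)) u
    ∂((towerMeasure m R).prod (towerMeasure m R))

variable [Countable ι]

lemma IsRegular.uncoupledMass_succ_le (hn : 0 < n₀) (hF : IsWGM m F ω J β)
    (hRt : IsReturnTime R ω) (h : IsRegular (towerMap F R hR) n₀ ω J e Φ D)
    (H : Set (Tower R × Tower R)) (i : ℕ) :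
    uncoupledMass m (towerMap F R hR) n₀ ω J e Φ H (i + 1) ≤
      uncoupledMass m (towerMap F R hR) n₀ ω J e Φ H i := by
  refine (setLIntegral_mono' (measurableSet_cylSet hF hRt hn _) fun u hu => ?_).trans
    (lintegral_mono_set (cylSet_anti (Nat.le_succ i)))
  refine indicator_le_indicator (ENNReal.ofReal_le_ofReal ?_)
  exact (h.bounds hn hF (cylSet_anti (Nat.le_add_left 1 i) hu) i).2.1

variable [IsFiniteMeasure m] [IsFiniteMeasure (towerMeasure m R)]

lemma IsRegular.uncoupledMass_add_le (hn : 0 < n₀) (hF : IsWGM m F ω J β)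
    (hRt : IsReturnTime R ω)
    (h : IsRegular (towerMap F R hR) n₀ ω J e Φ D) {q : ℕ} (hq : 1 ≤ q) {κ : ℝ} (hκ0 : 0 ≤ κ)
    (hκ1 : κ ≤ 1)
    (hκ : ∀ a b, ENNReal.ofReal κ * (ENNReal.ofReal (2 * D) ^ 2 *
      ((towerMeasure m R).prod (towerMeasure m R)) univ) ≤
      ((towerMeasure m R).prod (towerMeasure m R)) (goodSet (towerMap F R hR) n₀ ω q ∩
        {p : Tower R | p.1.2 = 0 ∧ p.1.1 ∈ F '' ω a} ×ˢ
        {p : Tower R | p.1.2 = 0 ∧ p.1.1 ∈ F '' ω b}))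
    (hμ0 : ((towerMeasure m R).prod (towerMeasure m R)) univ ≠ 0)
    (hfin : ∫⁻ u, ENNReal.ofReal (Φ u) ∂((towerMeasure m R).prod (towerMeasure m R)) ≠ ⊤)
    {H : Set (Tower R × Tower R)} {i : ℕ} (hi : 1 ≤ i)
    (hH : Saturated (towerMap F R hR) n₀ ω i H) :
    uncoupledMass m (towerMap F R hR) n₀ ω J e Φ H (i + q) ≤
      (1 - ENNReal.ofReal ((1 / 2) ^ q / (2 * D) * κ * e (i + q))) *
        uncoupledMass m (towerMap F R hR) n₀ ω J e Φ H i := by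
  have hm := fun k => measurableSet_cylSet (hR := hR) (n₀ := n₀) hF hRt hn k
  have hne : (1 - ENNReal.ofReal ((1 / 2) ^ q / (2 * D) * κ * e (i + q))) ≠ ⊤ :=
    ne_top_of_le_ne_top ENNReal.one_ne_top tsub_le_self
  have hZm : ∀ w, MeasurableSet (pairCyl (towerMap F R hR) ω w) := fun w =>
    measurableSet_pairCyl hF.measurableSet_elt
      (measurable_towerMap hRt.measurable hF.measurable_map) w
  unfold uncoupledMass
  rw [← lintegral_const_mul' _ _ hne]
  have h1 : ∀ f : Tower R × Tower R → ℝ≥0∞, ∫⁻ u in cylSet (towerMap F R hR) n₀ ω (i + q), f u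
      ∂((towerMeasure m R).prod (towerMeasure m R)) =
      ∫⁻ u in cylSet (towerMap F R hR) n₀ ω i,
        (cylSet (towerMap F R hR) n₀ ω (i + q)).indicator f u
        ∂((towerMeasure m R).prod (towerMeasure m R)) := by
    intro f
    rw [lintegral_indicator (hm _), Measure.restrict_restrict (hm _),
      inter_eq_self_of_subset_left (cylSet_anti (Nat.le_add_right i q))]
  rw [h1]
  refine setLIntegral_cylSet_le hF hRt hn i _ fun w hw => ?_
  rw [lintegral_const_mul' _ _ hne]
  by_cases hne : (pairCyl (towerMap F R hR) ω w ∩ H).Nonempty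
  · obtain ⟨v, hv, hvH⟩ := hne
    have hsub : pairCyl (towerMap F R hR) ω w ⊆ H := by
      intro u hu
      rw [← (hw.xiElt_eq hn hF.disjoint hRt.const hv).1] at hu
      exact (hH v u hu).1 hvH
    have key := h.pairCyl_decay hn hF hRt hq hκ0 hκ1 hκ hμ0 hfin hi hw
    refine le_trans (le_of_eq ?_) (key.trans (le_of_eq ?_))
    · refine setLIntegral_congr_fun (hZm w) fun u hu => ?_
      simp only [indicator, hsub hu, if_true]
    · congr 1
      refine setLIntegral_congr_fun (hZm w) fun u hu => ?_
      simp only [indicator, hsub hu, if_true]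
  · rw [setLIntegral_congr_fun (g := fun _ => 0) (hZm w), lintegral_zero]
    · exact zero_le
    · intro u hu
      have : u ∉ H := fun h => hne ⟨u, hu, h⟩
      simp only [indicator, this, if_false, ite_self]

/-- The mass surviving in a saturated set decays like the product of the `1 - δ e_j`. -/
lemma IsRegular.uncoupledMass_le_prod (hn : 0 < n₀) (hF : IsWGM m F ω J β)
    (hRt : IsReturnTime R ω)
    (h : IsRegular (towerMap F R hR) n₀ ω J e Φ D) {q : ℕ} (hq : 1 ≤ q) {κ : ℝ} (hκ0 : 0 ≤ κ)
    (hκ1 : κ ≤ 1)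
    (hκ : ∀ a b, ENNReal.ofReal κ * (ENNReal.ofReal (2 * D) ^ 2 *
      ((towerMeasure m R).prod (towerMeasure m R)) univ) ≤
      ((towerMeasure m R).prod (towerMeasure m R)) (goodSet (towerMap F R hR) n₀ ω q ∩
        {p : Tower R | p.1.2 = 0 ∧ p.1.1 ∈ F '' ω a} ×ˢ
        {p : Tower R | p.1.2 = 0 ∧ p.1.1 ∈ F '' ω b}))
    (hμ0 : ((towerMeasure m R).prod (towerMeasure m R)) univ ≠ 0)
    (hfin : ∫⁻ u, ENNReal.ofReal (Φ u) ∂((towerMeasure m R).prod (towerMeasure m R)) ≠ ⊤)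
    {δ : ℝ} (hδ0 : 0 ≤ δ) (hδ1 : δ ≤ 1) (hδ : q * δ ≤ (1 / 2) ^ q / (2 * D) * κ)
    {b : ℕ → ℝ≥0∞} (hb : ∀ j, 2⁻¹ ≤ b j) (hbe : ∀ j ≥ 1, b j = ENNReal.ofReal (1 - δ * e j))
    {H : Set (Tower R × Tower R)} {j₀ i : ℕ} (hj₀ : 1 ≤ j₀)
    (hH : Saturated (towerMap F R hR) n₀ ω j₀ H) (hi : j₀ ≤ i) :
    uncoupledMass m (towerMap F R hR) n₀ ω J e Φ H i ≤
      2 ^ q * (∏ j ∈ Finset.Ico (j₀ + 1) (i + 1), b j) *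
        uncoupledMass m (towerMap F R hR) n₀ ω J e Φ H j₀ := by
  refine le_prod_of_window_contraction hq hb
    (fun j _ => h.uncoupledMass_succ_le hn hF hRt H j) (fun j hj => ?_) hi
  refine (h.uncoupledMass_add_le hn hF hRt hq hκ0 hκ1 hκ hμ0 hfin (hj₀.trans hj)
    (hH.mono hj)).trans ?_
  gcongr
  rw [hbe _ (by omega)]
  have := h.weight_le (j + q) (by omega)
  exact one_sub_ofReal_le_pow (h.nonneg_weight _ (by omega)) (by linarith) hδ1 hδ hδ0

/-- At every return the next waiting time is, up to a constant, distributed as under the reference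
measure. -/
lemma IsRegular.uncoupledMass_waitSet_le (hn : 0 < n₀) (hF : IsWGM m F ω J β)
    (hRt : IsReturnTime R ω) (h : IsRegular (towerMap F R hR) n₀ ω J e Φ D) {d : ℝ≥0∞} (hd0 : d ≠ 0)
    (hd : ∀ a b, d ≤ ((towerMeasure m R).prod (towerMeasure m R))
        ({p : Tower R | p.1.2 = 0 ∧ p.1.1 ∈ F '' ω a} ×ˢ
        {p : Tower R | p.1.2 = 0 ∧ p.1.1 ∈ F '' ω b})) (V : Set ℕ∞) {k : ℕ} (hk : 1 ≤ k) :
    uncoupledMass m (towerMap F R hR) n₀ ω J e Φ (waitSet (towerMap F R hR) n₀ k V) k ≤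
      ENNReal.ofReal (2 * D) ^ 2 * d⁻¹ * ((towerMeasure m R).prod (towerMeasure m R))
        {u | simRet (towerMap F R hR) n₀ u ∈ V} *
        uncoupledMass m (towerMap F R hR) n₀ ω J e Φ univ k := by
  have hT : Measurable (towerMap F R hR) := measurable_towerMap hRt.measurable hF.measurable_map
  have hE : MeasurableSet {u | simRet (towerMap F R hR) n₀ u ∈ V} :=
    measurable_simRet hT (MeasurableSet.of_discrete)
  have hne : ENNReal.ofReal (2 * D) ^ 2 * d⁻¹ * ((towerMeasure m R).prod (towerMeasure m R))
        {u | simRet (towerMap F R hR) n₀ u ∈ V} ≠ ⊤ := by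
    refine ENNReal.mul_ne_top (ENNReal.mul_ne_top (ENNReal.pow_ne_top ENNReal.ofReal_ne_top) ?_)
      (measure_ne_top _ _)
    exact ENNReal.inv_ne_top.2 hd0
  unfold uncoupledMass
  rw [← lintegral_const_mul' _ _ hne]
  refine setLIntegral_cylSet_le hF hRt hn k _ fun w hw => ?_
  rw [lintegral_const_mul' _ _ hne]
  have hmem : ∀ u ∈ pairCyl (towerMap F R hR) ω w, u ∈ cylSet (towerMap F R hR) n₀ ω 1 :=
    fun u hu => cylSet_anti hk (hw.xiElt_eq hn hF.disjoint hRt.const hu).2.1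
  obtain ⟨hw₁, hw₂⟩ := hw.ne_nil hn hk
  obtain ⟨a, b, ha, hb⟩ := hw.wordImage_eq hRt hk hw₁ hw₂
  have hD := h.one_le
  have hcomp := mass_compare hF hRt hn hw₁ hw₂ hw
    (ψ := couplingDensity (towerMap F R hR) n₀ ω J e Φ k) (D := 2 * D) (by linarith)
    (fun u hu => (h.bounds hn hF (hmem u hu) k).1.le)
    (fun u hu v hv => h.ratio_self hn hF hk
      (by rw [(hw.xiElt_eq hn hF.disjoint hRt.const hu).1]; exact hv))
    hE (E' := univ) MeasurableSet.univ
  simp only [preimage_univ, univ_inter] at hcomp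
  rw [ha, hb] at hcomp
  simp only [indicator_univ] at hcomp ⊢
  have hdt : d ≠ ⊤ := ne_top_of_le_ne_top (measure_ne_top _ _) (hd a b)
  rw [← ENNReal.mul_le_mul_iff_right hd0 hdt, mul_comm d]
  refine ((mul_le_mul_right (hd a b) _).trans hcomp).trans ?_
  calc _ ≤ ENNReal.ofReal (2 * D) ^ 2 * ((towerMeasure m R).prod (towerMeasure m R))
        {u | simRet (towerMap F R hR) n₀ u ∈ V} * _ := by
          gcongr
          exact inter_subset_left
    _ = (d * d⁻¹) * _ := by rw [ENNReal.mul_inv_cancel hd0 hdt, one_mul]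
    _ = _ := by ring

/-- The mass surviving `i` returns, one of whose waiting times lies in `V`. -/
lemma IsRegular.uncoupledMass_waitSet_le_prod (hn : 0 < n₀) (hF : IsWGM m F ω J β)
    (hRt : IsReturnTime R ω)
    (h : IsRegular (towerMap F R hR) n₀ ω J e Φ D) {q : ℕ} (hq : 1 ≤ q) {κ : ℝ} (hκ0 : 0 ≤ κ)
    (hκ1 : κ ≤ 1)
    (hκ : ∀ a b, ENNReal.ofReal κ * (ENNReal.ofReal (2 * D) ^ 2 *
      ((towerMeasure m R).prod (towerMeasure m R)) univ) ≤
      ((towerMeasure m R).prod (towerMeasure m R)) (goodSet (towerMap F R hR) n₀ ω q ∩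
        {p : Tower R | p.1.2 = 0 ∧ p.1.1 ∈ F '' ω a} ×ˢ
        {p : Tower R | p.1.2 = 0 ∧ p.1.1 ∈ F '' ω b}))
    (hμ0 : ((towerMeasure m R).prod (towerMeasure m R)) univ ≠ 0)
    (hΦ1 : ∫⁻ u, ENNReal.ofReal (Φ u) ∂((towerMeasure m R).prod (towerMeasure m R)) ≤ 1)
    {M : ℝ} (hM : ∀ u, Φ u ≤ M) {d : ℝ≥0∞} (hd0 : d ≠ 0)
    (hd : ∀ a b, d ≤ ((towerMeasure m R).prod (towerMeasure m R))
        ({p : Tower R | p.1.2 = 0 ∧ p.1.1 ∈ F '' ω a} ×ˢ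
        {p : Tower R | p.1.2 = 0 ∧ p.1.1 ∈ F '' ω b}))
    {δ : ℝ} (hδ0 : 0 ≤ δ) (hδ1 : δ ≤ 1) (hδ : q * δ ≤ (1 / 2) ^ q / (2 * D) * κ)
    {b : ℕ → ℝ≥0∞} (hb : ∀ j, 2⁻¹ ≤ b j) (hbe : ∀ j ≥ 1, b j = ENNReal.ofReal (1 - δ * e j))
    (V : Set ℕ∞) {k i : ℕ} (hk : k ≤ i) (hi : 1 ≤ i) :
    uncoupledMass m (towerMap F R hR) n₀ ω J e Φ (waitSet (towerMap F R hR) n₀ k V) i ≤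
      (2 ^ (q + 1) * ENNReal.ofReal M + 2 ^ (2 * q + 2) * (ENNReal.ofReal (2 * D) ^ 2 * d⁻¹)) *
        (∏ j ∈ Finset.Icc 1 i, b j) * ((towerMeasure m R).prod (towerMeasure m R))
        {u | simRet (towerMap F R hR) n₀ u ∈ V} := by
  have hT : Measurable (towerMap F R hR) := measurable_towerMap hRt.measurable hF.measurable_map
  set μ₂ := (towerMeasure m R).prod (towerMeasure m R) with hμ₂
  set Q := μ₂ {u | simRet (towerMap F R hR) n₀ u ∈ V} with hQ
  have hE : MeasurableSet {u | simRet (towerMap F R hR) n₀ u ∈ V} :=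
    measurable_simRet hT (MeasurableSet.of_discrete)
  have hfin := ne_top_of_le_ne_top ENNReal.one_ne_top hΦ1
  set H := waitSet (towerMap F R hR) n₀ k V with hH
  set a := uncoupledMass m (towerMap F R hR) n₀ ω J e Φ H with ha
  set P := ∏ j ∈ Finset.Icc 1 i, b j with hP
  set L := ENNReal.ofReal (2 * D) ^ 2 * d⁻¹ with hL
  have hchain : ∀ {H : Set (Tower R × Tower R)} {j₀ i : ℕ}, 1 ≤ j₀ →
      Saturated (towerMap F R hR) n₀ ω j₀ H → j₀ ≤ i → _ := fun h1 h2 h3 =>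
    h.uncoupledMass_le_prod hn hF hRt hq hκ0 hκ1 hκ hμ0 hfin hδ0 hδ1 hδ hb hbe h1 h2 h3
  have hmono : ∀ H' j, uncoupledMass m (towerMap F R hR) n₀ ω J e Φ H' (j + 1) ≤
      uncoupledMass m (towerMap F R hR) n₀ ω J e Φ H' j := fun H' j =>
    h.uncoupledMass_succ_le hn hF hRt H' j
  rcases Nat.eq_zero_or_pos k with rfl | hk0
  · -- the waiting time of the first return: bound the density by its supremum
    have h0 : a 0 ≤ ENNReal.ofReal M * Q := by
      calc a 0 = ∫⁻ u, H.indicator (fun u => ENNReal.ofReal (Φ u)) u ∂μ₂ := by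
            rw [ha, uncoupledMass, cylSet_zero, Measure.restrict_univ]
            rfl
        _ ≤ ∫⁻ u, H.indicator (fun _ => ENNReal.ofReal M) u ∂μ₂ :=
            lintegral_mono fun u => indicator_le_indicator (ENNReal.ofReal_le_ofReal (hM u))
        _ = ENNReal.ofReal M * Q := lintegral_indicator_const hE _
    have h2 : ∏ j ∈ Finset.Ico (1 + 1) (i + 1), b j ≤ 2 * P := by
      have := prod_le_pow_mul_prod hb (s := Finset.Ico (1 + 1) (i + 1)) (t := Finset.Icc 1 i)
        (fun j hj => by rw [Finset.mem_Ico] at hj; rw [Finset.mem_Icc]; omega)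
      have hcard : (Finset.Icc 1 i \ Finset.Ico (1 + 1) (i + 1)).card = 1 := by
        rw [Finset.card_eq_one]
        refine ⟨1, ?_⟩
        ext j
        simp only [Finset.mem_sdiff, Finset.mem_Icc, Finset.mem_Ico, Finset.mem_singleton]
        omega
      rwa [hcard, pow_one] at this
    calc a i ≤ 2 ^ q * (∏ j ∈ Finset.Ico (1 + 1) (i + 1), b j) * a 1 :=
          hchain le_rfl (saturated_waitSet 0 V) hi
      _ ≤ 2 ^ q * (2 * P) * (ENNReal.ofReal M * Q) := by
          gcongr
          exact (hmono H 0).trans h0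
      _ = (2 ^ (q + 1) * ENNReal.ofReal M) * P * Q := by ring
      _ ≤ _ := by
          gcongr
          exact le_self_add
  · have h1 : uncoupledMass m (towerMap F R hR) n₀ ω J e Φ univ 1 ≤ 1 := by
      refine (hmono univ 0).trans (le_trans (le_of_eq ?_) hΦ1)
      rw [uncoupledMass, cylSet_zero, Measure.restrict_univ]
      simp only [indicator_univ]
      rfl
    have hu : uncoupledMass m (towerMap F R hR) n₀ ω J e Φ univ k ≤
        2 ^ q * ∏ j ∈ Finset.Ico (1 + 1) (k + 1), b j := by
      refine (hchain le_rfl (fun _ _ _ => Iff.rfl) hk0).trans ?_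
      calc _ ≤ 2 ^ q * (∏ j ∈ Finset.Ico (1 + 1) (k + 1), b j) * 1 := by gcongr
        _ = _ := mul_one _
    have hak : a k ≤ L * Q * (2 ^ q * ∏ j ∈ Finset.Ico (1 + 1) (k + 1), b j) := by
      refine (h.uncoupledMass_waitSet_le hn hF hRt hd0 hd V hk0).trans ?_
      gcongr
    have hai : a i ≤ 2 ^ q * (∏ j ∈ Finset.Ico (k + 1 + 1) (i + 1), b j) * a k := by
      rcases hk.lt_or_eq with hlt | rfl
      · refine (hchain (Nat.le_add_left 1 k) (saturated_waitSet k V) hlt).trans ?_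
        gcongr
        exact hmono H k
      · rw [Finset.Ico_eq_empty (by omega), Finset.prod_empty, mul_one]
        calc a k = 1 * a k := (one_mul _).symm
          _ ≤ 2 ^ q * a k := by
            gcongr
            exact one_le_pow₀ (by norm_num)
    have hprod : (∏ j ∈ Finset.Ico (k + 1 + 1) (i + 1), b j) *
        ∏ j ∈ Finset.Ico (1 + 1) (k + 1), b j ≤ 2 ^ 2 * P := by
      have hdisj : Disjoint (Finset.Ico (k + 1 + 1) (i + 1)) (Finset.Ico (1 + 1) (k + 1)) := by
        rw [Finset.disjoint_left]
        intro j hj hj'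
        rw [Finset.mem_Ico] at hj hj'
        omega
      rw [← Finset.prod_union hdisj]
      refine (prod_le_pow_mul_prod hb (t := Finset.Icc 1 i) ?_).trans ?_
      · intro j hj
        simp only [Finset.mem_union, Finset.mem_Ico, Finset.mem_Icc] at hj ⊢
        omega
      · gcongr
        · norm_num
        -- only the indices `1` and `k + 1` are missing
        refine (Finset.card_le_card (t := {1, k + 1}) fun j hj => ?_).trans Finset.card_le_two
        simp only [Finset.mem_sdiff, Finset.mem_union, Finset.mem_Ico, Finset.mem_Icc,
          Finset.mem_insert, Finset.mem_singleton] at hj ⊢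
        omega
    calc a i ≤ 2 ^ q * (∏ j ∈ Finset.Ico (k + 1 + 1) (i + 1), b j) *
          (L * Q * (2 ^ q * ∏ j ∈ Finset.Ico (1 + 1) (k + 1), b j)) := hai.trans (by gcongr)
      _ = 2 ^ (2 * q) * L * Q * ((∏ j ∈ Finset.Ico (k + 1 + 1) (i + 1), b j) *
          ∏ j ∈ Finset.Ico (1 + 1) (k + 1), b j) := by ring
      _ ≤ 2 ^ (2 * q) * L * Q * (2 ^ 2 * P) := by gcongr
      _ = (2 ^ (2 * q + 2) * L) * P * Q := by ring
      _ ≤ _ := by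
          gcongr
          exact le_add_self

end Survival
/-! ### Matched and unmatched mass -/

section TotalVariation

/-- The positive and the negative part of `μ - ν` have mass at most `r` each. -/
lemma tvNorm_le {Y : Type*} [MeasurableSpace Y] {μ ν : Measure Y} [IsFiniteMeasure μ]
    [IsFiniteMeasure ν] {r : ℝ≥0∞} (hr : r ≠ ⊤)
    (h₁ : ∀ B, MeasurableSet B → μ B ≤ ν B + r) (h₂ : ∀ B, MeasurableSet B → ν B ≤ μ B + r) :
    tvNorm μ ν ≤ 2 * r.toReal := by
  set s := μ.toSignedMeasure - ν.toSignedMeasure with hs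
  have hval : ∀ B, MeasurableSet B → s B = μ.real B - ν.real B := fun B hB => by
    rw [hs, sub_apply, Measure.toSignedMeasure_apply_measurable hB,
      Measure.toSignedMeasure_apply_measurable hB]
  have hreal : ∀ (μ ν : Measure Y) [IsFiniteMeasure μ] [IsFiniteMeasure ν] (B : Set Y),
      μ B ≤ ν B + r → μ.real B ≤ ν.real B + r.toReal := by
    intro μ ν _ _ B h
    have := ENNReal.toReal_mono (ENNReal.add_ne_top.2 ⟨measure_ne_top ν B, hr⟩) h
    rwa [ENNReal.toReal_add (measure_ne_top ν B) hr] at this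
  obtain ⟨i, hi₁, hi₂, hi₃, hp, hn⟩ := s.toJordanDecomposition_spec
  have h1 : tvNorm μ ν = s i - s iᶜ := by
    rw [tvNorm, ← hs, SignedMeasure.totalVariation, Measure.coe_add, Pi.add_apply, hp, hn,
      SignedMeasure.toMeasureOfZeroLE_apply _ hi₂ hi₁ MeasurableSet.univ,
      SignedMeasure.toMeasureOfLEZero_apply _ hi₃ hi₁.compl MeasurableSet.univ,
      ENNReal.toReal_add ENNReal.coe_ne_top ENNReal.coe_ne_top]
    simp only [ENNReal.coe_toReal, NNReal.coe_mk, inter_univ]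
    ring
  rw [h1, hval i hi₁, hval _ hi₁.compl]
  have h2 := hreal μ ν i (h₁ i hi₁)
  have h3 := hreal ν μ iᶜ (h₂ _ hi₁.compl)
  linarith

end TotalVariation

section Matching

variable {X ι : Type*} {F : X → X} {R : X → ℕ} {hR : ∀ x, 0 < R x} {ω : ι → Set X} {J : X → ℝ}
  {β : ℝ} {n₀ : ℕ} {e : ℕ → ℝ} {Φ : Tower R × Tower R → ℝ} {D : ℝ}

/-- The points that have returned at least `i` times by time `n`. -/
def returnedSet (T : Tower R → Tower R) (n₀ : ℕ) (ω : ι → Set X) (n i : ℕ) :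
    Set (Tower R × Tower R) :=
  {u | u ∈ cylSet T n₀ ω i ∧ stopTime T n₀ i u ≤ n}

lemma returnedSet_zero {T : Tower R → Tower R} (n : ℕ) : returnedSet T n₀ ω n 0 = univ :=
  eq_univ_of_forall fun _ => ⟨mem_xiElt_zero, Nat.zero_le _⟩

lemma returnedSet_succ_subset {T : Tower R → Tower R} (n i : ℕ) :
    returnedSet T n₀ ω n (i + 1) ⊆ returnedSet T n₀ ω n i := by
  rintro u ⟨h1, h2⟩
  refine ⟨cylSet_anti (Nat.le_succ i) h1, ?_⟩
  rw [stopTime_succ] at h2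
  omega

lemma returnedSet_eq_empty (hn : 0 < n₀) {T : Tower R → Tower R} {n i : ℕ} (h : n < i) :
    returnedSet T n₀ ω n i = ∅ := by
  refine eq_empty_iff_forall_notMem.2 fun u hu => ?_
  have := length_le_stopTime hn i hu.1
  have := hu.2
  omega

variable [MeasurableSpace X] {m : Measure X} [Countable ι]

lemma measurableSet_returnedSet (hF : IsWGM m F ω J β) (hRt : IsReturnTime R ω) (hn : 0 < n₀)
    (n i : ℕ) : MeasurableSet (returnedSet (towerMap F R hR) n₀ ω n i) :=
  (measurableSet_cylSet hF hRt hn i).inter (measurableSet_le (measurable_stopTime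
    (measurable_towerMap hRt.measurable hF.measurable_map) i) measurable_const)

/-- The mass coupled at the `(k+1)`-st return has equal marginals under `T^n`: on the elements where
the weight does not vanish, the image under `T̃^{k+1}` is a square, on which the mass has constant
density. -/
lemma lintegral_matched_le [SFinite m] [SFinite (towerMeasure m R)] (hn : 0 < n₀)
    (hF : IsWGM m F ω J β) (hRt : IsReturnTime R ω) (n k : ℕ) {B : Set (Tower R)}
    (hB : MeasurableSet B)
    {f g : Tower R × Tower R → Tower R}
    (hfg : f = Prod.fst ∧ g = Prod.snd ∨ f = Prod.snd ∧ g = Prod.fst) :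
    ∫⁻ u in returnedSet (towerMap F R hR) n₀ ω n (k + 1),
      ENNReal.ofReal (couplingDensity (towerMap F R hR) n₀ ω J e Φ k u -
        couplingDensity (towerMap F R hR) n₀ ω J e Φ (k + 1) u) *
        B.indicator 1 ((towerMap F R hR)^[n] (f u)) ∂((towerMeasure m R).prod (towerMeasure m R)) ≤
    ∫⁻ u in returnedSet (towerMap F R hR) n₀ ω n (k + 1),
      ENNReal.ofReal (couplingDensity (towerMap F R hR) n₀ ω J e Φ k u -
        couplingDensity (towerMap F R hR) n₀ ω J e Φ (k + 1) u) *
        B.indicator 1 ((towerMap F R hR)^[n] (g u))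
        ∂((towerMeasure m R).prod (towerMeasure m R)) := by
  set T := towerMap F R hR with hTdef
  set μ₂ := (towerMeasure m R).prod (towerMeasure m R) with hμ₂
  have hT : Measurable T := measurable_towerMap hRt.measurable hF.measurable_map
  have hZm : ∀ w, MeasurableSet (pairCyl T ω w) := fun w =>
    measurableSet_pairCyl hF.measurableSet_elt hT w
  have hrm : MeasurableSet {u | stopTime T n₀ (k + 1) u ≤ n} :=
    measurableSet_le (measurable_stopTime hT _) measurable_const
  have hres : ∀ h : Tower R × Tower R → ℝ≥0∞, ∫⁻ u in returnedSet T n₀ ω n (k + 1), h u ∂μ₂ =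
      ∫⁻ u in cylSet T n₀ ω (k + 1), {u | stopTime T n₀ (k + 1) u ≤ n}.indicator h u ∂μ₂ := by
    intro h
    rw [lintegral_indicator hrm, Measure.restrict_restrict hrm, inter_comm]
    rfl
  rw [hres, hres]
  refine setLIntegral_cylSet_le hF hRt hn (k + 1) _ fun w hw => ?_
  obtain ⟨v, hv, -⟩ := hw.2
  have hSu : ∀ u ∈ pairCyl T ω w, stopTime T n₀ (k + 1) u = w.1.length := fun u hu =>
    (hw.xiElt_eq hn hF.disjoint hRt.const hu).2.2
  by_cases hlen : n < w.1.length
  · refine le_of_eq (setLIntegral_congr_fun (hZm w) fun u hu => ?_)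
    have : u ∉ {u | stopTime T n₀ (k + 1) u ≤ n} := by
      simp only [mem_ofPred_eq, hSu u hu, not_le, hlen]
    simp only [indicator_of_notMem this]
  · obtain ⟨t, rfl⟩ := Nat.exists_eq_add_of_le (not_lt.1 hlen)
    have hvx := hw.xiElt_eq hn hF.disjoint hRt.const hv
    set θ := sInf ((fun v => couplingDensity T n₀ ω J e Φ k v / indJac T n₀ J (k + 1) v) ''
      xiElt T n₀ ω (k + 1) v) with hθ
    set χ := couplingWeight T n₀ ω e (k + 1) v with hχ
    have hdiff : ∀ u ∈ pairCyl T ω w, couplingDensity T n₀ ω J e Φ k u -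
        couplingDensity T n₀ ω J e Φ (k + 1) u = χ * θ * indJac T n₀ J (k + 1) u := by
      intro u hu
      have hx := hw.xiElt_eq hn hF.disjoint hRt.const hu
      have hw' : couplingWeight T n₀ ω e (k + 1) u = χ := by
        refine couplingWeight_eq_of_mem hn hF.disjoint (Nat.le_add_left 1 k) ?_
        rw [hvx.1]
        exact hu
      have hval : couplingDensity T n₀ ω J e Φ (k + 1) u = couplingDensity T n₀ ω J e Φ k u -
          couplingWeight T n₀ ω e (k + 1) u * indJac T n₀ J (k + 1) u *
          sInf ((fun v => couplingDensity T n₀ ω J e Φ k v / indJac T n₀ J (k + 1) v) ''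
            xiElt T n₀ ω (k + 1) u) := rfl
      rw [hval, hw', hx.1, ← hvx.1]
      ring
    by_cases hlast : lastSame T n₀ ω ((indMap T n₀)^[k] v)
    swap
    · have hχ0 : χ = 0 := by
        rw [hχ, couplingWeight, if_neg]
        exact hlast
      refine le_of_eq (setLIntegral_congr_fun (hZm w) fun u hu => ?_)
      have := hdiff u hu
      rw [hχ0, zero_mul, zero_mul] at this
      simp only [indicator, this, ENNReal.ofReal_zero, zero_mul]
    -- the coordinates visit the same element last, so that the image is a square
    obtain ⟨hw₁, hw₂⟩ := hw.ne_nil hn (Nat.le_add_left 1 k)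
    rw [lastSame_iterate_iff hn hvx.2.1, hvx.2.2] at hlast
    have hsq : wordImage T ω w.1 hw₁ = wordImage T ω w.2 hw₂ := by
      have h1 := iterate_mem_towerElt_getLast w.1 hw₁ hv.1
      have h2 := iterate_mem_towerElt_getLast w.2 hw₂ hv.2
      rw [← hw.1] at h2
      rw [towerSame_iff_mem hF.disjoint h1] at hlast
      rw [wordImage, wordImage, towerElt_eq_of_mem hF.disjoint hlast h2]
    by_cases h0 : μ₂ (pairCyl T ω w) = 0
    · rw [setLIntegral_measure_zero _ _ h0]
      exact zero_le
    have hTt : Measurable T^[t] := hT.iterate t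
    have hcomp : ∀ {f : Tower R × Tower R → Tower R}, Measurable f →
        (∀ u, f (T^[w.1.length] u.1, T^[w.1.length] u.2) = T^[w.1.length] (f u)) →
        ∫⁻ u in pairCyl T ω w, {u | stopTime T n₀ (k + 1) u ≤ w.1.length + t}.indicator
          (fun u => ENNReal.ofReal (couplingDensity T n₀ ω J e Φ k u -
            couplingDensity T n₀ ω J e Φ (k + 1) u) *
            B.indicator 1 (T^[w.1.length + t] (f u))) u ∂μ₂ =
        ENNReal.ofReal (χ * θ) * ∫⁻ u in wordImage T ω w.1 hw₁ ×ˢ wordImage T ω w.1 hw₁,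
          B.indicator 1 (T^[t] (f u)) ∂μ₂ := by
      intro f hf hfT
      have hG : Measurable fun u : Tower R × Tower R =>
          B.indicator (1 : Tower R → ℝ≥0∞) (T^[t] (f u)) :=
        (measurable_one.indicator hB).comp (hTt.comp hf)
      have := lintegral_pairCyl (J := J) hF hRt hn hw₁ hw₂ hw h0 hG
      rw [← hsq] at this
      rw [← this, ← lintegral_const_mul' _ _ ENNReal.ofReal_ne_top]
      refine setLIntegral_congr_fun (hZm w) fun u hu => ?_
      have hmem : u ∈ {u | stopTime T n₀ (k + 1) u ≤ w.1.length + t} := by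
        simp only [mem_ofPred_eq, hSu u hu, Nat.le_add_right]
      simp only [indicator_of_mem hmem, hdiff u hu]
      rw [ENNReal.ofReal_mul' (indJac_pos hF.jac_pos _ _ _ _).le, mul_assoc, indMap_iterate,
        hSu u hu, hfT, add_comm w.1.length t, Function.iterate_add_apply]
    have hswap : ∫⁻ u in wordImage T ω w.1 hw₁ ×ˢ wordImage T ω w.1 hw₁,
          B.indicator (1 : Tower R → ℝ≥0∞) (T^[t] u.1) ∂μ₂ =
        ∫⁻ u in wordImage T ω w.1 hw₁ ×ˢ wordImage T ω w.1 hw₁,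
          B.indicator 1 (T^[t] u.2) ∂μ₂ := by
      rw [hμ₂, ← Measure.prod_restrict]
      exact (lintegral_prod_swap _).symm
    have h1 := hcomp (f := Prod.fst) measurable_fst fun u => rfl
    have h2 := hcomp (f := Prod.snd) measurable_snd fun u => rfl
    rcases hfg with ⟨rfl, rfl⟩ | ⟨rfl, rfl⟩
    · exact (h1.trans (by rw [hswap])).trans h2.symm |>.le
    · exact (h2.trans (by rw [hswap])).trans h1.symm |>.le

/-- The mass that has not been coupled by time `n`, sorted by the number of returns by that time. -/
noncomputable def unmatchedMass (m : Measure X) (T : Tower R → Tower R) (n₀ : ℕ) (ω : ι → Set X)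
    (J : X → ℝ) (e : ℕ → ℝ) (Φ : Tower R × Tower R → ℝ) (n : ℕ) : ℝ≥0∞ :=
  ∑ i ∈ Finset.range (n + 1),
    ∫⁻ u in returnedSet T n₀ ω n i \ returnedSet T n₀ ω n (i + 1),
      ENNReal.ofReal (couplingDensity T n₀ ω J e Φ i u)
      ∂((towerMeasure m R).prod (towerMeasure m R))

/-- Splitting an integral according to the number of returns and to whether the mass has been
coupled. -/
lemma IsRegular.lintegral_decompose (hn : 0 < n₀) (hF : IsWGM m F ω J β) (hRt : IsReturnTime R ω)
    (h : IsRegular (towerMap F R hR) n₀ ω J e Φ D) (n : ℕ) {G : Tower R × Tower R → ℝ≥0∞}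
    (hG : Measurable G) (k : ℕ) :
    ∫⁻ u, ENNReal.ofReal (Φ u) * G u ∂((towerMeasure m R).prod (towerMeasure m R)) =
      (∑ j ∈ Finset.range k, ∫⁻ u in returnedSet (towerMap F R hR) n₀ ω n (j + 1),
        ENNReal.ofReal (couplingDensity (towerMap F R hR) n₀ ω J e Φ j u -
          couplingDensity (towerMap F R hR) n₀ ω J e Φ (j + 1) u) * G u
          ∂((towerMeasure m R).prod (towerMeasure m R))) +
      (∑ j ∈ Finset.range k, ∫⁻ u in returnedSet (towerMap F R hR) n₀ ω n j \
          returnedSet (towerMap F R hR) n₀ ω n (j + 1),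
        ENNReal.ofReal (couplingDensity (towerMap F R hR) n₀ ω J e Φ j u) * G u
          ∂((towerMeasure m R).prod (towerMeasure m R))) +
      ∫⁻ u in returnedSet (towerMap F R hR) n₀ ω n k,
        ENNReal.ofReal (couplingDensity (towerMap F R hR) n₀ ω J e Φ k u) * G u
          ∂((towerMeasure m R).prod (towerMeasure m R)) := by
  have hm := fun i => measurableSet_returnedSet (hR := hR) hF hRt hn n i
  have hψ := fun i => measurable_couplingDensity (hR := hR) (e := e) hF hRt hn h.measurable i
  induction k with
  | zero =>
    rw [returnedSet_zero, Measure.restrict_univ, Finset.sum_range_zero, Finset.sum_range_zero,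
      zero_add, zero_add]
    rfl
  | succ k ih =>
    have hsplit : ∫⁻ u in returnedSet (towerMap F R hR) n₀ ω n k,
        ENNReal.ofReal (couplingDensity (towerMap F R hR) n₀ ω J e Φ k u) * G u
          ∂((towerMeasure m R).prod (towerMeasure m R)) =
        (∫⁻ u in returnedSet (towerMap F R hR) n₀ ω n (k + 1),
          ENNReal.ofReal (couplingDensity (towerMap F R hR) n₀ ω J e Φ k u -
          couplingDensity (towerMap F R hR) n₀ ω J e Φ (k + 1) u) * G u
          ∂((towerMeasure m R).prod (towerMeasure m R))) +
        (∫⁻ u in returnedSet (towerMap F R hR) n₀ ω n k \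
          returnedSet (towerMap F R hR) n₀ ω n (k + 1),
          ENNReal.ofReal (couplingDensity (towerMap F R hR) n₀ ω J e Φ k u) * G u
          ∂((towerMeasure m R).prod (towerMeasure m R))) +
        ∫⁻ u in returnedSet (towerMap F R hR) n₀ ω n (k + 1),
          ENNReal.ofReal (couplingDensity (towerMap F R hR) n₀ ω J e Φ (k + 1) u) * G u
          ∂((towerMeasure m R).prod (towerMeasure m R)) := by
      rw [← lintegral_inter_add_sdiff _ (returnedSet (towerMap F R hR) n₀ ω n k) (hm (k + 1)),
        inter_eq_self_of_subset_right (returnedSet_succ_subset n k), add_right_comm]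
      congr 1
      have hdm : Measurable fun u => ENNReal.ofReal
          (couplingDensity (towerMap F R hR) n₀ ω J e Φ k u -
            couplingDensity (towerMap F R hR) n₀ ω J e Φ (k + 1) u) * G u :=
        (((hψ k).sub (hψ (k + 1))).ennreal_ofReal).mul hG
      rw [← lintegral_add_left hdm]
      refine setLIntegral_congr_fun (hm (k + 1)) fun u hu => ?_
      obtain ⟨-, h2, -⟩ := h.bounds hn hF (cylSet_anti (Nat.le_add_left 1 k) hu.1) k
      have h3 := (h.bounds hn hF (cylSet_anti (Nat.le_add_left 1 k) hu.1) (k + 1)).1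
      rw [← add_mul, ← ENNReal.ofReal_add (by linarith) h3.le, sub_add_cancel]
    rw [ih, hsplit, Finset.sum_range_succ, Finset.sum_range_succ]
    ring

/-- The marginals of the matched mass cancel, so that the marginals of `Φ` under `T^n` differ by at
most the unmatched mass. -/
lemma IsRegular.matched_le [SFinite m] [SFinite (towerMeasure m R)] (hn : 0 < n₀)
    (hF : IsWGM m F ω J β) (hRt : IsReturnTime R ω)
    (h : IsRegular (towerMap F R hR) n₀ ω J e Φ D) (n : ℕ)
    {B : Set (Tower R)} (hB : MeasurableSet B)
    {f g : Tower R × Tower R → Tower R}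
    (hfg : f = Prod.fst ∧ g = Prod.snd ∨ f = Prod.snd ∧ g = Prod.fst) :
    ∫⁻ u, ENNReal.ofReal (Φ u) * B.indicator 1 ((towerMap F R hR)^[n] (f u))
        ∂((towerMeasure m R).prod (towerMeasure m R)) ≤
      (∫⁻ u, ENNReal.ofReal (Φ u) * B.indicator 1 ((towerMap F R hR)^[n] (g u))
        ∂((towerMeasure m R).prod (towerMeasure m R))) +
      unmatchedMass m (towerMap F R hR) n₀ ω J e Φ n := by
  have hT : Measurable (towerMap F R hR) := measurable_towerMap hRt.measurable hF.measurable_map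
  have hf : Measurable f := by
    rcases hfg with ⟨rfl, -⟩ | ⟨rfl, -⟩
    exacts [measurable_fst, measurable_snd]
  have hg : Measurable g := by
    rcases hfg with ⟨-, rfl⟩ | ⟨-, rfl⟩
    exacts [measurable_snd, measurable_fst]
  have hGm : ∀ {f : Tower R × Tower R → Tower R}, Measurable f → Measurable
      fun u => B.indicator (1 : Tower R → ℝ≥0∞) ((towerMap F R hR)^[n] (f u)) := fun hf =>
    (measurable_one.indicator hB).comp ((hT.iterate n).comp hf)
  rw [h.lintegral_decompose hn hF hRt n (hGm hf) (n + 1),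
    h.lintegral_decompose hn hF hRt n (hGm hg) (n + 1),
    returnedSet_eq_empty hn (Nat.lt_succ_self n)]
  simp only [Measure.restrict_empty, lintegral_zero_measure, add_zero]
  rw [add_assoc]
  refine add_le_add (Finset.sum_le_sum fun j _ => lintegral_matched_le hn hF hRt n j hB hfg) ?_
  refine le_add_left (Finset.sum_le_sum fun j _ => ?_)
  refine lintegral_mono fun u => ?_
  calc _ ≤ ENNReal.ofReal (couplingDensity (towerMap F R hR) n₀ ω J e Φ j u) * 1 := by
        gcongr
        exact indicator_le_self' (fun _ _ => zero_le) _
    _ = _ := mul_one _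

end Matching
/-! ### Waiting times of the unmatched mass -/

section Estimate

variable {X ι : Type*} {F : X → X} {R : X → ℕ} {hR : ∀ x, 0 < R x} {ω : ι → Set X} {J : X → ℝ}
  {β : ℝ} {n₀ : ℕ} {e : ℕ → ℝ} {Φ : Tower R × Tower R → ℝ} {D : ℝ}

/-- The waiting times exceeding `n / (i + 1)`. -/
def longWait (n i : ℕ) : Set ℕ∞ := {s | (n : ℝ≥0∞) / ((i : ℝ≥0∞) + 1) < (s : ℝ≥0∞)}

lemma mem_longWait_zero {n : ℕ} {s : ℕ∞} : s ∈ longWait n 0 ↔ (n : ℕ∞) < s := by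
  rw [longWait, mem_ofPred_eq, Nat.cast_zero, zero_add, div_one, ← ENat.toENNReal_coe,
    ENat.toENNReal_lt]

/-- If the `(i+1)`-st return does not take place by time `n`, one of the `i + 1` waiting times
exceeds `n / (i + 1)`. -/
lemma exists_mem_longWait {T : Tower R → Tower R} {n i : ℕ} {u : Tower R × Tower R}
    (hu : ∀ t, TowerSame ω (T^[t] u.1) (T^[t] u.1) ∧ TowerSame ω (T^[t] u.2) (T^[t] u.2))
    (h : u ∈ returnedSet T n₀ ω n i) (h' : u ∉ returnedSet T n₀ ω n (i + 1)) :
    ∃ k ≤ i, u ∈ waitSet T n₀ k (longWait n i) := by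
  by_contra hcon
  push Not at hcon
  have hle : ∀ k ≤ i, (simRet T n₀ ((indMap T n₀)^[k] u) : ℝ≥0∞) ≤
      (n : ℝ≥0∞) / ((i : ℝ≥0∞) + 1) := fun k hk => not_lt.1 (hcon k hk)
  have hi0 : (i : ℝ≥0∞) + 1 ≠ 0 := by simp
  have hit : (i : ℝ≥0∞) + 1 ≠ ⊤ := by simp
  have hnt : (n : ℝ≥0∞) / ((i : ℝ≥0∞) + 1) ≠ ⊤ := ENNReal.div_ne_top (by simp) hi0
  have hfin : ∀ k ≤ i, simRet T n₀ ((indMap T n₀)^[k] u) ≠ ⊤ := by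
    intro k hk htop
    have := hle k hk
    rw [htop, ENat.toENNReal_top, top_le_iff] at this
    exact hnt this
  refine h' ⟨?_, ?_⟩
  · refine mem_xiElt_add.2 ⟨h.1, mem_xiElt_one.2 ⟨hfin i le_rfl, rfl, fun t _ => ?_⟩⟩
    rw [indMap_iterate, ← Function.iterate_add_apply, ← Function.iterate_add_apply]
    exact hu _
  · have hsum : (stopTime T n₀ (i + 1) u : ℝ≥0∞) ≤ n := by
      rw [stopTime, Nat.cast_sum]
      calc _ ≤ ∑ _k ∈ Finset.range (i + 1), (n : ℝ≥0∞) / ((i : ℝ≥0∞) + 1) := by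
            refine Finset.sum_le_sum fun k hk => ?_
            have hk' := Nat.lt_succ_iff.1 (Finset.mem_range.1 hk)
            refine le_trans (le_of_eq ?_) (hle k hk')
            rw [← ENat.toENNReal_coe, ENat.natCast_toNat (hfin k hk')]
        _ = n := by
            rw [Finset.sum_const, Finset.card_range, nsmul_eq_mul, Nat.cast_succ,
              ENNReal.mul_div_cancel hi0 hit]
    exact_mod_cast hsum

variable [MeasurableSpace X] {m : Measure X} [Countable ι]

lemma IsRegular.unmatchedMass_le [SFinite m] [SFinite (towerMeasure m R)] (hn : 0 < n₀)
    (hF : IsWGM m F ω J β) (hRt : IsReturnTime R ω)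
    (h : IsRegular (towerMap F R hR) n₀ ω J e Φ D) (n : ℕ) :
    unmatchedMass m (towerMap F R hR) n₀ ω J e Φ n ≤
      (∫⁻ u in {u | (n : ℕ∞) < simRet (towerMap F R hR) n₀ u}, ENNReal.ofReal (Φ u)
        ∂((towerMeasure m R).prod (towerMeasure m R))) +
      ∑ i ∈ Finset.Icc 1 n, ∑ k ∈ Finset.range (i + 1),
        uncoupledMass m (towerMap F R hR) n₀ ω J e Φ
          (waitSet (towerMap F R hR) n₀ k (longWait n i)) i := by
  set T := towerMap F R hR with hTdef
  set μ₂ := (towerMeasure m R).prod (towerMeasure m R) with hμ₂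
  have hT : Measurable T := measurable_towerMap hRt.measurable hF.measurable_map
  have hae : ∀ᵐ u ∂μ₂, ∀ t, TowerSame ω (T^[t] u.1) (T^[t] u.1) ∧
      TowerSame ω (T^[t] u.2) (T^[t] u.2) := by
    have h0 := ae_forall_towerSame (hR := hR) hF hRt
    filter_upwards [Measure.quasiMeasurePreserving_fst.ae h0,
      Measure.quasiMeasurePreserving_snd.ae h0] with u h1 h2 t
    exact ⟨h1 t, h2 t⟩
  have hψ := fun i => (measurable_couplingDensity (hR := hR) (e := e) hF hRt hn
    h.measurable i).ennreal_ofReal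
  have hH : ∀ k V, MeasurableSet (waitSet T n₀ k V) := fun k V =>
    ((measurable_simRet hT).comp ((measurable_indMap hT).iterate k)) (MeasurableSet.of_discrete)
  rw [unmatchedMass, Finset.sum_range_succ', add_comm]
  refine add_le_add ?_ ?_
  · refine lintegral_mono_set' ?_
    filter_upwards [hae] with u hu hmem
    obtain ⟨k, hk, hw⟩ := exists_mem_longWait hu hmem.1 hmem.2
    obtain rfl := Nat.le_zero.1 hk
    exact mem_longWait_zero.1 hw
  · rw [Finset.range_eq_Ico, Finset.sum_Ico_add' (fun i => ∫⁻ u in returnedSet T n₀ ω n i \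
      returnedSet T n₀ ω n (i + 1), ENNReal.ofReal (couplingDensity T n₀ ω J e Φ i u) ∂μ₂) 0 n 1,
      zero_add]
    refine Finset.sum_le_sum fun i _ => ?_
    have hcm := measurableSet_cylSet (hR := hR) (n₀ := n₀) hF hRt hn i
    calc ∫⁻ u in returnedSet T n₀ ω n i \ returnedSet T n₀ ω n (i + 1),
          ENNReal.ofReal (couplingDensity T n₀ ω J e Φ i u) ∂μ₂
        ≤ ∫⁻ u in returnedSet T n₀ ω n i \ returnedSet T n₀ ω n (i + 1),
          ∑ k ∈ Finset.range (i + 1), (waitSet T n₀ k (longWait n i)).indicator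
            (fun u => ENNReal.ofReal (couplingDensity T n₀ ω J e Φ i u)) u ∂μ₂ := by
          refine setLIntegral_mono_ae' ((measurableSet_returnedSet hF hRt hn n i).diff
            (measurableSet_returnedSet hF hRt hn n (i + 1))) ?_
          filter_upwards [hae] with u hu hmem
          obtain ⟨k, hk, hw⟩ := exists_mem_longWait hu hmem.1 hmem.2
          rw [← indicator_of_mem hw (fun u => ENNReal.ofReal (couplingDensity T n₀ ω J e Φ i u))]
          exact Finset.single_le_sum_of_canonicallyOrdered (f := fun k =>
            (waitSet T n₀ k (longWait n i)).indicator
            (fun u => ENNReal.ofReal (couplingDensity T n₀ ω J e Φ i u)) u)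
            (Finset.mem_range.2 (Nat.lt_succ_of_le hk))
      _ ≤ ∫⁻ u in cylSet T n₀ ω i,
          ∑ k ∈ Finset.range (i + 1), (waitSet T n₀ k (longWait n i)).indicator
            (fun u => ENNReal.ofReal (couplingDensity T n₀ ω J e Φ i u)) u ∂μ₂ :=
          lintegral_mono_set fun u hu => hu.1.1
      _ = _ := lintegral_finsetSum _ fun k _ => (hψ i).indicator (hH k _)

end Estimate

/-! ### Bounds that are uniform in the densities -/

section Constants

variable {X ι : Type*} {F : X → X} {R : X → ℕ} {hR : ∀ x, 0 < R x} {ω : ι → Set X} {J : X → ℝ}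
  {β : ℝ} {n₀ : ℕ}

lemma exists_pos_ofReal_mul_le {c M : ℝ≥0∞} (hc : c ≠ 0) (hM0 : M ≠ 0) (hM : M ≠ ⊤) :
    ∃ κ : ℝ, 0 < κ ∧ κ ≤ 1 ∧ ENNReal.ofReal κ * M ≤ c := by
  have hr0 : min c 1 / M ≠ 0 := ENNReal.div_ne_zero.2 ⟨by
    rw [ne_eq, min_eq_iff]; simp [hc], hM⟩
  have hrt : min c 1 / M ≠ ⊤ :=
    ENNReal.div_ne_top (ne_top_of_le_ne_top ENNReal.one_ne_top (min_le_right _ _)) hM0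
  refine ⟨min 1 (min c 1 / M).toReal, lt_min one_pos (ENNReal.toReal_pos hr0 hrt),
    min_le_left _ _, ?_⟩
  calc _ ≤ ENNReal.ofReal (min c 1 / M).toReal * M := by
        gcongr
        exact min_le_right _ _
    _ = min c 1 := by rw [ENNReal.ofReal_toReal hrt, ENNReal.div_mul_cancel hM0 hM]
    _ ≤ c := min_le_left _ _

/-- A probability density of bounded variation is bounded in terms of the variation only. -/
lemma abs_le_of_variation_le [MeasurableSpace X] {μ : Measure (Tower R)} [IsFiniteMeasure μ]
    (hμ : μ ≠ 0) {φ : Tower R → ℝ} (hφ : Measurable φ)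
    (h1 : ∫⁻ p, ENNReal.ofReal (φ p) ∂μ = 1) (hb : ∃ K : ℝ, ∀ p, |φ p| ≤ K) {v : ℝ}
    (hv : variation F ω φ 0 ≤ v) (hpos : ∃ q, 0 < φ q) (p : Tower R) :
    |φ p| ≤ v + (μ univ).toReal⁻¹ := by
  have hvar : ∀ q, |φ p - φ q| ≤ v := fun q =>
    (abs_sub_le_variation hb zero_le).trans hv
  have hinv : 0 ≤ (μ univ).toReal⁻¹ := by positivity
  obtain ⟨q, hq⟩ := hpos
  obtain ⟨r, hr⟩ := exists_le_laverage hμ hφ.ennreal_ofReal.aemeasurable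
  have hμ' : (μ univ)⁻¹ ≠ ⊤ := ENNReal.inv_ne_top.2 (Measure.measure_univ_ne_zero.2 hμ)
  rw [laverage_eq, h1, one_div, ENNReal.ofReal_le_iff_le_toReal hμ', ENNReal.toReal_inv] at hr
  have h2 := abs_le.1 (hvar q)
  have h3 := abs_le.1 (hvar r)
  rw [abs_le]
  constructor <;> linarith

lemma towerMeasure_ne_zero [MeasurableSpace X] {m : Measure X} [SFinite m] (hm : m ≠ 0)
    (hRm : Measurable R) (hR : ∀ x, 0 < R x) : towerMeasure m R ≠ 0 := by
  intro h
  have h1 := towerMeasure_level (m := m) hRm univ 0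
  have h2 : (univ : Set X) ∩ {x | 0 < R x} = univ := by
    ext x
    simp [hR x]
  rw [h, h2, Measure.coe_zero, Pi.zero_apply] at h1
  exact hm (Measure.measure_univ_eq_zero.1 h1.symm)

/-- The oscillation of the densities, normalised by the Jacobians, is bounded uniformly in the
number of returns. -/
lemma partialDensity_ratio_le {φ₁ φ₂ : Tower R → ℝ} (hn : 0 < n₀)
    (hd : Pairwise fun i j => Disjoint (ω i) (ω j))
    (hc : ∀ i, ∀ x ∈ ω i, ∀ y ∈ ω i, R x = R y) (hJ : ∀ x, 0 < J x)
    (hβ : 0 < β) (hβ1 : β < 1) {c : ℝ} (hc0 : 0 ≤ c)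
    (hG : ∀ i, ∀ x ∈ ω i, ∀ y ∈ ω i, Real.log (J x / J y) ≤ c * epow β (sep F ω (F x) (F y)))
    {C C₁ C₂ C'' D₃ : ℝ} (hC'' : 0 ≤ C'')
    (h₁ : ∃ K : ℝ, ∀ p, |φ₁ p| ≤ K) (h₂ : ∃ K : ℝ, ∀ p, |φ₂ p| ≤ K)
    (hpos₁ : ∀ p q : Tower R, TowerSame ω p q → 0 < φ₁ p)
    (hpos₂ : ∀ p q : Tower R, TowerSame ω p q → 0 < φ₂ p)
    (hC₁ : 0 ≤ C₁) (hC₂ : 0 ≤ C₂) (hC : C₁ + C₂ ≤ C)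
    (hlog₁ : ∀ p q : Tower R, TowerSame ω p q → |Real.log (φ₁ p / φ₁ q)| ≤
      C₁ * variation₂ F ω φ₁ φ₂ (towerSep F ω p q) + C'' * epow β (towerSep F ω p q))
    (hlog₂ : ∀ p q : Tower R, TowerSame ω p q → |Real.log (φ₂ p / φ₂ q)| ≤
      C₂ * variation₂ F ω φ₁ φ₂ (towerSep F ω p q) + C'' * epow β (towerSep F ω p q))
    {e : ℕ → ℝ} (he : IsEpsSeq β D₃ (fun i => variation₂ F ω φ₁ φ₂ i) e)
    {ε : ℕ → Tower R × Tower R → ℝ} (hε : IsWeight (towerMap F R hR) n₀ ω e ε)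
    (k : ℕ) (x y : Tower R × Tower R) (h : y ∈ xiElt (towerMap F R hR) n₀ ω (k + 1) x) :
    partialDensity (towerMap F R hR) n₀ ω J ε (fun w => φ₁ w.1 * φ₂ w.2) k x /
        indJac (towerMap F R hR) n₀ J (k + 1) x ≤
      Real.exp (|C| * |D₃| + 2 * C'' * |D₃| + 2 * (c / (1 - β)) / β * |D₃|) *
        (partialDensity (towerMap F R hR) n₀ ω J ε (fun w => φ₁ w.1 * φ₂ w.2) k y /
          indJac (towerMap F R hR) n₀ J (k + 1) y) := by
  have hC0 : 0 ≤ C := by linarith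
  have hK : 0 ≤ c / (1 - β) := div_nonneg hc0 (by linarith)
  have hpos : ∀ u, u ∈ xiElt (towerMap F R hR) n₀ ω 1 u → 0 < φ₁ u.1 * φ₂ u.2 := fun u hu => by
    obtain ⟨h1, h2⟩ := xiElt_one_towerSame hn le_rfl hu
    exact mul_pos (hpos₁ _ _ h1) (hpos₂ _ _ h2)
  have hv0 : 0 ≤ variation₂ F ω φ₁ φ₂ (k + 1 : ℕ) := variation₂_nonneg _
  refine (partialDensity_ratio_le_distBound (hR := hR) hn hd hc hJ hβ hβ1 hc0 hG hε
    (fun k hk => (he.pos k hk).le) hpos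
    (g := C * variation₂ F ω φ₁ φ₂ (k + 1 : ℕ) + 2 * C'' * β ^ (k + 1)) (by positivity)
    (fun u v huv => product_ratio_le hn hc hβ hβ1 hC'' h₁ h₂ hpos₁ hpos₂ hC₁ hC₂ hC hlog₁ hlog₂
      (Nat.le_add_left 1 k) huv) k (Nat.lt_succ_self k) x y h).trans ?_
  have hy1 : y ∈ xiElt (towerMap F R hR) n₀ ω 1 y :=
    xiElt_anti (Nat.le_add_left 1 k) y (mem_xiElt_self hd (mem_xiElt_comm h))
  have hpy := (partialDensity_pos_and_bounds hd hJ hε hpos k).1 y hy1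
  refine mul_le_mul_of_nonneg_right (Real.exp_le_exp.2 ?_)
    (div_nonneg hpy.le (indJac_pos hJ _ _ _ _).le)
  refine (distBound_le hβ he hC0 hC'' hK k hv0).trans ?_
  rw [abs_of_nonneg hC0]
  have := le_abs_self D₃
  gcongr

/-- Each step removes a fixed proportion of `ε_i` from the densities `Φ̃_i`. -/
lemma tildeDensity_le {e : ℕ → ℝ} {Φ : Tower R × Tower R → ℝ} {D : ℝ}
    (hd : Pairwise fun i j => Disjoint (ω i) (ω j)) (hJ : ∀ x, 0 < J x)
    {T : Tower R → Tower R} {ε : ℕ → ℝ} (hε : IsWeight T n₀ ω e fun k _ => ε k)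
    (hΦ : ∀ u, u ∈ xiElt T n₀ ω 1 u → 0 < Φ u) (hD : 0 < D)
    (hratio : ∀ k, ∀ u v, v ∈ xiElt T n₀ ω (k + 1) u →
      partialDensity T n₀ ω J (fun k _ => ε k) Φ k u / indJac T n₀ J (k + 1) u ≤
        D * (partialDensity T n₀ ω J (fun k _ => ε k) Φ k v / indJac T n₀ J (k + 1) v))
    {D₄ : ℝ} (hD₄ : D ≤ D₄) {i : ℕ} (hi : 1 ≤ i) {u : Tower R × Tower R}
    (hu : u ∈ xiElt T n₀ ω i u) :
    tildeDensity T n₀ ω J ε Φ i u ≤ (1 - ε i / D₄) * tildeDensity T n₀ ω J ε Φ (i - 1) u := by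
  obtain ⟨k, rfl⟩ := Nat.exists_eq_add_of_le' hi
  rw [Nat.add_sub_cancel, tildeDensity_eq_partialDensity, tildeDensity_eq_partialDensity]
  have h0 := hε.nonneg (k + 1) hi u
  refine (partialDensity_succ_le hJ hD h0 hu (hratio k u)).trans ?_
  have hpos := (partialDensity_pos_and_bounds hd hJ hε hΦ k).1 u
    (xiElt_anti (Nat.le_add_left 1 k) u hu)
  refine mul_le_mul_of_nonneg_right ?_ hpos.le
  have h2 : ε (k + 1) / D₄ ≤ ε (k + 1) / D := div_le_div_of_nonneg_left h0 hD hD₄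
  linarith

end Constants
/-! ### The coupling estimate -/

section Final

variable {X ι : Type*} [MeasurableSpace X] {m : Measure X} {F : X → X} {R : X → ℕ}
  {hR : ∀ x, 0 < R x} {ω : ι → Set X} {J : X → ℝ} {β : ℝ} {n₀ : ℕ} {e : ℕ → ℝ}
  {Φ : Tower R × Tower R → ℝ} {D : ℝ} [Countable ι]

/-- The coupling inequality: only the unmatched mass contributes to the total variation. -/
lemma IsRegular.tvNorm_le_unmatchedMass [SFinite m] [SFinite (towerMeasure m R)] (hn : 0 < n₀)
    (hF : IsWGM m F ω J β) (hRt : IsReturnTime R ω)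
    (h : IsRegular (towerMap F R hR) n₀ ω J e Φ D) {lam₁ lam₂ : Measure (Tower R)}
    [IsProbabilityMeasure lam₁] [IsProbabilityMeasure lam₂]
    (hP : lam₁.prod lam₂ = ((towerMeasure m R).prod (towerMeasure m R)).withDensity
      fun u => ENNReal.ofReal (Φ u)) (n : ℕ) {r : ℝ≥0∞} (hr : r ≠ ⊤)
    (hU : unmatchedMass m (towerMap F R hR) n₀ ω J e Φ n ≤ r) :
    tvNorm (lam₁.map (towerMap F R hR)^[n]) (lam₂.map (towerMap F R hR)^[n]) ≤ 2 * r.toReal := by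
  have hT : Measurable (towerMap F R hR) := measurable_towerMap hRt.measurable hF.measurable_map
  have key : ∀ {f : Tower R × Tower R → Tower R} {lam : Measure (Tower R)}, Measurable f →
      (lam₁.prod lam₂).map f = lam → ∀ B, MeasurableSet B →
      lam.map (towerMap F R hR)^[n] B = ∫⁻ u, ENNReal.ofReal (Φ u) *
        B.indicator 1 ((towerMap F R hR)^[n] (f u))
        ∂((towerMeasure m R).prod (towerMeasure m R)) := by
    intro f lam hf hlam B hB
    have hG : Measurable (B.indicator (1 : Tower R → ℝ≥0∞)) := measurable_one.indicator hB
    have hGn : Measurable fun p => B.indicator (1 : Tower R → ℝ≥0∞) ((towerMap F R hR)^[n] p) :=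
      hG.comp (hT.iterate n)
    rw [← lintegral_indicator_one hB, lintegral_map hG (hT.iterate n), ← hlam,
      lintegral_map hGn hf, hP]
    exact lintegral_withDensity_eq_lintegral_mul _ h.measurable.ennreal_ofReal (hGn.comp hf)
  have h1 := key measurable_fst (lam := lam₁) (by simp [Measure.map_fst_prod])
  have h2 := key measurable_snd (lam := lam₂) (by simp [Measure.map_snd_prod])
  refine tvNorm_le hr (fun B hB => ?_) fun B hB => ?_
  · rw [h1 B hB, h2 B hB]
    refine (h.matched_le hn hF hRt n hB (Or.inl ⟨rfl, rfl⟩)).trans ?_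
    gcongr
  · rw [h1 B hB, h2 B hB]
    refine (h.matched_le hn hF hRt n hB (Or.inr ⟨rfl, rfl⟩)).trans ?_
    gcongr

lemma prod_withDensity_eq [SFinite m] [SFinite (towerMeasure m R)] (hF : IsWGM m F ω J β)
    (hRt : IsReturnTime R ω) {φ₁ φ₂ : Tower R → ℝ} (h₁ : Measurable φ₁) (h₂ : Measurable φ₂)
    (hpos₁ : ∀ p q : Tower R, TowerSame ω p q → 0 < φ₁ p) :
    ((towerMeasure m R).withDensity fun p => ENNReal.ofReal (φ₁ p)).prod
      ((towerMeasure m R).withDensity fun p => ENNReal.ofReal (φ₂ p)) =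
    ((towerMeasure m R).prod (towerMeasure m R)).withDensity
      fun u => ENNReal.ofReal (φ₁ u.1 * φ₂ u.2) := by
  rw [prod_withDensity h₁.ennreal_ofReal h₂.ennreal_ofReal]
  refine withDensity_congr_ae ?_
  have h0 : ∀ᵐ p ∂(towerMeasure m R), TowerSame ω p p := by
    have hcov := iUnion_towerElt_compl_null (m := m) hF hRt
    filter_upwards [compl_mem_ae_iff.2 hcov] with p hp
    rw [compl_compl] at hp
    obtain ⟨i, hi⟩ := mem_iUnion.1 hp
    exact towerSame_iff.2 ⟨i, hi, hi⟩
  filter_upwards [Measure.quasiMeasurePreserving_fst.ae h0] with u hu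
  exact (ENNReal.ofReal_mul (hpos₁ _ _ hu).le).symm

/-- The constant in the estimate depends on `Φ` only through the bounds `M` for its supremum and `D`
for its oscillation. -/
lemma IsRegular.tvNorm_le_sum [IsFiniteMeasure m] [IsFiniteMeasure (towerMeasure m R)]
    (hn : 0 < n₀) (hF : IsWGM m F ω J β) (hRt : IsReturnTime R ω)
    (h : IsRegular (towerMap F R hR) n₀ ω J e Φ D) {q : ℕ} (hq : 1 ≤ q) {κ : ℝ} (hκ0 : 0 ≤ κ)
    (hκ1 : κ ≤ 1)
    (hκ : ∀ a b, ENNReal.ofReal κ * (ENNReal.ofReal (2 * D) ^ 2 *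
      ((towerMeasure m R).prod (towerMeasure m R)) univ) ≤
      ((towerMeasure m R).prod (towerMeasure m R)) (goodSet (towerMap F R hR) n₀ ω q ∩
        {p : Tower R | p.1.2 = 0 ∧ p.1.1 ∈ F '' ω a} ×ˢ
        {p : Tower R | p.1.2 = 0 ∧ p.1.1 ∈ F '' ω b}))
    (hμ0 : ((towerMeasure m R).prod (towerMeasure m R)) univ ≠ 0)
    {M : ℝ} (hM : ∀ u, Φ u ≤ M) {d : ℝ≥0∞} (hd0 : d ≠ 0)
    (hd : ∀ a b, d ≤ ((towerMeasure m R).prod (towerMeasure m R))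
        ({p : Tower R | p.1.2 = 0 ∧ p.1.1 ∈ F '' ω a} ×ˢ
        {p : Tower R | p.1.2 = 0 ∧ p.1.1 ∈ F '' ω b}))
    {δ : ℝ} (hδ0 : 0 ≤ δ) (hδ1 : δ ≤ 1) (hδ : q * δ ≤ (1 / 2) ^ q / (2 * D) * κ)
    {lam₁ lam₂ : Measure (Tower R)} [IsProbabilityMeasure lam₁] [IsProbabilityMeasure lam₂]
    (hP : lam₁.prod lam₂ = ((towerMeasure m R).prod (towerMeasure m R)).withDensity
      fun u => ENNReal.ofReal (Φ u)) (n : ℕ) :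
    tvNorm (lam₁.map (towerMap F R hR)^[n]) (lam₂.map (towerMap F R hR)^[n]) ≤
      2 * ((lam₁.prod lam₂) {u | (n : ℕ∞) < simRet (towerMap F R hR) n₀ u}).toReal +
        2 * (2 ^ (q + 1) * ENNReal.ofReal M +
          2 ^ (2 * q + 2) * (ENNReal.ofReal (2 * D) ^ 2 * d⁻¹)).toReal *
        ∑ i ∈ Finset.Icc 1 n, (∏ j ∈ Finset.Icc 1 i, (1 - δ * e j)) * ((i : ℝ) + 1) *
          (((towerMeasure m R).prod (towerMeasure m R))
            {u | (n : ℝ≥0∞) / ((i : ℝ≥0∞) + 1) <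
              (simRet (towerMap F R hR) n₀ u : ℝ≥0∞)}).toReal := by
  have hT : Measurable (towerMap F R hR) := measurable_towerMap hRt.measurable hF.measurable_map
  have hSm : MeasurableSet {u | (n : ℕ∞) < simRet (towerMap F R hR) n₀ u} :=
    measurable_simRet hT (MeasurableSet.of_discrete (s := Ioi (n : ℕ∞)))
  set μ₂ := (towerMeasure m R).prod (towerMeasure m R) with hμ₂
  set K := 2 ^ (q + 1) * ENNReal.ofReal M + 2 ^ (2 * q + 2) * (ENNReal.ofReal (2 * D) ^ 2 * d⁻¹)
    with hK
  have hKt : K ≠ ⊤ := by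
    refine ENNReal.add_ne_top.2 ⟨ENNReal.mul_ne_top (by simp) ENNReal.ofReal_ne_top,
      ENNReal.mul_ne_top (by simp) (ENNReal.mul_ne_top
        (ENNReal.pow_ne_top ENNReal.ofReal_ne_top) (ENNReal.inv_ne_top.2 hd0))⟩
  set Q : ℕ → ℝ≥0∞ := fun i => μ₂ {u | (n : ℝ≥0∞) / ((i : ℝ≥0∞) + 1) <
    (simRet (towerMap F R hR) n₀ u : ℝ≥0∞)} with hQ
  -- the value of `e` at `0` is irrelevant
  set b : ℕ → ℝ≥0∞ := fun j => if j = 0 then 1 else ENNReal.ofReal (1 - δ * e j) with hb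
  have hbe : ∀ j ≥ 1, b j = ENNReal.ofReal (1 - δ * e j) := fun j hj => if_neg (by omega)
  have hle : ∀ j ≥ 1, 1 / 2 ≤ 1 - δ * e j := fun j hj => by
    have h1 := h.nonneg_weight j hj
    have h2 := h.weight_le j hj
    nlinarith
  have hb2 : ∀ j, 2⁻¹ ≤ b j := by
    intro j
    rcases Nat.eq_zero_or_pos j with rfl | hj
    · simp [hb]
    · rw [hbe j hj, ← ENNReal.ofReal_ofNat 2, ← ENNReal.ofReal_inv_of_pos two_pos]
      refine ENNReal.ofReal_le_ofReal ?_
      rw [← one_div]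
      exact hle j hj
  have hbt : ∀ i, ∏ j ∈ Finset.Icc 1 i, b j =
      ENNReal.ofReal (∏ j ∈ Finset.Icc 1 i, (1 - δ * e j)) := by
    intro i
    have hj : ∀ j ∈ Finset.Icc 1 i, 1 ≤ j := fun j hj => (Finset.mem_Icc.1 hj).1
    rw [ENNReal.ofReal_prod_of_nonneg fun j hj' => by linarith [hle j (hj j hj')]]
    exact Finset.prod_congr rfl fun j hj' => hbe j (hj j hj')
  have hΦ1 : ∫⁻ u, ENNReal.ofReal (Φ u) ∂μ₂ ≤ 1 := by
    rw [← setLIntegral_univ, ← withDensity_apply _ MeasurableSet.univ, ← hP]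
    exact prob_le_one
  have hPS : ∫⁻ u in {u | (n : ℕ∞) < simRet (towerMap F R hR) n₀ u}, ENNReal.ofReal (Φ u) ∂μ₂ =
      (lam₁.prod lam₂) {u | (n : ℕ∞) < simRet (towerMap F R hR) n₀ u} := by
    rw [hP, withDensity_apply _ hSm]
  have hterm : ∀ i : ℕ, ((i : ℝ≥0∞) + 1) * (K * (∏ j ∈ Finset.Icc 1 i, b j) * Q i) ≠ ⊤ := by
    intro i
    rw [hbt]
    exact ENNReal.mul_ne_top (by simp) (ENNReal.mul_ne_top (ENNReal.mul_ne_top hKt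
      ENNReal.ofReal_ne_top) (measure_ne_top _ _))
  have hsum :
      ∑ i ∈ Finset.Icc 1 n, ((i : ℝ≥0∞) + 1) * (K * (∏ j ∈ Finset.Icc 1 i, b j) * Q i) ≠ ⊤ :=
    ENNReal.sum_ne_top.2 fun i _ => hterm i
  have hU : unmatchedMass m (towerMap F R hR) n₀ ω J e Φ n ≤
      (lam₁.prod lam₂) {u | (n : ℕ∞) < simRet (towerMap F R hR) n₀ u} +
      ∑ i ∈ Finset.Icc 1 n, ((i : ℝ≥0∞) + 1) * (K * (∏ j ∈ Finset.Icc 1 i, b j) * Q i) := by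
    refine (h.unmatchedMass_le hn hF hRt n).trans ?_
    rw [hPS]
    refine add_le_add le_rfl (Finset.sum_le_sum fun i hi => ?_)
    have hi1 := (Finset.mem_Icc.1 hi).1
    calc _ ≤ ∑ _k ∈ Finset.range (i + 1), K * (∏ j ∈ Finset.Icc 1 i, b j) * Q i :=
          Finset.sum_le_sum fun k hk => h.uncoupledMass_waitSet_le_prod hn hF hRt hq hκ0 hκ1 hκ hμ0
            hΦ1 hM hd0 hd hδ0 hδ1 hδ hb2 hbe (longWait n i)
            (Nat.lt_succ_iff.1 (Finset.mem_range.1 hk)) hi1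
      _ = _ := by
          rw [Finset.sum_const, Finset.card_range, nsmul_eq_mul, Nat.cast_succ]
  refine (h.tvNorm_le_unmatchedMass hn hF hRt hP n
    (ENNReal.add_ne_top.2 ⟨measure_ne_top _ _, hsum⟩) hU).trans (le_of_eq ?_)
  rw [ENNReal.toReal_add (measure_ne_top _ _) hsum, ENNReal.toReal_sum fun i _ => hterm i, mul_add,
    mul_assoc 2 K.toReal,
    Finset.mul_sum _ _ K.toReal]
  congr 2
  refine Finset.sum_congr rfl fun i _ => ?_
  have h1 : 0 ≤ ∏ j ∈ Finset.Icc 1 i, (1 - δ * e j) :=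
    Finset.prod_nonneg fun j hj => by linarith [hle j (Finset.mem_Icc.1 hj).1]
  rw [hbt, ENNReal.toReal_mul, ENNReal.toReal_mul, ENNReal.toReal_mul, ENNReal.toReal_ofReal h1,
    ENNReal.toReal_add (by simp) (by simp)]
  simp only [ENNReal.toReal_natCast, ENNReal.toReal_one]
  ring

end Final

end WGM

theorem mainTheorem3 {X ι : Type*} [MeasurableSpace X] [Countable ι]
    (m : Measure X) [IsFiniteMeasure m] (hm : m ≠ 0)
    (F : X → X) (ω : ι → Set X) (J : X → ℝ) (β : ℝ) (hF : WGM.IsWGM m F ω J β)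
    (R : X → ℕ) (hRpos : ∀ x, 0 < R x) (hR : WGM.IsReturnTime R ω)
    (hRint : Integrable (fun x => (R x : ℝ)) m)
    (hap : WGM.Aperiodic m F ω) (hcop : WGM.HasCoprimeBlock m F R ω)
    (n₀ : ℕ) (hn₀ : WGM.IsWaitingTime m F R hRpos ω n₀)
    (C'' : ℝ) (hC'' : 0 < C'') (C v D₃ : ℝ) :
    -- the constants depend only on the tower, on `n₀`, `C''`, and on (bounds for) `C_Φ`,
    -- `v_0(Φ)` and the constant `D₃` of the sequence `ε'`
    ∃ δ D₄ D₅ : ℝ, 0 < δ ∧ δ ≤ 1 ∧ 1 < D₄ ∧ 0 < D₅ ∧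
      ∀ (lam₁ lam₂ : Measure (WGM.Tower R)) [IsProbabilityMeasure lam₁]
        [IsProbabilityMeasure lam₂] (φ₁ φ₂ : WGM.Tower R → ℝ),
        Measurable φ₁ → Measurable φ₂ →
        lam₁ = (WGM.towerMeasure m R).withDensity (fun p => ENNReal.ofReal (φ₁ p)) →
        lam₂ = (WGM.towerMeasure m R).withDensity (fun p => ENNReal.ofReal (φ₂ p)) →
        WGM.InIPlus F ω β C'' φ₁ → WGM.InIPlus F ω β C'' φ₂ →
        -- the constant `C_Φ = C₁ + C₂`
        ∀ C₁ C₂ : ℝ, 0 ≤ C₁ → 0 ≤ C₂ → C₁ + C₂ ≤ C →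
        (∀ p q : WGM.Tower R, WGM.TowerSame ω p q →
          |Real.log (φ₁ p / φ₁ q)| ≤
            C₁ * WGM.variation₂ F ω φ₁ φ₂ (WGM.towerSep F ω p q) +
              C'' * WGM.epow β (WGM.towerSep F ω p q)) →
        (∀ p q : WGM.Tower R, WGM.TowerSame ω p q →
          |Real.log (φ₂ p / φ₂ q)| ≤
            C₂ * WGM.variation₂ F ω φ₁ φ₂ (WGM.towerSep F ω p q) +
              C'' * WGM.epow β (WGM.towerSep F ω p q)) →
        WGM.variation₂ F ω φ₁ φ₂ 0 ≤ v →
        ∀ ε' : ℕ → ℝ, WGM.IsEpsSeq β D₃ (fun i => WGM.variation₂ F ω φ₁ φ₂ i) ε' →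
          -- `ε_i = δ ε'_i` and `D₄` have the decay property of the densities `Φ̃_i`
          (∀ i : ℕ, 1 ≤ i → ∀ u : WGM.Tower R × WGM.Tower R,
            u ∈ WGM.xiElt (WGM.towerMap F R hRpos) n₀ ω i u →
            WGM.tildeDensity (WGM.towerMap F R hRpos) n₀ ω J (fun j => δ * ε' j)
                (fun w => φ₁ w.1 * φ₂ w.2) i u ≤
              (1 - δ * ε' i / D₄) *
                WGM.tildeDensity (WGM.towerMap F R hRpos) n₀ ω J (fun j => δ * ε' j)
                  (fun w => φ₁ w.1 * φ₂ w.2) (i - 1) u) ∧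
          -- the estimate
          ∀ n : ℕ, 1 ≤ n →
            WGM.tvNorm (lam₁.map (WGM.towerMap F R hRpos)^[n])
                (lam₂.map (WGM.towerMap F R hRpos)^[n]) ≤
              2 * ((lam₁.prod lam₂)
                  {u | (n : ℕ∞) < WGM.simRet (WGM.towerMap F R hRpos) n₀ u}).toReal +
                D₅ * ∑ i ∈ Finset.Icc 1 n,
                  (∏ j ∈ Finset.Icc 1 i, (1 - δ * ε' j / D₄)) * ((i : ℝ) + 1) *
                    (((WGM.towerMeasure m R).prod (WGM.towerMeasure m R))
                      {u | (n : ℝ≥0∞) / ((i : ℝ≥0∞) + 1) <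
                        (WGM.simRet (WGM.towerMap F R hRpos) n₀ u : ℝ≥0∞)}).toReal := by
  have hn := hn₀.1
  have hfin := WGM.towerMeasure_finite hR.measurable hRint
  have hμ := WGM.towerMeasure_ne_zero hm hR.measurable hRpos
  have hμ0 : ((WGM.towerMeasure m R).prod (WGM.towerMeasure m R)) univ ≠ 0 := by
    rw [← univ_prod_univ, Measure.prod_prod]
    exact mul_ne_zero (Measure.measure_univ_ne_zero.2 hμ) (Measure.measure_univ_ne_zero.2 hμ)
  obtain ⟨c, hc0, hG⟩ := hF.gibbs
  obtain ⟨l, hl0, hl⟩ := hF.long_branches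
  obtain ⟨q, hq, g, hg0, hg⟩ := WGM.exists_goodSet_lower_bound hF hR hap hcop hRpos hn
  have hβ := hF.beta_pos
  have hβ1 := hF.beta_lt_one
  -- `D` bounds the oscillation of the densities on the elements
  set D := Real.exp (|C| * |D₃| + 2 * C'' * |D₃| + 2 * (c / (1 - β)) / β * |D₃|) with hD
  have hD1 : 1 ≤ D := by
    refine Real.one_le_exp ?_
    have : 0 ≤ c / (1 - β) := div_nonneg hc0.le (by linarith)
    positivity
  obtain ⟨κ, hκ0, hκ1, hκ⟩ := WGM.exists_pos_ofReal_mul_le hg0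
    (M := ENNReal.ofReal (2 * D) ^ 2 * ((WGM.towerMeasure m R).prod (WGM.towerMeasure m R)) univ)
    (mul_ne_zero (pow_ne_zero _ (by simp; linarith)) hμ0)
    (ENNReal.mul_ne_top (ENNReal.pow_ne_top ENNReal.ofReal_ne_top) (measure_ne_top _ _))
  -- `x * ε'_j` is the proportion of the mass coupled within `q` returns
  set x := (1 / 2 : ℝ) ^ q / (2 * D) * κ with hx
  have hx0 : 0 < x := by positivity
  -- `d` bounds the measure of the images of the elements from below
  set d := ENNReal.ofReal l * ENNReal.ofReal l with hd
  have hd0 : d ≠ 0 := by simp [hd, hl0]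
  have hdAB : ∀ a b, d ≤ ((WGM.towerMeasure m R).prod (WGM.towerMeasure m R))
      ({p : WGM.Tower R | p.1.2 = 0 ∧ p.1.1 ∈ F '' ω a} ×ˢ
        {p : WGM.Tower R | p.1.2 = 0 ∧ p.1.1 ∈ F '' ω b}) := by
    have h1 : ∀ a, ENNReal.ofReal l ≤
        WGM.towerMeasure m R {p : WGM.Tower R | p.1.2 = 0 ∧ p.1.1 ∈ F '' ω a} := fun a => by
      have : {x | 0 < R x} = univ := eq_univ_of_forall hRpos
      rw [WGM.towerMeasure_level hR.measurable, this, inter_univ]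
      exact hl a
    intro a b
    rw [Measure.prod_prod]
    exact mul_le_mul' (h1 a) (h1 b)
  -- `M` bounds the densities `φ₁` and `φ₂`
  set M := v + ((WGM.towerMeasure m R) univ).toReal⁻¹ with hM
  -- the summand `q / (2 x)` ensures `(1 - ε' / (2 D₄)) ^ q ≥ 1 - x ε'`
  set D₄ := D + 1 + q / (2 * x) with hD₄
  have hq0 : 0 ≤ q / (2 * x) := by positivity
  have hD₄0 : 0 < D₄ := by linarith
  refine ⟨1 / 2, D₄, 2 * (2 ^ (q + 1) * ENNReal.ofReal (M * M) +
    2 ^ (2 * q + 2) * (ENNReal.ofReal (2 * D) ^ 2 * d⁻¹)).toReal + 1, by norm_num, by norm_num,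
    by linarith, by positivity, ?_⟩
  intro lam₁ lam₂ _ _ φ₁ φ₂ hm₁ hm₂ hlam₁ hlam₂ hI₁ hI₂ C₁ C₂ hC₁ hC₂ hC hlog₁ hlog₂ hv ε' hε'
  have hb₁ := hI₁.1.1
  have hb₂ := hI₂.1.1
  have hpos₁ : ∀ p q : WGM.Tower R, WGM.TowerSame ω p q → 0 < φ₁ p := fun p q h =>
    (hI₁.2.choose_spec.2 p q h).1
  have hpos₂ : ∀ p q : WGM.Tower R, WGM.TowerSame ω p q → 0 < φ₂ p := fun p q h =>
    (hI₂.2.choose_spec.2 p q h).1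
  have hpos : ∀ u, u ∈ WGM.xiElt (WGM.towerMap F R hRpos) n₀ ω 1 u → 0 < φ₁ u.1 * φ₂ u.2 :=
    fun u hu => by
      obtain ⟨h1, h2⟩ := WGM.xiElt_one_towerSame hn le_rfl hu
      exact mul_pos (hpos₁ _ _ h1) (hpos₂ _ _ h2)
  have hratio : ∀ {ε : ℕ → WGM.Tower R × WGM.Tower R → ℝ},
      WGM.IsWeight (WGM.towerMap F R hRpos) n₀ ω ε' ε → _ := fun hε =>
    WGM.partialDensity_ratio_le hn hF.disjoint hR.const hF.jac_pos hβ hβ1 hc0.le hG hC''.le hb₁ hb₂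
      hpos₁ hpos₂ hC₁ hC₂ hC hlog₁ hlog₂ hε' hε
  refine ⟨fun i hi u hu => ?_, fun n _ => ?_⟩
  · have hε : WGM.IsWeight (WGM.towerMap F R hRpos) n₀ ω ε' fun k _ => 1 / 2 * ε' k :=
      { nonneg := fun k hk _ => by have := hε'.pos k hk; positivity
        le := fun k _ _ => by linarith
        le_half := hε'.le_half
        const := fun _ _ _ _ _ => rfl }
    exact WGM.tildeDensity_le hF.disjoint hF.jac_pos hε hpos (by linarith) (hratio hε)
      (by linarith) hi hu
  · have hreg : WGM.IsRegular (WGM.towerMap F R hRpos) n₀ ω J ε' (fun w => φ₁ w.1 * φ₂ w.2) D :=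
      { measurable := (hm₁.comp measurable_fst).mul (hm₂.comp measurable_snd)
        pos := hpos
        nonneg_weight := fun k hk => (hε'.pos k hk).le
        weight_le := hε'.le_half
        one_le := hD1
        ratio := hratio (WGM.isWeight_couplingWeight hn hF.disjoint
          (fun k hk => (hε'.pos k hk).le) hε'.le_half) }
    have hbound : ∀ {lam : Measure (WGM.Tower R)} [IsProbabilityMeasure lam] {φ : WGM.Tower R → ℝ},
        Measurable φ → lam = (WGM.towerMeasure m R).withDensity (fun p => ENNReal.ofReal (φ p)) →
        (∃ K : ℝ, ∀ p, |φ p| ≤ K) → (∀ p q : WGM.Tower R, WGM.TowerSame ω p q → 0 < φ p) →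
        WGM.variation F ω φ 0 ≤ v → ∀ p, |φ p| ≤ M := by
      intro lam _ φ hφ hlam hb hpos hv
      have hae := WGM.ae_forall_towerSame (hR := hRpos) hF hR
      have : (ae (WGM.towerMeasure m R)).NeBot := ae_neBot.2 hμ
      obtain ⟨p, hp⟩ := hae.exists
      refine WGM.abs_le_of_variation_le hμ hφ ?_ hb hv ⟨p, hpos p p (hp 0)⟩
      rw [← setLIntegral_univ, ← withDensity_apply _ MeasurableSet.univ, ← hlam]
      exact measure_univ
    have hΦM : ∀ u : WGM.Tower R × WGM.Tower R, φ₁ u.1 * φ₂ u.2 ≤ M * M := fun u => by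
      have h1 := hbound hm₁ hlam₁ hb₁ hpos₁ ((le_max_left _ _).trans hv) u.1
      have h2 := hbound hm₂ hlam₂ hb₂ hpos₂ ((le_max_right _ _).trans hv) u.2
      calc φ₁ u.1 * φ₂ u.2 ≤ |φ₁ u.1 * φ₂ u.2| := le_abs_self _
        _ = |φ₁ u.1| * |φ₂ u.2| := abs_mul _ _
        _ ≤ M * M := mul_le_mul h1 h2 (abs_nonneg _) ((abs_nonneg _).trans h1)
    have hP : lam₁.prod lam₂ = ((WGM.towerMeasure m R).prod (WGM.towerMeasure m R)).withDensity
        fun u => ENNReal.ofReal (φ₁ u.1 * φ₂ u.2) := by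
      rw [hlam₁, hlam₂]
      exact WGM.prod_withDensity_eq hF hR hm₁ hm₂ hpos₁
    have hδ : q * (1 / 2 / D₄) ≤ x := by
      have h1 : q / (2 * x) ≤ D₄ := by linarith
      rw [div_le_iff₀ (by positivity)] at h1
      rw [← mul_div_assoc, div_le_iff₀ hD₄0]
      linarith
    have hδ1 : 1 / 2 / D₄ ≤ 1 := by
      rw [div_le_one hD₄0]
      linarith
    have hmain := hreg.tvNorm_le_sum hn hF hR hq hκ0.le hκ1 (fun a b => hκ.trans (hg a b)) hμ0 hΦM
      hd0 hdAB (by positivity) hδ1 hδ hP n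
    have hcoef : ∀ j, 1 / 2 / D₄ * ε' j = 1 / 2 * ε' j / D₄ := fun j => by ring
    simp only [hcoef] at hmain
    refine hmain.trans ?_
    have hnn : 0 ≤ ∑ i ∈ Finset.Icc 1 n,
        (∏ j ∈ Finset.Icc 1 i, (1 - 1 / 2 * ε' j / D₄)) * ((i : ℝ) + 1) *
          (((WGM.towerMeasure m R).prod (WGM.towerMeasure m R))
            {u | (n : ℝ≥0∞) / ((i : ℝ≥0∞) + 1) <
              (WGM.simRet (WGM.towerMap F R hRpos) n₀ u : ℝ≥0∞)}).toReal := by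
      refine Finset.sum_nonneg fun i _ => mul_nonneg (mul_nonneg (Finset.prod_nonneg fun j hj => ?_)
        (by positivity)) ENNReal.toReal_nonneg
      have h1 := hε'.le_half j (Finset.mem_Icc.1 hj).1
      have h2 : 1 / 2 * ε' j / D₄ ≤ 1 := by
        rw [div_le_one hD₄0]
        linarith
      linarith
    exact add_le_add le_rfl (mul_le_mul_of_nonneg_right (by linarith) hnn)
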